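/- **Setting.** Let $N,M\ge 1$, $a<b$, $\mathcal Z=[a,b]^M$, and let $\mathcal S\subseteq\mathbb R^2$ be the region of interest, with a reference antenna at ${\bf p}_{ref}\in\mathcal S$, sensors at known positions ${\bf p}_i(t)\in\mathcal S\setminus\{{\bf p}_{ref}\}$ ($1\le i\le N$, $t\in\mathbb N$), and a position ${\bf q}\in\mathcal S\setminus\{{\bf p}_{ref}\}$. For $x\in\mathbb R^M$ write $\theta(x)=(x(2),\dots,x(M))$. For each $\theta\in[a,b]^{M-1}$ let $\mathcal R(\cdot,\cdot,\theta)$ be a symmetric positive definite kernel on $\mathcal S$ (all its Gram matrices are positive semidefinite) with $\mathcal R({\bf u},{\bf u},\theta)=\eta^2(\theta)$ for all ${\bf u}\in\mathcal S$. Put $\alpha^{\bf u}=-10\log_{10}\|{\bf u}-{\bf p}_{ref}\|_2$, $A^{\bf u}=[\alpha^{\bf u}\,0\cdots0]\in\mathbb R^{1\times M}$, let $A_t$ be the $N\times M$ matrix with rows $A^{{\bf p}_i(t)}$, and let $$\Sigma_t(x)_{ij}=\mathcal R({\bf p}_i(t),{\bf p}_j(t),\theta(x)),\qquad C_t(x)=\Sigma_t(x)+\sigma_\xi^2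 I,\qquad \sigma_t^{\bf q}(x)_j=\mathcal R({\bf q},{\bf p}_j(t),\theta(x)).$$ Assume that the entries of $\Sigma_t$ are Lipschitz on $\mathcal Z$ with a constant independent of $t$, that $\inf_{t}\inf_{x\in\mathcal Z}\lambda_{\min}(C_t(x))>1$, and that $\theta\mapsto\mathcal R({\bf q},{\bf p}_j(t),\theta)$ is continuous on $[a,b]^{M-1}$ for all $t,j$. The hidden state $X_t$, $t\ge-1$, is a time-homogeneous Markov process with $X_t\in\mathcal Z$ almost surely. The log-magnitudes at the sensors and at ${\bf q}$ are, for $t\in\mathbb N$, $$y_t^i=\alpha^{{\bf p}_i(t)}X_t(1)+\sigma_t^i+\xi_t^i,\qquad y_t({\bf q})=\alpha^{\bf q}X_t(1)+\sigma^{\bf q}_t+\xi^{\bf q}_t ,$$ where, conditionally on the whole state trajectory, the vectors $(\sigma_t^1,\dots,\sigma_t^N,\sigma_t^{\bf q})$, $t\in\mathbb N$, are independent, centered and Gaussian with covariances given by $\mathcal R(\cdot,\cdot,\theta(X_t))$ at the positions ${\bf p}_1(t),\dots,{\bf p}_N(t),{\bf q}$, and where all $\xi_t^i,\xi_t^{\bf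 q}$ are i.i.d. $\mathcal N(0,\sigma_\xi^2)$ and independent of the states and of the shadowing. Let ${\bf y}_t=(y_t^1,\dots,y_t^N)^T$ and $\mathscr Y_t=\sigma({\bf y}_0,\dots,{\bf y}_t)$. **Quantization.** Divide $\mathcal Z$ into $L_S=L^M$ congruent hypercubic cells with centers $x^1,\dots,x^{L_S}$, and let $\mathcal Q_{L_S}$ map each point of a cell to its center. Let $Q_t$, $t\ge -1$, be one of the following. (i) *Markovian quantization*: $X_t=f(X_{t-1},W_t)$ with $W_t\in\mathcal W$ i.i.d. and independent of $X_{-1}$, where $f$ is measurable, $f(x,W_t)\in\mathcal Z$ almost surely for each $x\in\mathcal Z$, and $f(\cdot,w)$ is Lipschitz on $\mathcal Z$ for every $w\in\mathcal W$; $Q_{-1}=\mathcal Q_{L_S}(X_{-1})$ and $Q_t=\mathcal Q_{L_S}(f(Q_{t-1},W_t))$. (ii) *Marginal quantization*: $Q_t=\mathcal Q_{L_S}(X_t)$, where the transition kernel $\mathcal K$ of $X_t$ is conditionally regular, that is, for Lebesgue-almost every $x\in\mathcal Z$ there is a bounded sequence $\delta_{L_S}(x)\ge0$, tending to $0$ as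 $L_S\to\infty$, with $|\mathcal K(A|x)-\mathcal K(A|\mathcal Q_{L_S}(x))|\le\delta_{L_S}(x)/L_S$ for every cell $A$. In either case let $P$ be a column stochastic matrix with $P(i,j)=\mathcal P(Q_t=x^i\mid Q_{t-1}=x^j)$ for all $t\in\mathbb N$ and all $j$ with $\mathcal P(Q_{t-1}=x^j)>0$; in case (ii) it is part of the assumptions that these probabilities do not depend on $t$ (as is so if $X_t$ is stationary). Let ${\bf X}=[x^1\cdots x^{L_S}]$, and $$\lambda_t(x)=\frac{\exp\left(-\tfrac12({\bf y}_t-A_tx)^TC_t(x)^{-1}({\bf y}_t-A_tx)\right)}{\sqrt{\det C_t(x)}},\qquad \Lambda_t=\mathrm{diag}(\lambda_t(x^1),\dots,\lambda_t(x^{L_S})),$$ $$E_{-1}(l)=\mathcal P(Q_{-1}=x^l),\qquad E_t=\Lambda_tPE_{t-1}\quad(t\in\mathbb N),$$ $$\phi_t(x,v)=A^{\bf q}x+\sigma_t^{\bf q}(x)^TC_t(x)^{-1}(v-A_tx),\qquad \boldsymbol\phi_t({\bf y}_t)=[\phi_t(x^1,{\bf y}_t)\cdots\phi_t(x^{L_S},{\bf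 y}_t)]^T.$$ **Theorem.** Each $y_t({\bf q})$ is square integrable, and $\|E_t\|_1>0$ for all $t\in\mathbb N$, all outcomes and all $L$. Let $$\mathcal E^{L_S}(y_{t+\rho}({\bf q})\mid\mathscr Y_t)=\begin{cases}\left\langle\boldsymbol\phi_t({\bf y}_t),\,E_t/\|E_t\|_1\right\rangle,&\rho=0,\\ A^{\bf q}{\bf X}P^\rho E_t/\|E_t\|_1,&\rho\ge1.\end{cases}$$ Then for every $T\in\mathbb N$ and every real $C\ge1$ there is a measurable set $\widehat\Omega_T\subseteq\Omega$ with $\mathcal P(\widehat\Omega_T)\ge1-(T+1)^{1-CN}e^{-CN}$ such that, for every $\rho\ge0$, $$\sup_{0\le t\le T}\ \sup_{\omega\in\widehat\Omega_T}\left|\mathcal E^{L_S}(y_{t+\rho}({\bf q})\mid\mathscr Y_t)(\omega)-\mathbb E\{y_{t+\rho}({\bf q})\mid\mathscr Y_t\}(\omega)\right|\longrightarrow0\qquad(L\to\infty).$$ (The conditional expectation may be any fixed version; $\widehat\Omega_T$ may depend on the version.) -/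

import Mathlib

open MeasureTheory ProbabilityTheory Filter
open scoped Topology ENNReal NNReal Matrix

noncomputable section

namespace ChannelPrediction

/-- The plane in which the network lives. -/
abbrev Plane : Type := EuclideanSpace ℝ (Fin 2)

/-- State space `ℝ^M` with `M = K + 1`: coordinate `0` is the path loss exponent `μ`, the last `K`
coordinates are the parameters `θ` of the shadowing covariance kernel. -/
abbrev State (K : ℕ) : Type := Fin (K + 1) → ℝ

/-- Index set of the `(n + 1) ^ (K + 1)` quantization cells: `n + 1` intervals per dimension. -/
abbrev Cells (K n : ℕ) : Type := Fin (K + 1) → Fin (n + 1)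

/-- The deterministic data of a network of `N` sensors with a state of dimension `K + 1`. -/
structure Network (N K : ℕ) where
  /-- The state is confined to the hypercube `[a, b] ^ (K + 1)`. -/
  a : ℝ
  b : ℝ
  /-- The planar region of interest. -/
  S : Set Plane
  /-- The position of the reference antenna. -/
  pref : Plane
  /-- `p t i` is the position of sensor `i` at time `t`. -/
  p : ℕ → Fin N → Plane
  /-- The autocorrelation kernel of the shadowing, with parameter `θ`. -/
  R : Plane → Plane → (Fin K → ℝ) → ℝ
  /-- The shadowing power. -/
  etaSq : (Fin K → ℝ) → ℝ
  /-- The variance of the multipath fading noise. -/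
  xiVar : ℝ≥0

namespace Network

variable {N K : ℕ} (G : Network N K)

/-- The hypercube `Z = [a, b] ^ M`. -/
def box : Set (State K) := Set.Icc (fun _ => G.a) (fun _ => G.b)

/-- The range `[a, b] ^ (M - 1)` of the kernel parameters. -/
def paramBox : Set (Fin K → ℝ) := Set.Icc (fun _ => G.a) (fun _ => G.b)

/-- The path loss coefficient `-10 log₁₀ ‖u - p_ref‖` of position `u`. -/
def pathLoss (u : Plane) : ℝ := -10 * Real.logb 10 (dist u G.pref)

/-- The row `A^u = [α^u 0 … 0]`. -/
def row (u : Plane) : State K := Pi.single 0 (G.pathLoss u)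

/-- The observation matrix `A_t`, with rows `A^{p_i(t)}`. -/
def obsMatrix (t : ℕ) : Matrix (Fin N) (Fin (K + 1)) ℝ := Matrix.of fun i => G.row (G.p t i)

/-- The covariance matrix `Σ_t(x)` of the shadowing at the sensors in state `x`. -/
def shadowCov (t : ℕ) (x : State K) : Matrix (Fin N) (Fin N) ℝ :=
  Matrix.of fun i j => G.R (G.p t i) (G.p t j) (Fin.tail x)

/-- `C_t(x) = Σ_t(x) + σ_ξ² I`. -/
def obsCov (t : ℕ) (x : State K) : Matrix (Fin N) (Fin N) ℝ :=
  G.shadowCov t x + (G.xiVar : ℝ) • (1 : Matrix (Fin N) (Fin N) ℝ)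

/-- The vector `σ_t^q(x)` of the covariances between position `q` and the sensors. -/
def crossCov (q : Plane) (t : ℕ) (x : State K) : Fin N → ℝ :=
  fun j => G.R q (G.p t j) (Fin.tail x)

/-- Standing assumptions on the network. -/
structure Admissible : Prop where
  lt : G.a < G.b
  pref_mem : G.pref ∈ G.S
  p_mem : ∀ t i, G.p t i ∈ G.S
  p_ne : ∀ t i, G.p t i ≠ G.pref
  /-- `R(·, ·, θ)` is a symmetric positive definite kernel on the region. -/
  posDef : ∀ θ ∈ G.paramBox, ∀ (m : ℕ) (u : Fin m → Plane), (∀ i, u i ∈ G.S) →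
    (Matrix.of fun i j => G.R (u i) (u j) θ).PosSemidef
  diag : ∀ θ ∈ G.paramBox, ∀ u ∈ G.S, G.R u u θ = G.etaSq θ
  /-- The entries of `Σ_t` are Lipschitz on the hypercube, uniformly in time. -/
  lipschitz : ∃ KS : ℝ, 0 ≤ KS ∧ ∀ t i j, ∀ x ∈ G.box, ∀ x' ∈ G.box,
    |G.shadowCov t x i j - G.shadowCov t x' i j| ≤ KS * ∑ k, |x k - x' k|
  /-- The infimum over time and state of the least eigenvalue of `C_t(x)` exceeds `1`. -/
  expansive : ∃ c : ℝ, 1 < c ∧ ∀ t, ∀ x ∈ G.box, ∀ r ∈ spectrum ℝ (G.obsCov t x), c ≤ r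

/-! ### The observation model

Sensors are indexed by `some i`, and the imaginary sensor at `q` by `none`. The state is indexed
so that `X 0` is the initial state, at time `-1`, and `X (t + 1)` is the state at time `t`. -/

/-- The positions of the sensors and of the imaginary sensor at `q`. -/
def augPos (q : Plane) (t : ℕ) : Option (Fin N) → Plane
  | none => q
  | some i => G.p t i

/-- The covariance matrix of the shadowing at the sensors and at `q`. -/
def augCov (q : Plane) (t : ℕ) (x : State K) : Matrix (Option (Fin N)) (Option (Fin N)) ℝ :=
  Matrix.of fun i j => G.R (G.augPos q t i) (G.augPos q t j) (Fin.tail x)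

variable {Ω : Type*} [MeasurableSpace Ω]

/-- The log-magnitude at time `t` at sensor `some i` or, for `none`, at position `q`:
`α μ(X_t) + σ_t + ξ_t`. -/
def augObs (q : Plane) (X : ℕ → Ω → State K) (sh : ℕ → Ω → EuclideanSpace ℝ (Option (Fin N)))
    (ξ : ℕ → Option (Fin N) → Ω → ℝ) (t : ℕ) (i : Option (Fin N)) (ω : Ω) : ℝ :=
  G.pathLoss (G.augPos q t i) * X (t + 1) ω 0 + sh t ω i + ξ t i ω

/-- The probabilistic structure of the observations: state `X`, shadowing `sh`, fading noise `ξ`. -/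
structure IsObservationModel (μ : Measure Ω) (q : Plane) (X : ℕ → Ω → State K)
    (sh : ℕ → Ω → EuclideanSpace ℝ (Option (Fin N))) (ξ : ℕ → Option (Fin N) → Ω → ℝ) :
    Prop where
  measurable_X : ∀ k, Measurable (X k)
  measurable_sh : ∀ t, Measurable (sh t)
  measurable_xi : ∀ t i, Measurable (ξ t i)
  X_mem : ∀ k, ∀ᵐ ω ∂μ, X k ω ∈ G.box
  /-- Conditionally on the state trajectory, the shadowing vectors at distinct times are
  independent, and the one at time `t` is a centered Gaussian vector whose covariance is given by
  the kernel at the current state. -/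
  shadowing : ∀ (m : ℕ) (B : ℕ → Set (EuclideanSpace ℝ (Option (Fin N)))),
    (∀ t, MeasurableSet (B t)) →
    μ[Set.indicator {ω | ∀ t < m, sh t ω ∈ B t} (fun _ => (1 : ℝ)) |
        MeasurableSpace.comap (fun ω k => X k ω) inferInstance]
      =ᵐ[μ] fun ω => ∏ t ∈ Finset.range m,
        (multivariateGaussian 0 (G.augCov q t (X (t + 1) ω))).real (B t)
  /-- The fading noise is white in time and space ... -/
  xi_indep : iIndepFun (fun (k : ℕ × Option (Fin N)) => ξ k.1 k.2) μ
  /-- ... centered Gaussian ... -/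
  xi_law : ∀ t i, μ.map (ξ t i) = gaussianReal 0 G.xiVar
  /-- ... and independent of the state and of the shadowing. -/
  xi_indep_state : IndepFun (fun ω => ((fun k => X k ω), (fun t => sh t ω)))
    (fun ω t i => ξ t i ω) μ

/-! ### Quantization -/

/-- The cell of a point of the hypercube. Cells are half-open in each coordinate, except that the
last interval of each coordinate is closed. -/
def cellOf (n : ℕ) (x : State K) : Cells K n := fun i =>
  ⟨min ⌊(x i - G.a) / (G.b - G.a) * (n + 1)⌋₊ n, Nat.lt_succ_of_le (min_le_right _ _)⟩

/-- The cell with index `l`, as a subset of the hypercube. -/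
def cell (n : ℕ) (l : Cells K n) : Set (State K) := {x | x ∈ G.box ∧ G.cellOf n x = l}

/-- The center of mass of the cell with index `l`. -/
def center (n : ℕ) (l : Cells K n) : State K := fun i =>
  G.a + ((l i : ℝ) + 1 / 2) * ((G.b - G.a) / (n + 1))

/-- The quantizer. -/
def quantizer (n : ℕ) (x : State K) : State K := G.center n (G.cellOf n x)

/-- The Markovian quantization of the state (as a cell index), started at the quantized initial
state. -/
def markovianQuantization {Wt : Type*} (n : ℕ) (X0 : Ω → State K) (f : State K → Wt → State K)
    (W : ℕ → Ω → Wt) : ℕ → Ω → Cells K n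
  | 0, ω => G.cellOf n (X0 ω)
  | k + 1, ω => G.cellOf n (f (G.center n (markovianQuantization n X0 f W k ω)) (W k ω))

/-- The marginal quantization of the state (as a cell index). -/
def marginalQuantization (n : ℕ) (X : ℕ → Ω → State K) (k : ℕ) (ω : Ω) : Cells K n :=
  G.cellOf n (X k ω)

/-- `X_t = f(X_{t-1}, W_t)` with white noise `W` and `f` Lipschitz in the state. -/
structure IsLipschitzDynamics {d : ℕ} (μ : Measure Ω) (X : ℕ → Ω → State K)
    (Wset : Set (Fin d → ℝ)) (f : State K → (Fin d → ℝ) → State K) (W : ℕ → Ω → (Fin d → ℝ)) :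
    Prop where
  measurable_f : Measurable (Function.uncurry f)
  measurable_W : ∀ t, Measurable (W t)
  W_mem : ∀ t, ∀ᵐ ω ∂μ, W t ω ∈ Wset
  W_indep : iIndepFun W μ
  W_ident : ∀ t, IdentDistrib (W t) (W 0) μ μ
  init_indep : IndepFun (X 0) (fun ω t => W t ω) μ
  f_mem : ∀ x ∈ G.box, ∀ t, ∀ᵐ ω ∂μ, f x (W t ω) ∈ G.box
  lipschitz : ∀ w ∈ Wset, ∃ Kf : ℝ≥0, LipschitzOnWith Kf (fun x => f x w) G.box
  step : ∀ t, ∀ᵐ ω ∂μ, X (t + 1) ω = f (X t ω) (W t ω)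

/-- `X` is a Markov chain with transition kernel `κ`. -/
def IsMarkovChain (μ : Measure Ω) (X : ℕ → Ω → State K) (κ : Kernel (State K) (State K)) : Prop :=
  ∀ (k : ℕ) (B : Set (State K)), MeasurableSet B →
    μ[Set.indicator (X (k + 1) ⁻¹' B) (fun _ => (1 : ℝ)) |
        ⨆ i ≤ k, MeasurableSpace.comap (X i) inferInstance]
      =ᵐ[μ] fun ω => (κ (X k ω)).real B

/-- Conditional regularity of type I. -/
def CRTypeI (κ : Kernel (State K) (State K)) : Prop :=
  ∀ᵐ x ∂(volume.restrict G.box), ∃ δ : ℕ → ℝ, (∀ n, 0 ≤ δ n) ∧ BddAbove (Set.range δ) ∧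
    Tendsto δ atTop (𝓝 0) ∧
    ∀ n l, |(κ x).real (G.cell n l) - (κ (G.quantizer n x)).real (G.cell n l)|
      ≤ δ n / ((n + 1 : ℝ) ^ (K + 1))

/-- Conditional regularity of type II: type I and, with the same sequence, regularity of a
density. -/
def CRTypeII (κ : Kernel (State K) (State K)) : Prop :=
  ∃ dens : State K → State K → ℝ, Measurable (Function.uncurry dens) ∧ (∀ x y, 0 ≤ dens x y) ∧
    (∀ᵐ x ∂(volume : Measure (State K)),
      κ x = volume.withDensity fun y => ENNReal.ofReal (dens x y)) ∧
    ∀ᵐ x ∂(volume.restrict G.box), ∃ δ : ℕ → ℝ, (∀ n, 0 ≤ δ n) ∧ BddAbove (Set.range δ) ∧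
      Tendsto δ atTop (𝓝 0) ∧
      (∀ n l, |(κ x).real (G.cell n l) - (κ (G.quantizer n x)).real (G.cell n l)|
        ≤ δ n / ((n + 1 : ℝ) ^ (K + 1))) ∧
      ∀ n y, |dens x y - dens (G.quantizer n x) y| ≤ δ n

/-- Conditional regularity: of type I or of type II. -/
def ConditionallyRegular (κ : Kernel (State K) (State K)) : Prop :=
  G.CRTypeI κ ∨ G.CRTypeII κ

end Network

/-- `P` is a (column stochastic, time invariant) transition matrix of the finite valued `Z`:
`P i j = ℙ(Z_t = i | Z_{t-1} = j)` whenever the conditioning event has positive probability. -/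
structure IsTransitionMatrix {Ω : Type*} [MeasurableSpace Ω] {ι : Type*} [Fintype ι]
    (μ : Measure Ω) (Z : ℕ → Ω → ι) (P : Matrix ι ι ℝ) : Prop where
  nonneg : ∀ i j, 0 ≤ P i j
  colSum : ∀ j, ∑ i, P i j = 1
  eq_cond : ∀ k i j, μ {ω | Z k ω = j} ≠ 0 →
    P i j = (ProbabilityTheory.cond μ {ω | Z k ω = j}).real {ω | Z (k + 1) ω = i}

/-- The mean `𝔼{e_Z}` of the standard basis vector with random index `Z`. -/
def meanBasisVector {Ω : Type*} [MeasurableSpace Ω] {ι : Type*} [DecidableEq ι]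
    (μ : Measure Ω) (Z : Ω → ι) : ι → ℝ :=
  fun l => ∫ ω, (Pi.single (Z ω) (1 : ℝ) : ι → ℝ) l ∂μ

/-- The `ℓ¹` norm of a vector. -/
def l1norm {ι : Type*} [Fintype ι] (v : ι → ℝ) : ℝ := ∑ i, |v i|

namespace Network

variable {N K : ℕ} (G : Network N K)

/-! ### The grid based approximation

Below, `y` is a realization of the observations at the sensors. -/

/-- The likelihood `λ_t(x)` when the observation at time `t` is `v`. -/
def likelihood (t : ℕ) (v : Fin N → ℝ) (x : State K) : ℝ :=
  Real.exp (-(1 / 2) * ((v - G.obsMatrix t *ᵥ x) ⬝ᵥ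
      ((G.obsCov t x)⁻¹ *ᵥ (v - G.obsMatrix t *ᵥ x)))) / Real.sqrt (G.obsCov t x).det

/-- The likelihood matrix `Λ_t`. -/
def likelihoodMatrix (n t : ℕ) (v : Fin N → ℝ) : Matrix (Cells K n) (Cells K n) ℝ :=
  Matrix.diagonal fun l => G.likelihood t v (G.center n l)

/-- The recursion `E_t = Λ_t P E_{t-1}`. As for the state, index `0` is time `-1` and index `t + 1`
is time `t`. -/
def unnormalized (n : ℕ) (P : Matrix (Cells K n) (Cells K n) ℝ) (E0 : Cells K n → ℝ)
    (y : ℕ → Fin N → ℝ) : ℕ → Cells K n → ℝ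
  | 0 => E0
  | t + 1 => G.likelihoodMatrix n t (y t) *ᵥ (P *ᵥ unnormalized n P E0 y t)

/-- The reconstruction matrix, whose columns are the centers of the cells. -/
def reconstruction (n : ℕ) : Matrix (Fin (K + 1)) (Cells K n) ℝ :=
  Matrix.of fun i l => G.center n l i

/-- The Gaussian conditioning functional
`φ_t(x, v) = A^q x + (σ_t^q(x))ᵀ C_t(x)⁻¹ (v - A_t x)`. -/
def kriging (q : Plane) (t : ℕ) (x : State K) (v : Fin N → ℝ) : ℝ :=
  G.row q ⬝ᵥ x + G.crossCov q t x ⬝ᵥ ((G.obsCov t x)⁻¹ *ᵥ (v - G.obsMatrix t *ᵥ x))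

/-- The approximate predictor of the log-magnitude at `q` at time `t + ρ`, given the observations
up to time `t`. -/
def approxPredictor (q : Plane) (n : ℕ) (P : Matrix (Cells K n) (Cells K n) ℝ)
    (E0 : Cells K n → ℝ) (ρ t : ℕ) (y : ℕ → Fin N → ℝ) : ℝ :=
  let E : Cells K n → ℝ := G.unnormalized n P E0 y (t + 1)
  if ρ = 0 then
    (fun l => G.kriging q t (G.center n l) (y t)) ⬝ᵥ ((l1norm E)⁻¹ • E)
  else
    G.row q ⬝ᵥ ((G.reconstruction n * P ^ ρ) *ᵥ ((l1norm E)⁻¹ • E))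

end Network

end ChannelPrediction

end

/-!
# Consistency of grid based prediction of the channel magnitude

Write `w_k(x)` for the likelihood `λ_k(x)` of the `k`-th observation.

**The exact predictor.** Conditionally on the states, shadowing plus fading noise is a sequence of
independent Gaussian vectors (`IsObservationModel.exists_condLaw`). Hence states and observations
up to time `t` have the density `∏ k ≤ t, w_k(X_k)`, up to a constant, with respect to the law of
the states times Lebesgue measure, and the log-magnitude at `q` minus its regression on the
observations (for `ρ = 0`) or minus its path loss (for `ρ ≥ 1`) is conditionally centered given the
observations. Bayes' formula then gives a version of the conditional expectation as an explicit
function of the realization `y` of the observations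
(`IsObservationModel.condExp_eq_bayesPredictor`): the ratio of `𝔼[∏ k ≤ t, w_k(X_k) u(X_{t+ρ})]`
to `𝔼[∏ k ≤ t, w_k(X_k)]`, where `u` is the function `target` of the state and of `y`. In these
expectations `y` is a fixed parameter.

**The approximate predictor.** It is a ratio of the same shape, in which each expectation is
replaced by a sum `∑ l, E_m(l) u(x^l)` produced by the grid recursion `E_{k+1} = Λ_k P E_k`. Moving
the recursion to the other factor writes this sum as `𝔼[b(Z_0)]`, where `Z` is the quantized state
and `b` comes from `u` by alternately multiplying with a weight and applying the transposed
transition matrix (`sum_forward_mul`). By the definition of `P`, the second operation is a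
conditional expectation: `∑ i, P(i, Z_k) v(i)` is the conditional expectation of `v(Z_{k+1})` given
`Z_k`. So the limit can be taken one step at a time (`tendsto_backward`): if a function of `Z_{k+1}`
is close in `L¹` to a function `U` of `X_{k+1}`, then its conditional expectation is close to that of
`U`, since conditional expectations contract `L¹`. It remains to compare the conditional expectation
of `U` given the discretized past with the one given the past of `X`.

* For the Markovian quantization one may condition on the initial state and the driving noise for
  both processes, and the two coincide. The quantized state converges to the state almost surely,
  because the dynamics are Lipschitz for fixed noise.
* For the marginal quantization, the Markov property makes `𝔼[U | past]` a function of `X_k`, and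
  conditioning a function of `X_k` on the quantized `X_k` recovers it in `L¹` as the mesh decreases
  (`tendsto_integral_abs_condExp_sub`).

**Uniformity.** All of this holds along `y → y₀`, jointly with the refinement of the grid, because the
weights are jointly continuous in the observation and the state, and bounded on the hypercube. Since
the denominators are positive, the approximate predictors converge to the exact one locally uniformly
in `y`, hence uniformly on compact sets. The law of the observation sequence is tight, so that for
every `ε > 0`, in particular for `ε = (T + 1) ^ (1 - C N) e ^ (- C N)`, some compact set of realizations
has probability at least `1 - ε`. The outcomes with realizations in this set, less the null set where
the conditional expectations differ from Bayes' formula, are those on which convergence is uniform.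

The hypotheses on the covariances concern the hypercube only. Therefore the functions of the state
are composed with the projection `clamp` onto the hypercube, which is harmless as the states belong
to it almost surely.
-/

namespace ChannelPrediction

/-! ### Conditional expectations and Bayes' formula -/

theorem pi_withDensity {ι : Type*} [Fintype ι] {α : ι → Type*} [∀ i, MeasurableSpace (α i)]
    (μ : ∀ i, Measure (α i)) [∀ i, SigmaFinite (μ i)] (f : ∀ i, α i → ℝ)
    (hf : ∀ i, Integrable (f i) (μ i)) (hf0 : ∀ i x, 0 ≤ f i x) :
    Measure.pi (fun i => (μ i).withDensity fun x => ENNReal.ofReal (f i x))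
      = (Measure.pi μ).withDensity (fun x => ENNReal.ofReal (∏ i, f i (x i))) := by
  have hfin : ∀ i, IsFiniteMeasure ((μ i).withDensity fun x => ENNReal.ofReal (f i x)) :=
    fun i => isFiniteMeasure_withDensity_ofReal (hf i).2
  refine Measure.pi_eq fun s hs => ?_
  rw [withDensity_apply _ (MeasurableSet.univ_pi hs), Measure.restrict_pi_pi,
    ← ofReal_integral_eq_lintegral_ofReal, integral_fintype_prod_eq_prod,
    ENNReal.ofReal_prod_of_nonneg fun i _ => integral_nonneg (hf0 i)]
  · refine Finset.prod_congr rfl fun i _ => ?_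
    rw [withDensity_apply _ (hs i), ofReal_integral_eq_lintegral_ofReal (hf i).restrict
      (ae_of_all _ (hf0 i))]
  · exact Integrable.fintype_prod_dep fun i => (hf i).restrict
  · exact ae_of_all _ fun x => Finset.prod_nonneg fun i _ => hf0 i _

/-- **Bayes' formula**: if `(X, V)` has density `L` with respect to the product of the law of `X` and
a reference measure, then the conditional expectation of `g (X, V)` given `V` is a quotient of
integrals over an independent copy of `X`. -/
theorem condExp_eq_integral_div {Ω 𝒳 𝒱 : Type*} [MeasurableSpace Ω] [MeasurableSpace 𝒳]
    [MeasurableSpace 𝒱] {μ : Measure Ω} [IsProbabilityMeasure μ] {ν : Measure 𝒱} [SigmaFinite ν]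
    {X : Ω → 𝒳} {V : Ω → 𝒱} (hX : Measurable X) (hV : Measurable V) {L : 𝒳 × 𝒱 → ℝ}
    (hL : Measurable L) (hL0 : ∀ p, 0 ≤ L p)
    (hlaw : μ.map (fun ω => (X ω, V ω))
      = ((μ.map X).prod ν).withDensity fun p => ENNReal.ofReal (L p))
    {g : 𝒳 × 𝒱 → ℝ} (hg : Measurable g) (hint : Integrable (fun ω => g (X ω, V ω)) μ) :
    μ[fun ω => g (X ω, V ω) | MeasurableSpace.comap V inferInstance] =ᵐ[μ] fun ω =>
      (∫ ω', L (X ω', V ω) * g (X ω', V ω) ∂μ) / ∫ ω', L (X ω', V ω) ∂μ := by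
  have hXV : Measurable fun ω => (X ω, V ω) := hX.prodMk hV
  have : IsProbabilityMeasure (μ.map X) := Measure.isProbabilityMeasure_map hX.aemeasurable
  have hLm : Measurable fun p => ENNReal.ofReal (L p) := hL.ennreal_ofReal
  have transfer : ∀ h : 𝒳 × 𝒱 → ℝ, Measurable h →
      (Integrable (fun ω => h (X ω, V ω)) μ ↔
        Integrable (fun p => L p * h p) ((μ.map X).prod ν)) := by
    intro h hh
    have := integrable_map_measure (μ := μ) hh.aestronglyMeasurable hXV.aemeasurable
    rw [Function.comp_def] at this
    rw [← this, hlaw, integrable_withDensity_iff_integrable_smul' hLm (by simp)]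
    simp [ENNReal.toReal_ofReal (hL0 _)]
  have transferInt : ∀ h : 𝒳 × 𝒱 → ℝ, Measurable h →
      ∫ ω, h (X ω, V ω) ∂μ = ∫ p, L p * h p ∂((μ.map X).prod ν) := by
    intro h hh
    rw [← integral_map hXV.aemeasurable (f := h) hh.aestronglyMeasurable, hlaw,
      integral_withDensity_eq_integral_toReal_smul hLm (by simp)]
    simp [ENNReal.toReal_ofReal (hL0 _)]
  have hLint : Integrable L ((μ.map X).prod ν) := by
    simpa using (transfer (fun _ => 1) measurable_const).1 (integrable_const _)
  have hLg := (transfer g hg).1 hint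
  set Nf : 𝒱 → ℝ := fun v => ∫ x, L (x, v) * g (x, v) ∂(μ.map X) with hNf
  set Df : 𝒱 → ℝ := fun v => ∫ x, L (x, v) ∂(μ.map X) with hDf
  have hNm : Measurable Nf :=
    (hL.mul hg).stronglyMeasurable.integral_prod_left'.measurable
  have hDm : Measurable Df :=
    hL.stronglyMeasurable.integral_prod_left'.measurable
  have hLv : ∀ᵐ v ∂ν, Integrable (fun x => L (x, v)) (μ.map X) := hLint.prod_left_ae
  -- A vanishing denominator, for which the quotient is the junk value `0`, forces the numerator to
  -- vanish.
  have key : ∀ᵐ v ∂ν, Df v * (Nf v / Df v) = Nf v := by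
    filter_upwards [hLv] with v hv
    rcases eq_or_ne (Df v) 0 with h0 | h0
    · have h1 := (integral_eq_zero_iff_of_nonneg (fun x => hL0 (x, v)) hv).1 h0
      have h2 : Nf v = 0 := by
        rw [hNf]
        refine integral_eq_zero_of_ae ?_
        filter_upwards [h1] with x hx
        simp_all
      rw [h0, h2]; simp
    · field_simp
  have hrw : (fun ω => (∫ ω', L (X ω', V ω) * g (X ω', V ω) ∂μ) / ∫ ω', L (X ω', V ω) ∂μ)
      = fun ω => Nf (V ω) / Df (V ω) := by
    funext ω
    rw [hNf, hDf]
    dsimp only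
    rw [integral_map hX.aemeasurable, integral_map hX.aemeasurable]
    · exact (hL.comp measurable_prodMk_right).aestronglyMeasurable
    · exact ((hL.mul hg).comp measurable_prodMk_right).aestronglyMeasurable
  rw [hrw]
  have hΨm : Measurable fun v => Nf v / Df v := hNm.div hDm
  have hprod : Integrable (fun p : 𝒳 × 𝒱 => L p * (Nf p.2 / Df p.2)) ((μ.map X).prod ν) := by
    have hm : Measurable fun p : 𝒳 × 𝒱 => L p * (Nf p.2 / Df p.2) :=
      hL.mul (hΨm.comp measurable_snd)
    refine (integrable_prod_iff' hm.aestronglyMeasurable).2 ⟨?_, ?_⟩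
    · filter_upwards [hLv] with v hv using hv.mul_const _
    · have hN : Integrable (fun v => ‖Nf v‖) ν := hLg.integral_prod_right.norm
      refine hN.congr ?_
      filter_upwards [key, hLv] with v hv hi
      simp only [norm_mul, Real.norm_of_nonneg (hL0 _)]
      rw [integral_mul_const]
      nth_rewrite 1 [← hv]
      rw [norm_mul, Real.norm_of_nonneg (integral_nonneg fun x => hL0 _)]
  have hΨint : Integrable (fun ω => Nf (V ω) / Df (V ω)) μ :=
    (transfer (fun p => Nf p.2 / Df p.2) (hΨm.comp measurable_snd)).2 hprod
  symm
  refine ae_eq_condExp_of_forall_setIntegral_eq hV.comap_le hint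
    (fun s _ _ => hΨint.integrableOn) ?_ ?_
  · rintro s ⟨B, hB, rfl⟩ _
    rw [← integral_indicator (hV hB), ← integral_indicator (hV hB)]
    have hBm : MeasurableSet (Prod.snd ⁻¹' B : Set (𝒳 × 𝒱)) := measurable_snd hB
    have e1 := transferInt (Set.indicator (Prod.snd ⁻¹' B) fun p => Nf p.2 / Df p.2)
      ((hΨm.comp measurable_snd).indicator hBm)
    have e2 := transferInt (Set.indicator (Prod.snd ⁻¹' B) g) (hg.indicator hBm)
    have c1 : ∀ h : 𝒳 × 𝒱 → ℝ, (V ⁻¹' B).indicator (fun ω => h (X ω, V ω))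
        = fun ω => Set.indicator (Prod.snd ⁻¹' B) h (X ω, V ω) := fun h => rfl
    have c2 : ∀ h : 𝒳 × 𝒱 → ℝ, (fun p => L p * Set.indicator (Prod.snd ⁻¹' B) h p)
        = Set.indicator (Prod.snd ⁻¹' B) fun p => L p * h p := by
      intro h; funext p
      by_cases hp : p ∈ (Prod.snd ⁻¹' B : Set (𝒳 × 𝒱)) <;> simp [hp]
    rw [c1 (fun p => Nf p.2 / Df p.2), c1 g, e1, e2, c2, c2,
      integral_prod_symm _ (hprod.indicator hBm), integral_prod_symm _ (hLg.indicator hBm)]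
    refine integral_congr_ae ?_
    filter_upwards [key] with v hv
    by_cases hvB : v ∈ B
    · simp only [Set.indicator, Set.mem_preimage, hvB, if_true]
      rw [integral_mul_const]
      exact hv
    · simp [Set.indicator, hvB]
  · exact (hΨm.comp (comap_measurable V)).aestronglyMeasurable

theorem condExp_eq_zero_of_piSystem {Ω : Type*} {m m0 : MeasurableSpace Ω} (hm : m ≤ m0)
    {μ : Measure Ω} [IsProbabilityMeasure μ] {r : Ω → ℝ} (hr : Integrable r μ)
    (S : Set (Set Ω)) (hS : IsPiSystem S) (hgen : m = MeasurableSpace.generateFrom S)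
    (huniv : Set.univ ∈ S) (h0 : ∀ s ∈ S, ∫ ω in s, r ω ∂μ = 0) : μ[r | m] =ᵐ[μ] 0 := by
  symm
  refine ae_eq_condExp_of_forall_setIntegral_eq hm hr
    (fun _ _ _ => (integrable_zero _ _ _).integrableOn) ?_ aestronglyMeasurable_zero
  intro s hs _
  simp only [Pi.zero_apply, integral_zero]
  symm
  induction s, hs using MeasurableSpace.induction_on_inter hgen hS with
  | empty => simp
  | basic s hs => exact h0 s hs
  | compl s hs ih =>
    have := integral_add_compl (hm s hs) hr
    have h1 := h0 _ huniv
    rw [setIntegral_univ] at h1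
    linarith [ih (measure_lt_top _ _)]
  | iUnion f hd hf ih =>
    rw [integral_iUnion (fun i => hm _ (hf i)) hd hr.integrableOn]
    simp [ih _ (measure_lt_top _ _)]

/-! ### Gaussian vectors -/

section Gaussian

variable {ι κ : Type*} [Fintype ι] [DecidableEq ι] [Fintype κ] [DecidableEq κ]

theorem multivariateGaussian_conv {S₁ S₂ : Matrix ι ι ℝ} (h₁ : S₁.PosSemidef)
    (h₂ : S₂.PosSemidef) :
    ((multivariateGaussian 0 S₁).prod (multivariateGaussian 0 S₂)).map (fun p => p.1 + p.2)
      = multivariateGaussian 0 (S₁ + S₂) := by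
  change multivariateGaussian 0 S₁ ∗ multivariateGaussian 0 S₂ = _
  refine Measure.ext_of_charFun (E := EuclideanSpace ℝ ι) ?_
  ext t
  rw [charFun_conv, charFun_multivariateGaussian h₁, charFun_multivariateGaussian h₂,
    charFun_multivariateGaussian (h₁.add h₂), ← Complex.exp_add, Matrix.add_mulVec,
    dotProduct_add]
  congr 1
  simp
  ring

theorem pi_gaussianReal_map_toLp (v : ℝ≥0) :
    (Measure.pi fun _ : ι => gaussianReal 0 v).map (WithLp.toLp 2)
      = multivariateGaussian 0 ((v : ℝ) • (1 : Matrix ι ι ℝ)) := by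
  refine Measure.ext_of_charFun (E := EuclideanSpace ℝ ι) ?_
  ext t
  have h : ((v : ℝ) • (1 : Matrix ι ι ℝ)).PosSemidef := Matrix.PosSemidef.one.smul v.2
  rw [charFun_multivariateGaussian h]
  simp_rw [charFun_pi, charFun_gaussianReal, ← Complex.exp_sum]
  congr 1
  simp [Matrix.smul_mulVec, dotProduct, Finset.sum_div]
  refine Finset.sum_congr rfl fun i _ => ?_
  ring

theorem map_multivariateGaussian_comp {S : Matrix κ κ ℝ} (hS : S.PosSemidef) (e : ι → κ) :
    (multivariateGaussian 0 S).map (fun z => WithLp.toLp 2 fun i => z (e i))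
      = multivariateGaussian 0 (S.submatrix e e) := by
  let L : EuclideanSpace ℝ κ →L[ℝ] EuclideanSpace ℝ ι :=
    (PiLp.continuousLinearEquiv 2 ℝ (fun _ : ι => ℝ)).symm.toContinuousLinearMap.comp
      (ContinuousLinearMap.pi fun i => EuclideanSpace.proj (e i))
  have hL : (fun z : EuclideanSpace ℝ κ => (WithLp.toLp 2 fun i => z (e i) : EuclideanSpace ℝ ι))
      = L := by
    ext z i; rfl
  rw [hL]
  apply IsGaussian.ext
  · simp only [id_eq, integral_id_multivariateGaussian]
    rw [ContinuousLinearMap.integral_id_map, integral_id_multivariateGaussian]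
    · simp
    exact IsGaussian.integrable_id
  rw [← ContinuousLinearMap.toBilinForm_inj]
  refine LinearMap.BilinForm.ext_basis (EuclideanSpace.basisFun ι ℝ).toBasis fun i j ↦ ?_
  rw [ContinuousLinearMap.toBilinForm_apply, ContinuousLinearMap.toBilinForm_apply,
    covarianceBilin_apply_eq_cov, covariance_map]
  · have (i : ι) : (fun u ↦ inner ℝ ((EuclideanSpace.basisFun ι ℝ).toBasis i) u) ∘ L
        = fun u : EuclideanSpace ℝ κ ↦ u (e i) := by
      rw [← hL]; ext; simp [PiLp.inner_apply]
    simp_rw [this, covariance_eval_multivariateGaussian hS,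
      covarianceBilin_multivariateGaussian (hS.submatrix _)]
    simp
  any_goals exact Measurable.aestronglyMeasurable (by fun_prop)
  · fun_prop
  · exact IsGaussian.memLp_two_id

open scoped MatrixOrder in
/-- The density of a nondegenerate Gaussian vector, by the change of variables `v = c + √C u` from
the standard Gaussian vector `u`. -/
theorem map_multivariateGaussian_eq_withDensity {C : Matrix ι ι ℝ} (hC : C.PosDef) (c : ι → ℝ) :
    (multivariateGaussian 0 C).map (fun z i => c i + z i)
      = volume.withDensity fun v => ENNReal.ofReal ((√(2 * Real.pi))⁻¹ ^ Fintype.card ι *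
          (Real.exp (-(1 / 2) * ((v - c) ⬝ᵥ (C⁻¹ *ᵥ (v - c)))) / √C.det)) := by
  set S := CFC.sqrt C with hS
  have hSS : S * S = C := CFC.sqrt_mul_sqrt_self _ hC.posSemidef.nonneg
  have hSpos : S.PosSemidef := Matrix.nonneg_iff_posSemidef.1 (CFC.sqrt_nonneg C)
  have hST : Sᵀ = S := by simpa using hSpos.isHermitian.eq
  have hdet : S.det * S.det = C.det := by rw [← Matrix.det_mul, hSS]
  have hdet0 : S.det ≠ 0 := by
    intro h; rw [h] at hdet; exact hC.det_pos.ne' (by rw [← hdet]; simp)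
  have hSunit : IsUnit S.det := isUnit_iff_ne_zero.2 hdet0
  have hsqrt : √C.det = |S.det| := by rw [← hdet, Real.sqrt_mul_self_eq_abs]
  let T : (ι → ℝ) → ι → ℝ := fun u => c + S *ᵥ u
  have hT : Measurable T := by
    have : Continuous T := by fun_prop
    exact this.measurable
  let h : (ι → ℝ) → ℝ := fun v => (√(2 * Real.pi))⁻¹ ^ Fintype.card ι *
          (Real.exp (-(1 / 2) * ((v - c) ⬝ᵥ (C⁻¹ *ᵥ (v - c)))))
  have hh : Measurable h := by
    have : Continuous h := by fun_prop
    exact this.measurable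
  have hpi : (Measure.pi fun _ : ι => gaussianReal 0 1)
      = volume.withDensity fun u => ENNReal.ofReal (h (T u)) := by
    have : gaussianReal 0 1 = volume.withDensity fun x => ENNReal.ofReal (gaussianPDFReal 0 1 x) :=
      gaussianReal_of_var_ne_zero _ one_ne_zero
    simp_rw [this]
    rw [pi_withDensity (fun _ : ι => (volume : Measure ℝ)) (fun _ => gaussianPDFReal 0 1)
      (fun _ => integrable_gaussianPDFReal _ _) (fun _ => gaussianPDFReal_nonneg _ _), volume_pi]
    congr 1
    funext u
    congr 1
    simp only [gaussianPDFReal, Finset.prod_mul_distrib, ← Real.exp_sum, h, T]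
    congr 1
    · simp
    · congr 1
      have e1 : c + S *ᵥ u - c = S *ᵥ u := by simp
      have e2 : C⁻¹ *ᵥ (S *ᵥ u) = S⁻¹ *ᵥ u := by
        rw [← hSS, Matrix.mul_inv_rev, Matrix.mulVec_mulVec, Matrix.mul_assoc,
          Matrix.nonsing_inv_mul _ hSunit, Matrix.mul_one]
      rw [e1, e2, Matrix.dotProduct_mulVec, ← Matrix.mulVec_transpose, Matrix.mulVec_mulVec,
        Matrix.transpose_nonsing_inv, hST, Matrix.nonsing_inv_mul _ hSunit, Matrix.one_mulVec]
      simp only [dotProduct, Finset.mul_sum]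
      refine Finset.sum_congr rfl fun i _ => ?_
      simp; ring
  have hvol : (volume : Measure (ι → ℝ)).map T = ENNReal.ofReal |S.det⁻¹| • volume := by
    have : T = (fun v => c + v) ∘ (Matrix.toLin' S) := by
      funext u; simp [T]
    rw [this, ← Measure.map_map (measurable_const_add c)
      (Matrix.toLin' S).continuous_of_finiteDimensional.measurable,
      Real.map_matrix_volume_pi_eq_smul_volume_pi hdet0, Measure.map_smul, map_add_left_eq_self]
  have hmap : (multivariateGaussian 0 C).map (fun z i => c i + z i)
      = (Measure.pi fun _ : ι => gaussianReal 0 1).map T := by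
    rw [multivariateGaussian, ← map_pi_eq_stdGaussian, Measure.map_map (by fun_prop) (by fun_prop),
      Measure.map_map (by fun_prop) (by fun_prop)]
    congr 1
    funext u i
    simp [T, hS]
  rw [hmap, hpi]
  ext s hs
  rw [Measure.map_apply hT hs, withDensity_apply _ (hT hs), withDensity_apply _ hs,
    ← setLIntegral_map hs (f := fun v => ENNReal.ofReal (h v)) hh.ennreal_ofReal hT, hvol,
    Measure.restrict_smul, lintegral_smul_measure, smul_eq_mul,
    ← lintegral_const_mul _ hh.ennreal_ofReal]
  refine lintegral_congr fun v => ?_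
  rw [← ENNReal.ofReal_mul (abs_nonneg _)]
  congr 1
  simp only [h]
  rw [hsqrt, abs_inv]
  ring

theorem memLp_eval_multivariateGaussian (S : Matrix κ κ ℝ) (i : κ) :
    MemLp (fun z : EuclideanSpace ℝ κ => z i) 2 (multivariateGaussian 0 S) :=
  (IsGaussian.hasGaussianLaw_id (μ := multivariateGaussian 0 S)).map_fun
    (EuclideanSpace.proj i) |>.memLp_two

theorem integral_eval_multivariateGaussian (S : Matrix κ κ ℝ) (i : κ) :
    ∫ z, z i ∂(multivariateGaussian 0 S) = 0 := by
  have := ContinuousLinearMap.integral_comp_comm (μ := multivariateGaussian 0 S)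
    (EuclideanSpace.proj i : EuclideanSpace ℝ κ →L[ℝ] ℝ) IsGaussian.integrable_id
  simp only [id_eq, integral_id_multivariateGaussian] at this
  simpa using this

/-- If `a` solves the normal equations, then the residual of the linear regression of the coordinate
`none` on the others is uncorrelated with them, hence independent of them, and so it integrates to
`0` against every function of them. -/
theorem integral_residual_eq_zero {S : Matrix (Option ι) (Option ι) ℝ} (hS : S.PosSemidef)
    {a : ι → ℝ} (ha : ∀ j, S (some j) none = ∑ i, a i * S (some j) (some i))
    {B : Set (ι → ℝ)} (hB : MeasurableSet B) :
    ∫ z, B.indicator 1 (fun i => z (some i)) * (z none - ∑ i, a i * z (some i))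
      ∂(multivariateGaussian 0 S) = 0 := by
  set Γ := multivariateGaussian 0 S with hΓ
  have hmem : ∀ i, MemLp (fun z : EuclideanSpace ℝ (Option ι) => z i) 2 Γ :=
    memLp_eval_multivariateGaussian S
  have hmean : ∀ i, ∫ z : EuclideanSpace ℝ (Option ι), z i ∂Γ = 0 :=
    integral_eval_multivariateGaussian S
  let Xc : ι → EuclideanSpace ℝ (Option ι) → ℝ := fun i z => z (some i)
  let Yc : Unit → EuclideanSpace ℝ (Option ι) → ℝ := fun _ z => z none - ∑ i, a i * z (some i)
  have hmemS : MemLp (fun z : EuclideanSpace ℝ (Option ι) => ∑ i, a i * z (some i)) 2 Γ :=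
    memLp_finsetSum _ fun i _ => (hmem (some i)).const_mul _
  have hgauss : HasGaussianLaw (fun z => (fun i => Xc i z, fun j => Yc j z)) Γ := by
    let L : EuclideanSpace ℝ (Option ι) →L[ℝ] (ι → ℝ) × (Unit → ℝ) :=
      (ContinuousLinearMap.pi fun i => EuclideanSpace.proj (some i)).prod
        (ContinuousLinearMap.pi fun _ => EuclideanSpace.proj none -
          ∑ i, a i • EuclideanSpace.proj (some i))
    have : (fun z => (fun i => Xc i z, fun j => Yc j z)) = fun z => L z := by
      funext z
      ext i <;> simp [Xc, Yc, L]
    rw [this]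
    exact (IsGaussian.hasGaussianLaw_id (μ := Γ)).map_fun L
  have hind := hgauss.indepFun_of_covariance_eval (by
    intro j _
    simp only [Xc, Yc]
    rw [covariance_fun_sub_right (hmem _) (hmem _) hmemS, covariance_fun_sum_right
      (fun i => (hmem (some i)).const_mul _) (hmem _)]
    simp_rw [covariance_const_mul_right]
    simp only [hΓ, covariance_eval_multivariateGaussian hS]
    rw [ha j, sub_self])
  have hind2 : IndepFun (fun z : EuclideanSpace ℝ (Option ι) =>
      (B.indicator 1 (fun i => z (some i)) : ℝ))
      (fun z => z none - ∑ i, a i * z (some i)) Γ :=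
    hind.comp (φ := B.indicator (1 : (ι → ℝ) → ℝ)) (ψ := fun y : Unit → ℝ => y ())
      (measurable_one.indicator hB) (measurable_pi_apply _)
  rw [hind2.integral_fun_mul_eq_mul_integral]
  · rw [integral_sub ((hmem _).integrable one_le_two) (hmemS.integrable one_le_two),
      integral_finsetSum _ fun i _ => ((hmem (some i)).const_mul _).integrable one_le_two]
    simp [integral_const_mul, hmean]
  · refine ((measurable_one.indicator hB).comp ?_).aestronglyMeasurable
    fun_prop
  · fun_prop

end Gaussian

/-! ### Conditional laws of random vectors with independent blocks -/

section NoiseLaw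

variable {ι κ : Type*} [Fintype ι] [Fintype κ]

theorem pi_pi_map_uncurry (ν : ι → κ → Measure ℝ) [∀ i j, IsProbabilityMeasure (ν i j)] :
    (Measure.pi fun i => Measure.pi (ν i)).map (fun z (p : ι × κ) => z p.1 p.2)
      = Measure.pi fun p : ι × κ => ν p.1 p.2 := by
  symm
  refine Measure.pi_eq fun s hs => ?_
  rw [Measure.map_apply (by fun_prop) (MeasurableSet.univ_pi hs)]
  have : (fun (z : ι → κ → ℝ) (p : ι × κ) => z p.1 p.2) ⁻¹' Set.univ.pi s
      = Set.univ.pi fun i => Set.univ.pi fun j => s (i, j) := by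
    ext z; simp
  rw [this, Measure.pi_pi]
  simp_rw [Measure.pi_pi]
  rw [Fintype.prod_prod_type]

theorem map_whiteNoise [DecidableEq κ] {Ω : Type*} [MeasurableSpace Ω] {μ : Measure Ω}
    [IsProbabilityMeasure μ]
    {ξ : ι → κ → Ω → ℝ} {v : ℝ≥0} (hm : ∀ i j, Measurable (ξ i j))
    (hind : iIndepFun (fun p : ι × κ => ξ p.1 p.2) μ)
    (hlaw : ∀ i j, μ.map (ξ i j) = gaussianReal 0 v) :
    μ.map (fun ω i => (WithLp.toLp 2 fun j => ξ i j ω : EuclideanSpace ℝ κ))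
      = Measure.pi fun _ : ι => multivariateGaussian 0 ((v : ℝ) • (1 : Matrix κ κ ℝ)) := by
  have h1 : μ.map (fun ω (p : ι × κ) => ξ p.1 p.2 ω)
      = (Measure.pi fun _ : ι => Measure.pi fun _ : κ => gaussianReal 0 v).map
          (fun z (p : ι × κ) => z p.1 p.2) := by
    have := (iIndepFun_iff_map_fun_eq_pi_map
      (fun p : ι × κ => (hm p.1 p.2).aemeasurable)).1 hind
    rw [pi_pi_map_uncurry, this]
    simp_rw [hlaw]
  have h2 := congrArg (Measure.map fun (z : ι × κ → ℝ) (i : ι) =>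
    (WithLp.toLp 2 fun j => z (i, j) : EuclideanSpace ℝ κ)) h1
  rw [Measure.map_map (by fun_prop) (by fun_prop), Measure.map_map (by fun_prop) (by fun_prop)]
    at h2
  rw [Function.comp_def, Function.comp_def] at h2
  rw [h2]
  have := Measure.pi_map_pi (μ := fun _ : ι => Measure.pi fun _ : κ => gaussianReal 0 v)
    (f := fun _ => (WithLp.toLp 2 : (κ → ℝ) → EuclideanSpace ℝ κ))
    (hμ := fun _ => by rw [pi_gaussianReal_map_toLp]; infer_instance)
    (fun _ => by fun_prop)
  simp_rw [pi_gaussianReal_map_toLp] at this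
  exact this

theorem pi_prod_pi_map_add [DecidableEq κ] {S₁ S₂ : ι → Matrix κ κ ℝ}
    (h₁ : ∀ i, (S₁ i).PosSemidef) (h₂ : ∀ i, (S₂ i).PosSemidef) :
    ((Measure.pi fun i => multivariateGaussian 0 (S₁ i)).prod
      (Measure.pi fun i => multivariateGaussian 0 (S₂ i))).map (fun p => p.1 + p.2)
      = Measure.pi fun i => multivariateGaussian 0 (S₁ i + S₂ i) := by
  rw [← (measurePreserving_arrowProdEquivProdArrow _ _ ι (fun i => multivariateGaussian 0 (S₁ i))
    (fun i => multivariateGaussian 0 (S₂ i))).map_eq, Measure.map_map (by fun_prop) (by fun_prop)]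
  have := Measure.pi_map_pi
    (μ := fun i => (multivariateGaussian 0 (S₁ i)).prod (multivariateGaussian 0 (S₂ i)))
    (f := fun _ (p : EuclideanSpace ℝ κ × EuclideanSpace ℝ κ) => p.1 + p.2)
    (hμ := fun i => by rw [multivariateGaussian_conv (h₁ i) (h₂ i)]; infer_instance)
    (fun _ => by fun_prop)
  simp_rw [multivariateGaussian_conv (h₁ _) (h₂ _)] at this
  rw [← this]
  rfl

end NoiseLaw

/-- If the conditional probabilities of measurable rectangles are the products of those of a family of
measures, then the regular conditional distribution is the product measure. The null set where this
fails for a given rectangle is made uniform by means of a countable generating algebra. -/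
theorem condDistrib_eq_pi_of_condExp {Ω 𝒳 ι E : Type*} [MeasurableSpace Ω] [MeasurableSpace 𝒳]
    [Fintype ι] [MeasurableSpace E] [StandardBorelSpace E] [Nonempty E]
    {μ : Measure Ω} [IsProbabilityMeasure μ] {X : Ω → 𝒳} (hX : Measurable X) {s : Ω → ι → E}
    (hs : Measurable s) (Γ : ι → 𝒳 → Measure E) [∀ i x, IsProbabilityMeasure (Γ i x)]
    (hcond : ∀ B : ι → Set E, (∀ i, MeasurableSet (B i)) →
      μ[Set.indicator {ω | ∀ i, s ω i ∈ B i} (fun _ => (1 : ℝ)) |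
        MeasurableSpace.comap X inferInstance] =ᵐ[μ] fun ω => ∏ i, (Γ i (X ω)).real (B i)) :
    ∀ᵐ ω ∂μ, condDistrib s X μ (X ω) = Measure.pi fun i => Γ i (X ω) := by
  classical
  let C : Set (Set E) := generateSetAlgebra (MeasurableSpace.countableGeneratingSet E)
  have hCc : C.Countable :=
    countable_generateSetAlgebra (MeasurableSpace.countable_countableGeneratingSet)
  have hCgen : MeasurableSpace.generateFrom C = ‹MeasurableSpace E› := by
    rw [generateFrom_generateSetAlgebra_eq, MeasurableSpace.generateFrom_countableGeneratingSet]
  have hCm : ∀ A ∈ C, MeasurableSet A := fun A hA => by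
    rw [← hCgen]; exact MeasurableSpace.measurableSet_generateFrom hA
  have : Countable C := hCc
  have hall : ∀ᵐ ω ∂μ, ∀ B : ι → C,
      (condDistrib s X μ (X ω)).real (Set.univ.pi fun i => (B i : Set E))
        = ∏ i, (Γ i (X ω)).real (B i) := by
    rw [ae_all_iff]
    intro B
    have hBm : ∀ i, MeasurableSet (B i : Set E) := fun i => hCm _ (B i).2
    have h1 := condDistrib_ae_eq_condExp (μ := μ) hX hs (MeasurableSet.univ_pi hBm)
    have h2 := hcond (fun i => B i) hBm
    have h3 : s ⁻¹' (Set.univ.pi fun i => (B i : Set E)) = {ω | ∀ i, s ω i ∈ (B i : Set E)} := by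
      ext ω; simp
    rw [h3] at h1
    exact h1.trans h2
  filter_upwards [hall] with ω hω
  symm
  refine Measure.pi_eq_generateFrom (C := fun _ => C) (fun _ => hCgen)
    (fun _ => fun A hA A' hA' _ => isSetAlgebra_generateSetAlgebra.inter_mem hA hA')
    (fun i => ⟨fun _ => Set.univ, fun _ => isSetAlgebra_generateSetAlgebra.univ_mem,
      fun _ => measure_lt_top _ _, Set.iUnion_const _⟩) ?_
  intro B hB
  have := hω (fun i => ⟨B i, hB i⟩)
  rw [← ENNReal.toReal_eq_toReal_iff' (measure_ne_top _ _)
    (ENNReal.prod_ne_top fun i _ => measure_ne_top _ _), ENNReal.toReal_prod]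
  exact this

/-- If, given `X`, the blocks of `s` are independent and centered Gaussian with covariances
`S i (X ω)`, and if `e` is independent Gaussian white noise of variance `v`, then the conditional law
of `s + e` given `X` is the product of the Gaussian measures with covariances
`S i (X ω) + v • 1`. -/
theorem exists_kernel_noisyShadowing {Ω 𝒳 ι κ : Type*} [MeasurableSpace Ω] [MeasurableSpace 𝒳]
    [Fintype ι] [Fintype κ] [DecidableEq κ]
    {μ : Measure Ω} [IsProbabilityMeasure μ] {X : Ω → 𝒳} (hX : Measurable X)
    {s e : Ω → ι → EuclideanSpace ℝ κ} (hs : Measurable s) (he : Measurable e)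
    (S : ι → 𝒳 → Matrix κ κ ℝ) (hS : ∀ᵐ ω ∂μ, ∀ i, (S i (X ω)).PosSemidef)
    (hcond : ∀ B : ι → Set (EuclideanSpace ℝ κ), (∀ i, MeasurableSet (B i)) →
      μ[Set.indicator {ω | ∀ i, s ω i ∈ B i} (fun _ => (1 : ℝ)) |
        MeasurableSpace.comap X inferInstance]
        =ᵐ[μ] fun ω => ∏ i, (multivariateGaussian 0 (S i (X ω))).real (B i))
    {v : ℝ≥0} (helaw : μ.map e
      = Measure.pi fun _ : ι => multivariateGaussian 0 ((v : ℝ) • (1 : Matrix κ κ ℝ)))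
    (hind : IndepFun (fun ω => (X ω, s ω)) e μ) :
    ∃ η : Kernel 𝒳 (ι → EuclideanSpace ℝ κ), IsMarkovKernel η ∧
      μ.map (fun ω => (X ω, s ω + e ω)) = μ.map X ⊗ₘ η ∧
      ∀ᵐ ω ∂μ, η (X ω) = Measure.pi fun i =>
        multivariateGaussian 0 (S i (X ω) + (v : ℝ) • (1 : Matrix κ κ ℝ)) := by
  have h1 := condDistrib_eq_pi_of_condExp hX hs (fun i x => multivariateGaussian 0 (S i x)) hcond
  have : IsProbabilityMeasure (μ.map e) := Measure.isProbabilityMeasure_map he.aemeasurable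
  have : IsProbabilityMeasure (μ.map X) := Measure.isProbabilityMeasure_map hX.aemeasurable
  have hadd : Measurable fun p : (ι → EuclideanSpace ℝ κ) × (ι → EuclideanSpace ℝ κ) =>
    p.1 + p.2 := by fun_prop
  refine ⟨(condDistrib s X μ ×ₖ Kernel.const 𝒳 (μ.map e)).map (fun p => p.1 + p.2),
    Kernel.IsMarkovKernel.map _ hadd, ?_, ?_⟩
  · have hXs := compProd_map_condDistrib (μ := μ) (X := X)
      (mβ := inferInstance) hs.aemeasurable
    have hjoint := hind.map_prod_eq_prod_map_map (hX.prodMk hs).aemeasurable he.aemeasurable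
    rw [← hXs] at hjoint
    have hmap : μ.map (fun ω => (X ω, s ω + e ω))
        = (μ.map fun ω => ((X ω, s ω), e ω)).map fun p => (p.1.1, p.1.2 + p.2) := by
      rw [Measure.map_map (by fun_prop) (by fun_prop)]
      rfl
    rw [hmap, hjoint]
    refine Measure.ext_of_lintegral _ fun f hf => ?_
    rw [lintegral_map hf (by fun_prop), lintegral_prod _ (by fun_prop),
      Measure.lintegral_compProd, Measure.lintegral_compProd hf]
    · refine lintegral_congr fun x => ?_
      rw [Kernel.map_apply _ hadd, lintegral_map (by fun_prop) hadd, Kernel.prod_apply,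
        Kernel.const_apply, lintegral_prod _ (by fun_prop)]
    · exact Measurable.lintegral_prod_right' (f := fun q : (𝒳 × (ι → EuclideanSpace ℝ κ)) × _ =>
        f (q.1.1, q.1.2 + q.2)) (by fun_prop)
  · filter_upwards [h1, hS] with ω hω hSω
    rw [Kernel.map_apply _ hadd, Kernel.prod_apply, Kernel.const_apply, hω, helaw,
      pi_prod_pi_map_add (S₂ := fun _ => (v : ℝ) • (1 : Matrix κ κ ℝ)) hSω
        fun _ => Matrix.PosSemidef.one.smul v.coe_nonneg]

/-! ### Consequences of a conditional product law -/

section ConditionallyGaussian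

variable {Ω 𝒳 ι κ E : Type*} [MeasurableSpace Ω] [MeasurableSpace 𝒳] [Fintype ι]
  [MeasurableSpace E] {μ : Measure Ω} [IsProbabilityMeasure μ] {X : Ω → 𝒳} {ζ : Ω → ι → E}
  {η : Kernel 𝒳 (ι → E)} [IsMarkovKernel η] {Γ : ι → 𝒳 → Measure E}

theorem lintegral_of_condLaw (hX : Measurable X) (hζ : Measurable ζ)
    (hjoint : μ.map (fun ω => (X ω, ζ ω)) = μ.map X ⊗ₘ η)
    (hη : ∀ᵐ ω ∂μ, η (X ω) = Measure.pi fun i => Γ i (X ω))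
    {f : 𝒳 × (ι → E) → ℝ≥0∞} (hf : Measurable f) :
    ∫⁻ ω, f (X ω, ζ ω) ∂μ = ∫⁻ ω, ∫⁻ z, f (X ω, z) ∂(Measure.pi fun i => Γ i (X ω)) ∂μ := by
  have : IsProbabilityMeasure (μ.map X) := Measure.isProbabilityMeasure_map hX.aemeasurable
  rw [← lintegral_map (f := f) hf (hX.prodMk hζ), hjoint, Measure.lintegral_compProd hf,
    lintegral_map (hf.lintegral_kernel_prod_right') hX]
  refine lintegral_congr_ae ?_
  filter_upwards [hη] with ω hω
  rw [hω]

theorem integral_of_condLaw (hX : Measurable X) (hζ : Measurable ζ)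
    (hjoint : μ.map (fun ω => (X ω, ζ ω)) = μ.map X ⊗ₘ η)
    (hη : ∀ᵐ ω ∂μ, η (X ω) = Measure.pi fun i => Γ i (X ω))
    {f : 𝒳 × (ι → E) → ℝ} (hf : Measurable f) (hint : Integrable (fun ω => f (X ω, ζ ω)) μ) :
    ∫ ω, f (X ω, ζ ω) ∂μ = ∫ ω, ∫ z, f (X ω, z) ∂(Measure.pi fun i => Γ i (X ω)) ∂μ := by
  have : IsProbabilityMeasure (μ.map X) := Measure.isProbabilityMeasure_map hX.aemeasurable
  have hint' : Integrable f (μ.map X ⊗ₘ η) := by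
    rw [← hjoint]
    exact (integrable_map_measure hf.aestronglyMeasurable (hX.prodMk hζ).aemeasurable).2 hint
  rw [← integral_map (f := f) (hX.prodMk hζ).aemeasurable hf.aestronglyMeasurable, hjoint,
    Measure.integral_compProd hint', integral_map hX.aemeasurable]
  · refine integral_congr_ae ?_
    filter_upwards [hη] with ω hω
    rw [hω]
  · exact (hf.stronglyMeasurable.integral_kernel_prod_right').aestronglyMeasurable

/-- If, given `X`, the blocks `ζ i` are independent and the `i`-th observation has density
`ℓ i (X ω)`, then `X` and the observations have the product of the `ℓ i` as joint density. -/
theorem map_observation_eq_withDensity [Fintype κ] [∀ i x, IsProbabilityMeasure (Γ i x)]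
    (hX : Measurable X) (hζ : Measurable ζ)
    (hjoint : μ.map (fun ω => (X ω, ζ ω)) = μ.map X ⊗ₘ η)
    (hη : ∀ᵐ ω ∂μ, η (X ω) = Measure.pi fun i => Γ i (X ω))
    {obs : ι → 𝒳 → E → κ → ℝ} (hobs : ∀ i, Measurable (Function.uncurry (obs i)))
    {ℓ : ι → 𝒳 → (κ → ℝ) → ℝ} (hℓ : ∀ i, Measurable (Function.uncurry (ℓ i)))
    (hℓ0 : ∀ i x v, 0 ≤ ℓ i x v)
    (hlaw : ∀ᵐ ω ∂μ, ∀ i, (Γ i (X ω)).map (obs i (X ω))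
      = volume.withDensity fun v => ENNReal.ofReal (ℓ i (X ω) v)) :
    μ.map (fun ω => (X ω, fun i => obs i (X ω) (ζ ω i)))
      = ((μ.map X).prod (volume : Measure (ι → κ → ℝ))).withDensity
          fun p => ENNReal.ofReal (∏ i, ℓ i p.1 (p.2 i)) := by
  have : IsProbabilityMeasure (μ.map X) := Measure.isProbabilityMeasure_map hX.aemeasurable
  have hobs' : ∀ i x, Measurable (obs i x) := fun i x => (hobs i).of_uncurry_left
  have hℓ' : ∀ i x, Measurable (ℓ i x) := fun i x => (hℓ i).of_uncurry_left
  have hVm : Measurable fun ω => fun i => obs i (X ω) (ζ ω i) := measurable_pi_lambda _ fun i =>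
    (hobs i).comp (hX.prodMk ((measurable_pi_apply i).comp hζ))
  have hLm : Measurable fun p : 𝒳 × (ι → κ → ℝ) => ENNReal.ofReal (∏ i, ℓ i p.1 (p.2 i)) :=
    (Finset.measurable_prod _ fun i _ => (hℓ i).comp (measurable_fst.prodMk
      ((measurable_pi_apply i).comp measurable_snd))).ennreal_ofReal
  refine Measure.ext_of_lintegral _ fun f hf => ?_
  rw [lintegral_map hf (hX.prodMk hVm), lintegral_withDensity_eq_lintegral_mul _ hLm hf,
    lintegral_prod _ (hLm.mul hf).aemeasurable,
    lintegral_map (hLm.mul hf).lintegral_prod_right' hX]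
  have hF : Measurable fun p : 𝒳 × (ι → E) => f (p.1, fun i => obs i p.1 (p.2 i)) :=
    hf.comp (measurable_fst.prodMk (measurable_pi_lambda _ fun i => (hobs i).comp
      (measurable_fst.prodMk ((measurable_pi_apply i).comp measurable_snd))))
  have := lintegral_of_condLaw hX hζ hjoint hη hF
  dsimp only at this
  rw [this]
  refine lintegral_congr_ae ?_
  filter_upwards [hlaw] with ω hω
  have hprob : ∀ i, IsProbabilityMeasure ((Γ i (X ω)).map (obs i (X ω))) := fun i =>
    Measure.isProbabilityMeasure_map (hobs' i _).aemeasurable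
  have hint : ∀ i, Integrable (ℓ i (X ω)) := fun i => by
    refine ⟨(hℓ' i _).aestronglyMeasurable, ?_⟩
    rw [hasFiniteIntegral_iff_ofReal (ae_of_all _ (hℓ0 i _)), ← setLIntegral_univ,
      ← withDensity_apply _ MeasurableSet.univ, ← hω i]
    exact measure_lt_top _ _
  have hpi : (Measure.pi fun i => Γ i (X ω)).map (fun z i => obs i (X ω) (z i))
      = volume.withDensity fun v => ENNReal.ofReal (∏ i, ℓ i (X ω) (v i)) := by
    rw [Measure.pi_map_pi fun i => (hobs' i _).aemeasurable]
    simp_rw [hω]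
    rw [pi_withDensity (fun _ => volume) (fun i => ℓ i (X ω)) hint fun i => hℓ0 i _]
    rfl
  have hLω : Measurable fun v : ι → κ → ℝ => ENNReal.ofReal (∏ i, ℓ i (X ω) (v i)) :=
    hLm.comp measurable_prodMk_left
  have hobsω : Measurable fun (z : ι → E) i => obs i (X ω) (z i) :=
    measurable_pi_lambda _ fun i => (hobs' i _).comp (measurable_pi_apply i)
  have := lintegral_map (μ := Measure.pi fun i => Γ i (X ω)) (f := fun v => f (X ω, v))
    (hf.comp measurable_prodMk_left) hobsω
  rw [← this, hpi]
  exact lintegral_withDensity_eq_lintegral_mul _ hLω (hf.comp measurable_prodMk_left)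

/-- If, given `X`, the blocks `ζ i` are independent and `r` is a function of the `j`-th one that
integrates to `0` over the event that the `j`-th observation is in `B j`, then `r` integrates to `0`
over the event that all observations are in their sets: the other blocks contribute a factor. -/
theorem setIntegral_eq_zero_of_condLaw [∀ i x, IsProbabilityMeasure (Γ i x)]
    (hX : Measurable X) (hζ : Measurable ζ)
    (hjoint : μ.map (fun ω => (X ω, ζ ω)) = μ.map X ⊗ₘ η)
    (hη : ∀ᵐ ω ∂μ, η (X ω) = Measure.pi fun i => Γ i (X ω))
    {obs : ι → 𝒳 → E → κ → ℝ} (hobs : ∀ i, Measurable (Function.uncurry (obs i)))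
    {B : ι → Set (κ → ℝ)} (hB : ∀ i, MeasurableSet (B i)) {j : ι} {r : 𝒳 → E → ℝ}
    (hr : Measurable (Function.uncurry r)) (hint : Integrable (fun ω => r (X ω) (ζ ω j)) μ)
    (h0 : ∀ᵐ ω ∂μ, ∫ z, (B j).indicator 1 (obs j (X ω) z) * r (X ω) z ∂(Γ j (X ω)) = 0) :
    ∫ ω in {ω | ∀ i, obs i (X ω) (ζ ω i) ∈ B i}, r (X ω) (ζ ω j) ∂μ = 0 := by
  classical
  let g : ι → 𝒳 → E → ℝ := fun i x z =>
    (B i).indicator 1 (obs i x z) * if i = j then r x z else 1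
  have hg : ∀ i, Measurable (Function.uncurry (g i)) := fun i => by
    refine Measurable.mul ((measurable_one.indicator (hB i)).comp (hobs i)) ?_
    by_cases hij : i = j
    · simp only [hij, if_true]; exact hr
    · simp only [hij, if_false]; exact measurable_const
  let F : 𝒳 × (ι → E) → ℝ := fun p => ∏ i, g i p.1 (p.2 i)
  have hF : Measurable F := Finset.measurable_prod _ fun i _ => (hg i).comp
    (measurable_fst.prodMk ((measurable_pi_apply i).comp measurable_snd))
  have hset : MeasurableSet {ω | ∀ i, obs i (X ω) (ζ ω i) ∈ B i} := by
    rw [Set.ofPred_forall]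
    exact MeasurableSet.iInter fun i => ((hobs i).comp
      (hX.prodMk ((measurable_pi_apply i).comp hζ))) (hB i)
  have hFeq : ∀ ω, {ω | ∀ i, obs i (X ω) (ζ ω i) ∈ B i}.indicator
      (fun ω => r (X ω) (ζ ω j)) ω = F (X ω, ζ ω) := by
    intro ω
    have hprod : F (X ω, ζ ω) = (∏ i, (B i).indicator 1 (obs i (X ω) (ζ ω i))) *
        r (X ω) (ζ ω j) := by
      simp only [F, g, Finset.prod_mul_distrib]
      congr 1
      rw [Finset.prod_ite_eq' Finset.univ j]
      simp
    rw [hprod]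
    by_cases hω : ∀ i, obs i (X ω) (ζ ω i) ∈ B i
    · rw [Set.indicator_of_mem (by exact hω), Finset.prod_eq_one, one_mul]
      intro i _
      rw [Set.indicator_of_mem (hω i)]; rfl
    · rw [Set.indicator_of_notMem (by exact hω)]
      push Not at hω
      obtain ⟨i, hi⟩ := hω
      rw [Finset.prod_eq_zero (Finset.mem_univ i) (Set.indicator_of_notMem hi _), zero_mul]
  rw [← integral_indicator hset]
  simp_rw [hFeq]
  rw [integral_of_condLaw hX hζ hjoint hη hF]
  · refine integral_eq_zero_of_ae ?_
    filter_upwards [h0] with ω hω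
    simp only [F, Pi.zero_apply]
    rw [integral_fintype_prod_eq_prod]
    refine Finset.prod_eq_zero (Finset.mem_univ j) ?_
    simpa [g] using hω
  · refine (hint.indicator hset).congr (ae_of_all _ fun ω => hFeq ω)

end ConditionallyGaussian

theorem memLp_two_of_condLaw {Ω 𝒳 ι κ : Type*} [MeasurableSpace Ω] [MeasurableSpace 𝒳] [Fintype ι]
    [Fintype κ] [DecidableEq κ] {μ : Measure Ω} [IsProbabilityMeasure μ] {X : Ω → 𝒳}
    {ζ : Ω → ι → EuclideanSpace ℝ κ}
    {η : Kernel 𝒳 (ι → EuclideanSpace ℝ κ)} [IsMarkovKernel η] {S : ι → 𝒳 → Matrix κ κ ℝ}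
    (hX : Measurable X) (hζ : Measurable ζ)
    (hjoint : μ.map (fun ω => (X ω, ζ ω)) = μ.map X ⊗ₘ η)
    (hη : ∀ᵐ ω ∂μ, η (X ω) = Measure.pi fun i => multivariateGaussian 0 (S i (X ω)))
    (i : ι) (k : κ) (hS : ∀ᵐ ω ∂μ, (S i (X ω)).PosSemidef) {c : ℝ}
    (hc : ∀ᵐ ω ∂μ, S i (X ω) k k ≤ c) : MemLp (fun ω => ζ ω i k) 2 μ := by
  have hm : Measurable fun ω => ζ ω i k := by fun_prop
  rw [memLp_two_iff_integrable_sq hm.aestronglyMeasurable]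
  refine ⟨(hm.pow_const 2).aestronglyMeasurable, ?_⟩
  rw [hasFiniteIntegral_iff_ofReal (ae_of_all _ fun ω => sq_nonneg _)]
  have := lintegral_of_condLaw (Γ := fun i x => multivariateGaussian 0 (S i x)) hX hζ hjoint hη
    (f := fun p => ENNReal.ofReal (p.2 i k ^ 2)) (by fun_prop)
  dsimp only at this
  rw [this]
  refine lt_of_le_of_lt (lintegral_mono_ae (g := fun _ => ENNReal.ofReal c) ?_) (by simp)
  filter_upwards [hS, hc] with ω hSω hcω
  have hmp : (Measure.pi fun i => multivariateGaussian 0 (S i (X ω))).map (Function.eval i)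
      = multivariateGaussian 0 (S i (X ω)) := (measurePreserving_eval _ i).map_eq
  have h1 : ∫⁻ z, ENNReal.ofReal (z i k ^ 2)
      ∂(Measure.pi fun i => multivariateGaussian 0 (S i (X ω)))
      = ∫⁻ z, ENNReal.ofReal (z k ^ 2) ∂(multivariateGaussian 0 (S i (X ω))) := by
    rw [← hmp, lintegral_map (by fun_prop) (by fun_prop)]
  rw [h1, ← ofReal_integral_eq_lintegral_ofReal
      (memLp_eval_multivariateGaussian _ k).integrable_sq
    (ae_of_all _ fun _ => sq_nonneg _)]
  refine ENNReal.ofReal_le_ofReal ?_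
  rw [← variance_of_integral_eq_zero (by fun_prop)
    (integral_eval_multivariateGaussian _ k), variance_eval_multivariateGaussian hSω]
  exact hcω

/-! ### The hypercube and the continuity of the model in the state -/

namespace Network

variable {N K : ℕ} {G : Network N K}

variable (G) in
/-- The coordinatewise projection of the state space onto the hypercube. -/
def clamp (x : State K) : State K := fun i => max G.a (min G.b (x i))

theorem clamp_mem (hG : G.Admissible) (x : State K) : G.clamp x ∈ G.box :=
  ⟨fun _ => le_max_left _ _, fun _ => max_le hG.lt.le (min_le_left _ _)⟩

theorem clamp_of_mem {x : State K} (hx : x ∈ G.box) : G.clamp x = x := by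
  funext i
  simp [clamp, min_eq_right (hx.2 i), max_eq_right (hx.1 i)]

theorem continuous_clamp : Continuous G.clamp := by
  unfold clamp; fun_prop

theorem tail_mem_paramBox {x : State K} (hx : x ∈ G.box) : Fin.tail x ∈ G.paramBox :=
  ⟨fun i => hx.1 i.succ, fun i => hx.2 i.succ⟩

theorem continuous_shadowCov_clamp (hG : G.Admissible) (t : ℕ) :
    Continuous fun x => G.shadowCov t (G.clamp x) := by
  obtain ⟨KS, -, hKS⟩ := hG.lipschitz
  have hc : Continuous G.clamp := continuous_clamp
  refine continuous_matrix fun i j => continuous_iff_continuousAt.2 fun x => ?_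
  rw [ContinuousAt, tendsto_iff_dist_tendsto_zero]
  have hlim : Tendsto (fun x' => KS * ∑ k, |G.clamp x' k - G.clamp x k|) (𝓝 x) (𝓝 0) := by
    have : Continuous fun x' => KS * ∑ k, |G.clamp x' k - G.clamp x k| := by fun_prop
    simpa using this.tendsto x
  exact squeeze_zero (fun _ => dist_nonneg)
    (fun x' => hKS t i j _ (clamp_mem hG x') _ (clamp_mem hG x)) hlim

theorem continuous_obsCov_clamp (hG : G.Admissible) (t : ℕ) :
    Continuous fun x => G.obsCov t (G.clamp x) :=
  (continuous_shadowCov_clamp hG t).add continuous_const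

theorem continuous_crossCov_clamp (hG : G.Admissible) {q : Plane}
    (hcross : ∀ t i, ContinuousOn (fun θ => G.R q (G.p t i) θ) G.paramBox) (t : ℕ) :
    Continuous fun x => G.crossCov q t (G.clamp x) := by
  refine continuous_pi fun j => ?_
  have hc : Continuous fun x => Fin.tail (G.clamp x) := by
    have := continuous_clamp (G := G)
    unfold Fin.tail; fun_prop
  exact (hcross t j).comp_continuous hc fun x => tail_mem_paramBox (clamp_mem hG x)

theorem posDef_obsCov (hG : G.Admissible) (t : ℕ) {x : State K} (hx : x ∈ G.box) :
    (G.obsCov t x).PosDef := by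
  have hS : (G.shadowCov t x).PosSemidef :=
    hG.posDef _ (tail_mem_paramBox hx) N (G.p t) (hG.p_mem t)
  have hC : (G.obsCov t x).IsHermitian :=
    (hS.add (Matrix.PosSemidef.one.smul G.xiVar.coe_nonneg)).isHermitian
  obtain ⟨c, hc, hmin⟩ := hG.expansive
  refine hC.posDef_iff_eigenvalues_pos.2 fun i => ?_
  have := hmin t x hx _ (hC.eigenvalues_mem_spectrum_real i)
  linarith

variable (G) in
/-- The covariance matrix of shadowing plus fading noise. -/
def noiseCov (q : Plane) (t : ℕ) (x : State K) : Matrix (Option (Fin N)) (Option (Fin N)) ℝ :=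
  G.augCov q t x + (G.xiVar : ℝ) • (1 : Matrix (Option (Fin N)) (Option (Fin N)) ℝ)

theorem posSemidef_augCov (hG : G.Admissible) {q : Plane} (hq : q ∈ G.S) (t : ℕ) {x : State K}
    (hx : x ∈ G.box) : (G.augCov q t x).PosSemidef := by
  let e : Option (Fin N) ≃ Fin (N + 1) := (finSuccEquiv N).symm
  have hmem : ∀ i, G.augPos q t i ∈ G.S := by
    rintro (_ | i)
    exacts [hq, hG.p_mem t i]
  have := (hG.posDef _ (tail_mem_paramBox hx) (N + 1) (fun i => G.augPos q t (e.symm i))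
    fun i => hmem _).submatrix e
  convert this using 1
  ext i j
  simp [augCov]

theorem posSemidef_noiseCov (hG : G.Admissible) {q : Plane} (hq : q ∈ G.S) (t : ℕ) {x : State K}
    (hx : x ∈ G.box) : (G.noiseCov q t x).PosSemidef :=
  (posSemidef_augCov hG hq t hx).add (Matrix.PosSemidef.one.smul G.xiVar.coe_nonneg)

theorem noiseCov_submatrix_some (q : Plane) (t : ℕ) (x : State K) :
    (G.noiseCov q t x).submatrix some some = G.obsCov t x := by
  ext i j
  simp [noiseCov, obsCov, augCov, shadowCov, augPos, Matrix.one_apply]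

theorem noiseCov_some_none (hG : G.Admissible) {q : Plane} (hq : q ∈ G.S) (t : ℕ) {x : State K}
    (hx : x ∈ G.box) (j : Fin N) : G.noiseCov q t x (some j) none = G.crossCov q t x j := by
  have := (posSemidef_augCov hG hq t hx).isHermitian.apply none (some j)
  simp only [star_trivial] at this
  simp [noiseCov, this]
  simp [augCov, augPos, crossCov]

theorem obsMatrix_mulVec (t : ℕ) (x : State K) (i : Fin N) :
    (G.obsMatrix t *ᵥ x) i = G.pathLoss (G.p t i) * x 0 := by
  simp [obsMatrix, Matrix.mulVec, row]

theorem row_dotProduct (u : Plane) (x : State K) : G.row u ⬝ᵥ x = G.pathLoss u * x 0 := by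
  simp [row]

theorem continuous_inv_obsCov_clamp (hG : G.Admissible) (t : ℕ) :
    Continuous fun x => (G.obsCov t (G.clamp x))⁻¹ := by
  have hc := continuous_obsCov_clamp hG t
  simp_rw [Matrix.inv_def, Ring.inverse_eq_inv']
  exact (hc.matrix_det.inv₀ fun x => (posDef_obsCov hG t (clamp_mem hG x)).det_pos.ne').smul
    hc.matrix_adjugate

theorem continuous_likelihood_clamp (hG : G.Admissible) (t : ℕ) :
    Continuous fun p : (Fin N → ℝ) × State K => G.likelihood t p.1 (G.clamp p.2) := by
  have h1 := (continuous_inv_obsCov_clamp hG t).comp (continuous_snd (X := Fin N → ℝ))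
  have h2 := ((continuous_obsCov_clamp hG t).comp (continuous_snd (X := Fin N → ℝ))).matrix_det
  have hc : Continuous G.clamp := continuous_clamp
  have h3 : Continuous fun p : (Fin N → ℝ) × State K => p.1 - G.obsMatrix t *ᵥ G.clamp p.2 :=
    continuous_fst.sub (continuous_const.matrix_mulVec (hc.comp continuous_snd))
  have h4 := h3.dotProduct (h1.matrix_mulVec h3)
  unfold likelihood
  refine (Real.continuous_exp.comp (continuous_const.mul h4)).div
    (Real.continuous_sqrt.comp h2) fun p => ?_
  exact (Real.sqrt_pos.2 (posDef_obsCov hG t (clamp_mem hG p.2)).det_pos).ne'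

theorem continuous_kriging_clamp (hG : G.Admissible) {q : Plane}
    (hcross : ∀ t i, ContinuousOn (fun θ => G.R q (G.p t i) θ) G.paramBox) (t : ℕ) :
    Continuous fun p : (Fin N → ℝ) × State K => G.kriging q t (G.clamp p.2) p.1 := by
  have h1 := (continuous_inv_obsCov_clamp hG t).comp (continuous_snd (X := Fin N → ℝ))
  have h2 := (continuous_crossCov_clamp hG hcross t).comp (continuous_snd (X := Fin N → ℝ))
  have hc : Continuous G.clamp := continuous_clamp
  have h3 : Continuous fun p : (Fin N → ℝ) × State K => p.1 - G.obsMatrix t *ᵥ G.clamp p.2 :=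
    continuous_fst.sub (continuous_const.matrix_mulVec (hc.comp continuous_snd))
  unfold kriging
  exact (continuous_const.dotProduct (hc.comp continuous_snd)).add
    (h2.dotProduct (h1.matrix_mulVec h3))

theorem likelihood_pos (hG : G.Admissible) (t : ℕ) (v : Fin N → ℝ) {x : State K}
    (hx : x ∈ G.box) : 0 < G.likelihood t v x :=
  div_pos (Real.exp_pos _) (Real.sqrt_pos.2 (posDef_obsCov hG t hx).det_pos)

/-! ### The law of the noise given the states -/

variable {Ω : Type*} {q : Plane} {X : ℕ → Ω → State K}
  {sh : ℕ → Ω → EuclideanSpace ℝ (Option (Fin N))} {ξ : ℕ → Option (Fin N) → Ω → ℝ}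

/-- The shadowing plus the fading noise, at the sensors and at the imaginary sensor. -/
def noise (sh : ℕ → Ω → EuclideanSpace ℝ (Option (Fin N))) (ξ : ℕ → Option (Fin N) → Ω → ℝ)
    (t : ℕ) (ω : Ω) : EuclideanSpace ℝ (Option (Fin N)) :=
  sh t ω + WithLp.toLp 2 fun i => ξ t i ω

theorem augObs_eq (t : ℕ) (i : Option (Fin N)) (ω : Ω) :
    G.augObs q X sh ξ t i ω
      = G.pathLoss (G.augPos q t i) * X (t + 1) ω 0 + noise sh ξ t ω i := by
  simp [augObs, noise, add_assoc]

variable [MeasurableSpace Ω] {μ : Measure Ω}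

theorem IsObservationModel.measurable_noise (h : G.IsObservationModel μ q X sh ξ) (t : ℕ) :
    Measurable (noise sh ξ t) := by
  have h1 := h.measurable_sh t
  have h2 := h.measurable_xi t
  unfold noise
  fun_prop

theorem IsObservationModel.measurable_sensor (h : G.IsObservationModel μ q X sh ξ)
    (y : ℕ → Ω → Fin N → ℝ) (hy : y = fun t ω i => G.augObs q X sh ξ t (some i) ω) (t : ℕ) :
    Measurable (y t) := by
  have hXm := h.measurable_X
  have hnm := h.measurable_noise
  rw [hy]
  refine measurable_pi_lambda _ fun i => ?_
  simp_rw [augObs_eq]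
  fun_prop

variable [IsProbabilityMeasure μ]

/-- Given the state trajectory, the noise vectors at distinct times are independent, centered and
Gaussian. The conditional law is a kernel on trajectories, identified on the trajectories of `X`
only, as the kernel matrices are covariance matrices on the hypercube only. -/
theorem IsObservationModel.exists_condLaw (h : G.IsObservationModel μ q X sh ξ)
    (hG : G.Admissible) (hq : q ∈ G.S) (m : ℕ) :
    ∃ η : Kernel (ℕ → State K) (Fin m → EuclideanSpace ℝ (Option (Fin N))), IsMarkovKernel η ∧
      μ.map (fun ω => (fun k => X k ω, fun i : Fin m => noise sh ξ i ω))
        = μ.map (fun ω k => X k ω) ⊗ₘ η ∧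
      ∀ᵐ ω ∂μ, η (fun k => X k ω) = Measure.pi fun i : Fin m =>
        multivariateGaussian 0 (G.noiseCov q i (X (i + 1) ω)) := by
  have hXm := h.measurable_X
  have hsm := h.measurable_sh
  have hξm := h.measurable_xi
  have := exists_kernel_noisyShadowing (μ := μ) (X := fun ω k => X k ω)
    (s := fun ω (i : Fin m) => sh i ω)
    (e := fun ω (i : Fin m) => (WithLp.toLp 2 fun j => ξ i j ω : EuclideanSpace ℝ (Option (Fin N))))
    (by fun_prop) (by fun_prop) (by fun_prop) (fun i x => G.augCov q i (x (i + 1)))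
    ?_ ?_ (v := G.xiVar) ?_ ?_
  · exact this
  · rw [ae_all_iff]
    intro i
    filter_upwards [h.X_mem (i + 1)] with ω hω using posSemidef_augCov hG hq i hω
  · intro B hB
    have := h.shadowing m (fun t => if ht : t < m then B ⟨t, ht⟩ else Set.univ) (by
      intro t
      by_cases ht : t < m
      · simpa [ht] using hB _
      · simp [ht])
    have hset : {ω | ∀ t < m, sh t ω ∈ (if ht : t < m then B ⟨t, ht⟩ else Set.univ)}
        = {ω | ∀ i : Fin m, sh i ω ∈ B i} := by
      ext ω
      constructor
      · intro hω i
        simpa using hω i i.2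
      · intro hω t ht
        simpa [ht] using hω ⟨t, ht⟩
    rw [hset] at this
    refine this.trans (ae_of_all _ fun ω => ?_)
    dsimp only
    rw [Finset.prod_range]
    exact Finset.prod_congr rfl fun i _ => by simp
  · refine map_whiteNoise (ξ := fun (i : Fin m) j => ξ i j) (fun i j => hξm i j) ?_
      fun i j => h.xi_law i j
    exact h.xi_indep.precomp (g := fun p : Fin m × Option (Fin N) => ((p.1 : ℕ), p.2))
      fun p p' hpp => by
        simp only [Prod.mk.injEq, Fin.val_inj] at hpp
        exact Prod.ext hpp.1 hpp.2
  · exact h.xi_indep_state.comp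
      (φ := fun p => (p.1, fun i : Fin m => p.2 i))
      (ψ := fun z (i : Fin m) => (WithLp.toLp 2 fun j => z i j : EuclideanSpace ℝ (Option (Fin N))))
      (by fun_prop) (by fun_prop)

theorem IsObservationModel.memLp_noise (h : G.IsObservationModel μ q X sh ξ)
    (hG : G.Admissible) (hN : 0 < N) (hq : q ∈ G.S) (t : ℕ) (k : Option (Fin N)) :
    MemLp (fun ω => noise sh ξ t ω k) 2 μ := by
  obtain ⟨η, hη, hjoint, hae⟩ := h.exists_condLaw hG hq (t + 1)
  have hXm := h.measurable_X
  have hnm := h.measurable_noise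
  have hkmem : G.augPos q t k ∈ G.S := by
    rcases k with _ | i
    exacts [hq, hG.p_mem t i]
  have hcont : Continuous fun x => G.shadowCov t (G.clamp x) ⟨0, hN⟩ ⟨0, hN⟩ + (G.xiVar : ℝ) :=
    ((continuous_shadowCov_clamp hG t).matrix_elem _ _).add continuous_const
  obtain ⟨c, hc⟩ := (isCompact_Icc (a := fun _ => G.a) (b := fun _ => G.b) :
    IsCompact G.box).bddAbove_image hcont.continuousOn
  refine memLp_two_of_condLaw (S := fun (i : Fin (t + 1)) x => G.noiseCov q i (x (i + 1)))
    (X := fun ω k => X k ω) (ζ := fun ω (i : Fin (t + 1)) => noise sh ξ i ω)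
    (by fun_prop) (by fun_prop) hjoint hae (Fin.last t) k ?_ (c := c) ?_
  · filter_upwards [h.X_mem (t + 1)] with ω hω using posSemidef_noiseCov hG hq t hω
  · filter_upwards [h.X_mem (t + 1)] with ω hω
    have h1 := hc ⟨_, hω, rfl⟩
    have hθ := tail_mem_paramBox hω
    simp only [clamp_of_mem hω, shadowCov, Matrix.of_apply, hG.diag _ hθ _ (hG.p_mem t _)] at h1
    simpa [noiseCov, augCov, hG.diag _ hθ _ hkmem] using h1

end Network

/-! ### Kriging -/

theorem iSup_comap_eq_comap {Ω E : Type*} [MeasurableSpace E] (y : ℕ → Ω → E) (t : ℕ) :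
    (⨆ i ≤ t, MeasurableSpace.comap (y i) inferInstance)
      = MeasurableSpace.comap (fun ω (i : Fin (t + 1)) => y i ω) inferInstance := by
  rw [MeasurableSpace.pi, MeasurableSpace.comap_iSup]
  simp_rw [MeasurableSpace.comap_comp]
  refine le_antisymm (iSup₂_le fun i hi => ?_) (iSup_le fun i => ?_)
  · exact le_iSup (fun i : Fin (t + 1) => MeasurableSpace.comap ((fun b : Fin (t + 1) → E => b i) ∘
      fun ω (i : Fin (t + 1)) => y i ω) inferInstance) ⟨i, Nat.lt_succ_of_le hi⟩
  · exact le_iSup₂ (f := fun i (_ : i ≤ t) => MeasurableSpace.comap (y i) inferInstance) (i : ℕ)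
      (Nat.le_of_lt_succ i.2)

namespace Network

variable {N K : ℕ} {G : Network N K}

variable (G) in
/-- The conditional mean of the log-magnitude at `q` at time `t + ρ`, given that the state is `x` at
that time and that the sensors observed `y` up to time `t`. -/
noncomputable def target (q : Plane) (ρ t : ℕ) (y : ℕ → Fin N → ℝ) (x : State K) : ℝ :=
  if ρ = 0 then G.kriging q t x (y t) else G.row q ⬝ᵥ x

variable (G) in
/-- The exact predictor of the log-magnitude at `q` at time `t + ρ`, as a function of the realization
`y` of the observations: the quotient of integrals in Bayes' formula. The factor `(2π) ^ (-N/2)` of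
the Gaussian densities cancels and is left out. -/
noncomputable def bayesPredictor {Ω : Type*} [MeasurableSpace Ω] (μ : Measure Ω)
    (X : ℕ → Ω → State K) (q : Plane) (ρ t : ℕ) (y : ℕ → Fin N → ℝ) : ℝ :=
  (∫ ω, (∏ k ∈ Finset.range (t + 1), G.likelihood k (y k) (G.clamp (X (k + 1) ω))) *
      G.target q ρ t y (G.clamp (X (t + ρ + 1) ω)) ∂μ) /
    ∫ ω, ∏ k ∈ Finset.range (t + 1), G.likelihood k (y k) (G.clamp (X (k + 1) ω)) ∂μ

theorem continuous_target_clamp (hG : G.Admissible) {q : Plane}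
    (hcross : ∀ t i, ContinuousOn (fun θ => G.R q (G.p t i) θ) G.paramBox) (ρ t : ℕ) :
    Continuous fun p : (ℕ → Fin N → ℝ) × State K => G.target q ρ t p.1 (G.clamp p.2) := by
  unfold target
  have hc : Continuous G.clamp := continuous_clamp
  by_cases hρ : ρ = 0
  · simp only [hρ, if_true]
    exact (continuous_kriging_clamp hG hcross t).comp
      (f := fun p : (ℕ → Fin N → ℝ) × State K => (p.1 t, p.2)) (by fun_prop)
  · simp only [hρ, if_false]
    exact continuous_const.dotProduct (hc.comp continuous_snd)

theorem exists_bound_comp_clamp (hG : G.Admissible) {f : State K → ℝ}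
    (hf : Continuous fun x => f (G.clamp x)) : ∃ c, ∀ x, |f (G.clamp x)| ≤ c := by
  obtain ⟨c, hc⟩ := (isCompact_Icc (a := fun _ => G.a) (b := fun _ => G.b) :
    IsCompact G.box).exists_bound_of_continuousOn hf.continuousOn
  refine ⟨c, fun x => ?_⟩
  simpa [clamp_of_mem (clamp_mem hG x)] using hc _ (clamp_mem hG x)

variable {Ω : Type*} {q : Plane} {X : ℕ → Ω → State K}
  {sh : ℕ → Ω → EuclideanSpace ℝ (Option (Fin N))} {ξ : ℕ → Option (Fin N) → Ω → ℝ}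
  [MeasurableSpace Ω] {μ : Measure Ω} [IsProbabilityMeasure μ]

theorem map_sensor_multivariateGaussian (hG : G.Admissible) (hq : q ∈ G.S) (t : ℕ) {x : State K}
    (hx : x ∈ G.box) :
    (multivariateGaussian 0 (G.noiseCov q t x)).map
        (fun z j => G.pathLoss (G.p t j) * x 0 + z (some j))
      = volume.withDensity fun v =>
          ENNReal.ofReal ((√(2 * Real.pi))⁻¹ ^ N * G.likelihood t v (G.clamp x)) := by
  have h1 := map_multivariateGaussian_comp (posSemidef_noiseCov hG hq t hx)
    (some : Fin N → Option (Fin N))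
  rw [noiseCov_submatrix_some] at h1
  have h2 := map_multivariateGaussian_eq_withDensity (posDef_obsCov hG t hx) (G.obsMatrix t *ᵥ x)
  rw [← h1, Measure.map_map (by fun_prop) (by fun_prop), Fintype.card_fin] at h2
  rw [clamp_of_mem hx]
  unfold likelihood
  rw [← h2]
  congr 1
  funext z j
  simp [obsMatrix_mulVec]

variable (G) in
/-- The coefficients of the linear regression of the noise at `q` on the noise at the sensors. -/
noncomputable def krigingCoeff (q : Plane) (t : ℕ) (x : State K) : Fin N → ℝ :=
  G.crossCov q t x ᵥ* (G.obsCov t x)⁻¹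

theorem continuous_krigingCoeff_clamp (hG : G.Admissible)
    (hcross : ∀ t i, ContinuousOn (fun θ => G.R q (G.p t i) θ) G.paramBox) (t : ℕ) :
    Continuous fun x => G.krigingCoeff q t (G.clamp x) :=
  (continuous_crossCov_clamp hG hcross t).matrix_vecMul (continuous_inv_obsCov_clamp hG t)

theorem kriging_eq (t : ℕ) (x : State K) (v : Fin N → ℝ) :
    G.kriging q t x v = G.pathLoss q * x 0
      + ∑ i, G.krigingCoeff q t x i * (v i - G.pathLoss (G.p t i) * x 0) := by
  rw [kriging, row_dotProduct, Matrix.dotProduct_mulVec]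
  simp [dotProduct, krigingCoeff, obsMatrix_mulVec]

theorem noiseCov_normal_equations (hG : G.Admissible) (hq : q ∈ G.S) (t : ℕ) {x : State K}
    (hx : x ∈ G.box) (j : Fin N) :
    G.noiseCov q t x (some j) none
      = ∑ i, G.krigingCoeff q t x i * G.noiseCov q t x (some j) (some i) := by
  have hC := posDef_obsCov hG t hx
  have h1 : ∀ i, G.noiseCov q t x (some j) (some i) = G.obsCov t x i j := fun i => by
    rw [← noiseCov_submatrix_some q t x]
    simpa using ((posSemidef_noiseCov hG hq t hx).isHermitian.apply (some i) (some j))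
  simp_rw [h1]
  have h2 : G.krigingCoeff q t x ᵥ* G.obsCov t x = G.crossCov q t x := by
    rw [krigingCoeff, Matrix.vecMul_vecMul,
      Matrix.nonsing_inv_mul _ (isUnit_iff_ne_zero.2 hC.det_pos.ne'), Matrix.vecMul_one]
  rw [noiseCov_some_none hG hq t hx, ← congrFun h2 j]
  rfl

/-- The part of the log-magnitude at `q` that is not accounted for by `target` has vanishing
conditional expectation given the observations. For `ρ = 0` it is the residual of the regression of
the noise at `q` on the noise at the sensors, and for `ρ ≥ 1` it is the noise at `q` itself. -/
theorem IsObservationModel.condExp_residual (h : G.IsObservationModel μ q X sh ξ)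
    (hG : G.Admissible) (hN : 0 < N) (hq : q ∈ G.S)
    (hcross : ∀ t i, ContinuousOn (fun θ => G.R q (G.p t i) θ) G.paramBox) (ρ t : ℕ)
    (y : ℕ → Ω → Fin N → ℝ) (hy : y = fun t ω i => G.augObs q X sh ξ t (some i) ω)
    (r : (ℕ → State K) → EuclideanSpace ℝ (Option (Fin N)) → ℝ)
    (hr : r = fun x z => z none - if ρ = 0 then
      ∑ i, G.krigingCoeff q t (G.clamp (x (t + ρ + 1))) i * z (some i) else 0) :
    Integrable (fun ω => r (fun k => X k ω) (noise sh ξ (t + ρ) ω)) μ ∧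
    μ[fun ω => r (fun k => X k ω) (noise sh ξ (t + ρ) ω) |
      MeasurableSpace.comap (fun ω (i : Fin (t + 1)) => y i ω) inferInstance] =ᵐ[μ] 0 := by
  have hXm := h.measurable_X
  have hnm := h.measurable_noise
  have hym := h.measurable_sensor y hy
  have hcc := continuous_krigingCoeff_clamp hG hcross t
  have hcm : ∀ i, Measurable fun x => G.krigingCoeff q t (G.clamp x) i :=
    fun i => ((continuous_apply i).comp hcc).measurable
  have hrm : Measurable (Function.uncurry r) := by
    rw [hr]
    unfold Function.uncurry
    by_cases hρ : ρ = 0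
    · simp only [hρ, if_true]
      refine Measurable.sub (by fun_prop) (Finset.measurable_sum _ fun i _ => Measurable.mul ?_
        (by fun_prop))
      exact (hcm i).comp (g := fun x => G.krigingCoeff q t (G.clamp x) i)
        (f := fun p : (ℕ → State K) × EuclideanSpace ℝ (Option (Fin N)) => p.1 (t + 0 + 1))
        (by fun_prop)
    · simp only [hρ, if_false]
      fun_prop
  have hnint : ∀ k, Integrable (fun ω => noise sh ξ (t + ρ) ω k) μ := fun k =>
    (h.memLp_noise hG hN hq (t + ρ) k).integrable one_le_two
  have hint : Integrable (fun ω => r (fun k => X k ω) (noise sh ξ (t + ρ) ω)) μ := by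
    rw [hr]
    refine (hnint none).sub ?_
    by_cases hρ : ρ = 0
    · simp only [hρ, if_true]
      refine integrable_finsetSum _ fun i _ => ?_
      obtain ⟨c, hc⟩ := exists_bound_comp_clamp hG (f := fun x => G.krigingCoeff q t x i)
        ((continuous_apply i).comp hcc)
      have hni := hnint (some i)
      simp only [hρ] at hni
      exact hni.bdd_mul ((hcm i).comp (hXm (t + 0 + 1))).aestronglyMeasurable (c := c)
        (ae_of_all _ fun ω => hc _)
    · simp only [hρ, if_false]
      exact integrable_const _
  refine ⟨hint, ?_⟩
  obtain ⟨η, hη, hjoint, hae⟩ := h.exists_condLaw hG hq (t + ρ + 1)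
  have hVm : Measurable fun ω (i : Fin (t + 1)) => y i ω := by fun_prop
  refine condExp_eq_zero_of_piSystem hVm.comap_le hint
    ((fun s => (fun ω (i : Fin (t + 1)) => y i ω) ⁻¹' s) '' (Set.univ.pi ''
      Set.univ.pi fun _ : Fin (t + 1) => {s : Set (Fin N → ℝ) | MeasurableSet s})) ?_ ?_ ?_ ?_
  · exact isPiSystem_pi.comap _
  · rw [← generateFrom_pi, MeasurableSpace.comap_generateFrom]
  · exact ⟨Set.univ, ⟨fun _ => Set.univ, by simp, Set.pi_univ _⟩, rfl⟩
  · rintro _ ⟨_, ⟨B, hB, rfl⟩, rfl⟩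
    -- The noise up to time `t + ρ` is involved, but only the observations up to time `t` are
    -- constrained.
    let B' : Fin (t + ρ + 1) → Set (Fin N → ℝ) := fun i =>
      if hi : (i : ℕ) ≤ t then B ⟨i, Nat.lt_succ_of_le hi⟩ else Set.univ
    have hB' : ∀ i, MeasurableSet (B' i) := fun i => by
      by_cases hi : (i : ℕ) ≤ t
      · simp only [B', hi, dif_pos]
        exact hB _ (Set.mem_univ _)
      · simp [B', hi]
    let obs : Fin (t + ρ + 1) → (ℕ → State K) → EuclideanSpace ℝ (Option (Fin N)) → Fin N → ℝ :=
      fun i x z j => G.pathLoss (G.p i j) * x (i + 1) 0 + z (some j)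
    have hobs : ∀ i, Measurable (Function.uncurry (obs i)) := fun i => by
      unfold Function.uncurry
      fun_prop
    have key := setIntegral_eq_zero_of_condLaw (μ := μ) (X := fun ω k => X k ω)
      (ζ := fun ω (i : Fin (t + ρ + 1)) => noise sh ξ i ω)
      (Γ := fun i x => multivariateGaussian 0 (G.noiseCov q i (x (i + 1))))
      (by fun_prop) (by fun_prop) hjoint hae hobs hB' (j := Fin.last (t + ρ)) hrm
      (by simpa using hint) ?_
    · have hset : {ω | ∀ i : Fin (t + ρ + 1), obs i (fun k => X k ω) (noise sh ξ i ω) ∈ B' i}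
          = (fun ω (i : Fin (t + 1)) => y i ω) ⁻¹' Set.univ.pi B := by
        ext ω
        have hyobs : ∀ i : Fin (t + ρ + 1), obs i (fun k => X k ω) (noise sh ξ i ω) = y i ω := by
          intro i; funext j
          simp only [hy, augObs_eq]; rfl
        simp only [Set.mem_ofPred_eq, hyobs, Set.mem_preimage, Set.mem_univ_pi]
        constructor
        · intro hω i
          have := hω ⟨i, by omega⟩
          simpa [B', Nat.le_of_lt_succ i.2] using this
        · intro hω i
          by_cases hi : (i : ℕ) ≤ t
          · simpa [B', hi] using hω ⟨i, Nat.lt_succ_of_le hi⟩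
          · simp [B', hi]
      rw [hset] at key
      exact key
    · filter_upwards [h.X_mem (t + ρ + 1)] with ω hω
      simp only [Fin.val_last]
      by_cases hρ : ρ = 0
      · subst hρ
        simp only [add_zero] at hω ⊢
        have hshift : MeasurableSet ((fun v : Fin N → ℝ => fun j =>
            G.pathLoss (G.p t j) * X (t + 1) ω 0 + v j) ⁻¹' B' (Fin.last t)) :=
          (show Measurable fun v : Fin N → ℝ => fun j =>
            G.pathLoss (G.p t j) * X (t + 1) ω 0 + v j by fun_prop) (hB' _)
        have := integral_residual_eq_zero (posSemidef_noiseCov hG hq t hω)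
          (noiseCov_normal_equations hG hq t hω) hshift
        rw [← this, hr]
        simp only [if_true, add_zero, clamp_of_mem hω]
        rfl
      · have hlast : B' (Fin.last (t + ρ)) = Set.univ := by
          exact dif_neg (by simp; omega)
        rw [hlast, hr]
        simp [hρ, integral_eval_multivariateGaussian]

end Network

/-! ### The exact predictor -/

namespace Network

variable {N K : ℕ} {G : Network N K} {Ω : Type*} {q : Plane} {X : ℕ → Ω → State K}
  {sh : ℕ → Ω → EuclideanSpace ℝ (Option (Fin N))} {ξ : ℕ → Option (Fin N) → Ω → ℝ}
  [MeasurableSpace Ω] {μ : Measure Ω} [IsProbabilityMeasure μ]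

theorem IsObservationModel.map_sensor_eq_withDensity (h : G.IsObservationModel μ q X sh ξ)
    (hG : G.Admissible) (hq : q ∈ G.S) (t : ℕ)
    (y : ℕ → Ω → Fin N → ℝ) (hy : y = fun t ω i => G.augObs q X sh ξ t (some i) ω) :
    μ.map (fun ω => ((fun k => X k ω), fun i : Fin (t + 1) => y i ω))
      = ((μ.map fun ω k => X k ω).prod (volume : Measure (Fin (t + 1) → Fin N → ℝ))).withDensity
          fun p => ENNReal.ofReal (∏ i : Fin (t + 1), ((√(2 * Real.pi))⁻¹ ^ N *
            G.likelihood i (p.2 i) (G.clamp (p.1 (i + 1))))) := by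
  obtain ⟨η, hη, hjoint, hae⟩ := h.exists_condLaw hG hq (t + 1)
  have hXm := h.measurable_X
  have hnm := h.measurable_noise
  let obs : Fin (t + 1) → (ℕ → State K) → EuclideanSpace ℝ (Option (Fin N)) → Fin N → ℝ :=
    fun i x z j => G.pathLoss (G.p i j) * x (i + 1) 0 + z (some j)
  have hobs : ∀ i, Measurable (Function.uncurry (obs i)) := fun i => by
    unfold Function.uncurry
    fun_prop
  have hlaw := map_observation_eq_withDensity (μ := μ) (X := fun ω k => X k ω)
      (ζ := fun ω (i : Fin (t + 1)) => noise sh ξ i ω)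
      (Γ := fun i x => multivariateGaussian 0 (G.noiseCov q i (x (i + 1))))
      (ℓ := fun i x v => (√(2 * Real.pi))⁻¹ ^ N * G.likelihood i v (G.clamp (x (i + 1))))
      (by fun_prop) (by fun_prop) hjoint hae hobs (fun i => by
        refine Measurable.const_mul ?_ _
        exact (continuous_likelihood_clamp hG i).measurable.comp
          (f := fun p : (ℕ → State K) × (Fin N → ℝ) => (p.2, p.1 ((i : ℕ) + 1))) (by fun_prop))
      (fun i x v => mul_nonneg (by positivity) (likelihood_pos hG i v (clamp_mem hG _)).le) (by
        rw [ae_all_iff]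
        intro i
        filter_upwards [h.X_mem (i + 1)] with ω hω
        exact map_sensor_multivariateGaussian hG hq i hω)
  rw [← hlaw]
  congr 1
  funext ω
  congr 1
  funext i j
  simp only [hy, augObs_eq]; rfl

theorem IsObservationModel.memLp_augObs (h : G.IsObservationModel μ q X sh ξ)
    (hG : G.Admissible) (hN : 0 < N) (hq : q ∈ G.S) (t : ℕ) :
    MemLp (G.augObs q X sh ξ t none) 2 μ := by
  have hXm := h.measurable_X
  obtain ⟨c, hc⟩ := exists_bound_comp_clamp hG (f := fun x => G.pathLoss q * x 0)
    (by have := continuous_clamp (G := G); fun_prop)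
  have h2 : MemLp (fun ω => G.pathLoss q * X (t + 1) ω 0) 2 μ := by
    refine MemLp.of_bound (by fun_prop) c ?_
    filter_upwards [h.X_mem (t + 1)] with ω hω
    simpa [clamp_of_mem hω] using hc (X (t + 1) ω)
  have h3 := h2.add (h.memLp_noise hG hN hq t none)
  convert h3 using 1
  funext ω
  rw [augObs_eq]; rfl

theorem IsObservationModel.condExp_eq_bayesPredictor (h : G.IsObservationModel μ q X sh ξ)
    (hG : G.Admissible) (hN : 0 < N) (hq : q ∈ G.S)
    (hcross : ∀ t i, ContinuousOn (fun θ => G.R q (G.p t i) θ) G.paramBox) (ρ t : ℕ)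
    (y : ℕ → Ω → Fin N → ℝ) (hy : y = fun t ω i => G.augObs q X sh ξ t (some i) ω) :
    μ[G.augObs q X sh ξ (t + ρ) none | ⨆ i ≤ t, MeasurableSpace.comap (y i) inferInstance]
      =ᵐ[μ] fun ω => G.bayesPredictor μ X q ρ t (fun s => y s ω) := by
  rw [iSup_comap_eq_comap]
  obtain ⟨hrint, hr0⟩ := h.condExp_residual hG hN hq hcross ρ t y hy _ rfl
  have hlaw := h.map_sensor_eq_withDensity hG hq t y hy
  have hXm := h.measurable_X
  have hym := h.measurable_sensor y hy
  have hVm : Measurable fun ω (i : Fin (t + 1)) => y i ω := by fun_prop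
  -- `target` takes a whole sequence of observations, but depends on the one at time `t` only.
  obtain ⟨ext, hextm, hext⟩ : ∃ ext : (Fin (t + 1) → Fin N → ℝ) → ℕ → Fin N → ℝ,
      Measurable ext ∧ ∀ y' : ℕ → Fin N → ℝ, ext (fun i => y' i) t = y' t := by
    refine ⟨fun v _ => v (Fin.last t), by fun_prop, fun y' => by simp⟩
  let g : (ℕ → State K) × (Fin (t + 1) → Fin N → ℝ) → ℝ := fun p =>
    G.target q ρ t (ext p.2) (G.clamp (p.1 (t + ρ + 1)))
  have htarget : ∀ y' : ℕ → Fin N → ℝ, ∀ x,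
      G.target q ρ t (ext fun i => y' i) x = G.target q ρ t y' x := by
    intro y' x
    simp only [target, hext]
  have hgm : Measurable g :=
    (continuous_target_clamp hG hcross ρ t).measurable.comp
      (f := fun p : (ℕ → State K) × _ => (ext p.2, p.1 (t + ρ + 1))) (by fun_prop)
  have hyq := (h.memLp_augObs hG hN hq (t + ρ)).integrable one_le_two
  have hdecomp : G.augObs q X sh ξ (t + ρ) none =ᵐ[μ]
      (fun ω => g (fun k => X k ω, fun i : Fin (t + 1) => y i ω)) +
      fun ω => noise sh ξ (t + ρ) ω none - if ρ = 0 then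
        ∑ i, G.krigingCoeff q t (G.clamp (X (t + ρ + 1) ω)) i * noise sh ξ (t + ρ) ω (some i)
        else 0 := by
    filter_upwards [h.X_mem (t + ρ + 1)] with ω hω
    simp only [g, Pi.add_apply, htarget (fun s => y s ω), clamp_of_mem hω, augObs_eq]
    by_cases hρ : ρ = 0
    · subst hρ
      simp [target, kriging_eq, hy, augObs_eq, augPos]
    · simp [target, hρ, row_dotProduct, augPos]
  have hgint : Integrable (fun ω => g (fun k => X k ω, fun i : Fin (t + 1) => y i ω)) μ := by
    refine (hyq.sub hrint).congr ?_
    filter_upwards [hdecomp] with ω hω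
    simp [hω]
  have hLm : Measurable fun p : (ℕ → State K) × (Fin (t + 1) → Fin N → ℝ) =>
      ∏ i : Fin (t + 1), ((√(2 * Real.pi))⁻¹ ^ N *
        G.likelihood i (p.2 i) (G.clamp (p.1 (i + 1)))) := by
    refine Finset.measurable_prod _ fun i _ => Measurable.const_mul ?_ _
    exact (continuous_likelihood_clamp hG i).measurable.comp
      (f := fun p : (ℕ → State K) × (Fin (t + 1) → Fin N → ℝ) => (p.2 i, p.1 ((i : ℕ) + 1)))
      (by fun_prop)
  have hbayes := condExp_eq_integral_div (μ := μ) (X := fun ω k => X k ω)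
    (V := fun ω (i : Fin (t + 1)) => y i ω) (by fun_prop) hVm hLm
    (fun p => Finset.prod_nonneg fun i _ => mul_nonneg (by positivity)
      (likelihood_pos hG i _ (clamp_mem hG _)).le) hlaw hgm hgint
  refine (condExp_congr_ae hdecomp).trans ((condExp_add hgint hrint _).trans ?_)
  filter_upwards [hbayes, hr0] with ω hω hω0
  rw [Pi.add_apply, hω, hω0, Pi.zero_apply, add_zero]
  simp only [g, htarget (fun s => y s ω), Finset.prod_mul_distrib, Finset.prod_const, mul_assoc]
  rw [integral_const_mul, integral_const_mul, mul_div_mul_left _ _ (by positivity)]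
  simp only [bayesPredictor, Finset.prod_range]

end Network

/-! ### The grid recursion and its adjoint -/

section Weighted

variable {ι S : Type*} [Fintype ι]

/-- The recursion `E_{k+1} = diag (w_k) P E_k`, started at `E`, where the weight `w k` is a function on
the state space that is read at the grid points `ctr`. -/
noncomputable def forward (P : Matrix ι ι ℝ) (ctr : ι → S) (w : ℕ → S → ℝ) (E : ι → ℝ) :
    ℕ → ι → ℝ
  | 0 => E
  | k + 1 => fun l => w k (ctr l) * (P *ᵥ forward P ctr w E k) l

/-- The adjoint of `m` steps of the recursion `forward`, applied to the function `u`: in each step one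
multiplies with a weight and applies the transpose of `P`. -/
noncomputable def backward (P : Matrix ι ι ℝ) (ctr : ι → S) (u : S → ℝ) :
    ℕ → (ℕ → S → ℝ) → ι → ℝ
  | 0, _ => fun l => u (ctr l)
  | m + 1, w => fun l => ∑ i, P i l * (w 0 (ctr i) * backward P ctr u m (fun k => w (k + 1)) i)

theorem forward_congr (P : Matrix ι ι ℝ) {ctr : ι → S} {w w' : ℕ → S → ℝ} (E : ι → ℝ)
    (h : ∀ k l, w k (ctr l) = w' k (ctr l)) (m : ℕ) :
    forward P ctr w E m = forward P ctr w' E m := by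
  induction m with
  | zero => rfl
  | succ m ih => simp only [forward, ih, h]

theorem forward_succ' (P : Matrix ι ι ℝ) (ctr : ι → S) (w : ℕ → S → ℝ) (E : ι → ℝ) (m : ℕ) :
    forward P ctr w E (m + 1)
      = forward P ctr (fun k => w (k + 1)) (fun l => w 0 (ctr l) * (P *ᵥ E) l) m := by
  induction m with
  | zero => rfl
  | succ m ih => rw [forward, ih]; rfl

theorem sum_forward_mul (P : Matrix ι ι ℝ) (ctr : ι → S) (u : S → ℝ) (m : ℕ) (w : ℕ → S → ℝ)
    (E : ι → ℝ) :
    ∑ l, forward P ctr w E m l * u (ctr l) = ∑ l, E l * backward P ctr u m w l := by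
  induction m generalizing w E with
  | zero => rfl
  | succ m ih =>
    rw [forward_succ', ih]
    simp only [backward, Matrix.mulVec, dotProduct, Finset.mul_sum, Finset.sum_mul]
    rw [Finset.sum_comm]
    refine Finset.sum_congr rfl fun i _ => Finset.sum_congr rfl fun j _ => ?_
    ring

end Weighted

/-- Finite valued processes `Z n`, read through the points `ctr n`, approximate the process `X`, and
`P n` is their one step transition matrix relative to auxiliary `σ`-algebras. The `σ`-algebra `𝒢 k`
stands for the past of `X` at time `k`, `𝒮 k` for the present, and `𝒜 n k` for the past of `Z n`;
the field `tendsto_condExp` says that conditioning a function of the next present on the past yields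
a function of the present, and that conditioning it on the past of `Z n` instead makes an
asymptotically negligible error in mean. -/
structure IsConsistentApproximation {Ω E : Type*} [m0 : MeasurableSpace Ω] (μ : Measure Ω)
    [TopologicalSpace E] [MeasurableSpace E] {ι : ℕ → Type*} [∀ n, Fintype (ι n)]
    [∀ n, MeasurableSpace (ι n)] (X : ℕ → Ω → E) (Z : ∀ n, ℕ → Ω → ι n) (ctr : ∀ n, ι n → E)
    (P : ∀ n, Matrix (ι n) (ι n) ℝ) (𝒮 𝒢 : ℕ → MeasurableSpace Ω)
    (𝒜 : ℕ → ℕ → MeasurableSpace Ω) : Prop where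
  measurable_X : ∀ k, Measurable (X k)
  measurable_Z : ∀ n k, Measurable (Z n k)
  tendsto_ctr : ∀ k, ∀ᵐ ω ∂μ, Tendsto (fun n => ctr n (Z n k ω)) atTop (𝓝 (X k ω))
  present_le : ∀ k, 𝒮 k ≤ m0
  past_le : ∀ k, 𝒢 k ≤ m0
  past_mono : Monotone 𝒢
  aesm_present : ∀ (k : ℕ) (g : E → ℝ), Continuous g →
    AEStronglyMeasurable[𝒮 k] (fun ω => g (X k ω)) μ
  aesm_past : ∀ (k : ℕ) (g : E → ℝ), Continuous g →
    AEStronglyMeasurable[𝒢 k] (fun ω => g (X k ω)) μ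
  condExp_step : ∀ n k (v : ι n → ℝ), μ[fun ω => v (Z n (k + 1) ω) | 𝒜 n k]
    =ᵐ[μ] fun ω => ∑ i, P n i (Z n k ω) * v i
  tendsto_condExp : ∀ k (U : Ω → ℝ), AEStronglyMeasurable[𝒮 (k + 1)] U μ →
    (∃ c, ∀ᵐ ω ∂μ, |U ω| ≤ c) → AEStronglyMeasurable[𝒮 k] (μ[U | 𝒢 k]) μ ∧
      Tendsto (fun n => ∫ ω, |(μ[U | 𝒜 n k]) ω - (μ[U | 𝒢 k]) ω| ∂μ) atTop (𝓝 0)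

/-- The adjoint recursion started at the quantized state `Z n k₀` converges in `L¹` to a bounded
function `U` of the present, which represents the conditional expectation of the weighted functional
of the future of `X` given the past. The weights `w` and `u` may vary along the filter; all that is
asked is that they converge continuously and are eventually bounded. -/
theorem tendsto_backward {Ω E A : Type*} [m0 : MeasurableSpace Ω] {μ : Measure Ω}
    [IsProbabilityMeasure μ] [TopologicalSpace E] [MeasurableSpace E] [BorelSpace E]
    {ι : ℕ → Type*} [∀ n, Fintype (ι n)] [∀ n, MeasurableSpace (ι n)]
    [∀ n, DiscreteMeasurableSpace (ι n)]
    {X : ℕ → Ω → E} {Z : ∀ n, ℕ → Ω → ι n} {ctr : ∀ n, ι n → E} {P : ∀ n, Matrix (ι n) (ι n) ℝ}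
    {𝒮 𝒢 : ℕ → MeasurableSpace Ω} {𝒜 : ℕ → ℕ → MeasurableSpace Ω}
    (h : IsConsistentApproximation μ X Z ctr P 𝒮 𝒢 𝒜)
    {F : Filter A} [F.IsCountablyGenerated] {ν : A → ℕ} (hν : Tendsto ν F atTop)
    {u : A → E → ℝ} {u₀ : E → ℝ} (hu₀ : Continuous u₀)
    (hu : ∀ (x : E) (xa : A → E), Tendsto xa F (𝓝 x) → Tendsto (fun a => u a (xa a)) F (𝓝 (u₀ x)))
    {cu : ℝ} (hub : ∀ᶠ a in F, ∀ x, |u a x| ≤ cu) (hu₀b : ∀ x, |u₀ x| ≤ cu) (m : ℕ) :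
    ∀ (k₀ : ℕ) (w : A → ℕ → E → ℝ) (w₀ : ℕ → E → ℝ) (c : ℕ → ℝ), (∀ k, Continuous (w₀ k)) →
    (∀ (k : ℕ) (x : E) (xa : A → E), Tendsto xa F (𝓝 x) →
      Tendsto (fun a => w a k (xa a)) F (𝓝 (w₀ k x))) →
    (∀ k, ∀ᶠ a in F, ∀ x, |w a k x| ≤ c k) → (∀ k x, |w₀ k x| ≤ c k) →
    ∃ U : Ω → ℝ, AEStronglyMeasurable[𝒮 k₀] U μ ∧ (∃ c, ∀ᵐ ω ∂μ, |U ω| ≤ c) ∧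
      Tendsto (fun a => ∫ ω, |backward (P (ν a)) (ctr (ν a)) (u a) m (w a) (Z (ν a) k₀ ω) - U ω| ∂μ)
        F (𝓝 0) ∧
      ∀ (Φ : Ω → ℝ), AEStronglyMeasurable[𝒢 k₀] Φ μ → (∃ c, ∀ᵐ ω ∂μ, |Φ ω| ≤ c) →
        ∫ ω, Φ ω * U ω ∂μ
          = ∫ ω, Φ ω * ((∏ k ∈ Finset.range m, w₀ k (X (k₀ + k + 1) ω)) * u₀ (X (k₀ + m) ω)) ∂μ := by
  obtain ⟨hX, hZ, hconv, h𝒮, h𝒢, h𝒢mono, hX𝒮, hX𝒢, hstep, hlim⟩ := h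
  have hfin : ∀ (n k : ℕ) (v : ι n → ℝ), Measurable fun ω => v (Z n k ω) := fun n k v =>
    (Measurable.of_discrete (f := v)).comp (hZ n k)
  -- Dominated convergence for a weight evaluated at the quantized state.
  have hdom : ∀ (k : ℕ) (g : A → E → ℝ) (g₀ : E → ℝ) (c : ℝ), Continuous g₀ →
      (∀ (x : E) (xa : A → E), Tendsto xa F (𝓝 x) →
        Tendsto (fun a => g a (xa a)) F (𝓝 (g₀ x))) →
      (∀ᶠ a in F, ∀ x, |g a x| ≤ c) → (∀ x, |g₀ x| ≤ c) →
      Tendsto (fun a => ∫ ω, |g a (ctr (ν a) (Z (ν a) k ω)) - g₀ (X k ω)| ∂μ) F (𝓝 0) := by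
    intro k g g₀ c hg₀ hg hgb hg₀b
    have := tendsto_integral_filter_of_dominated_convergence (μ := μ) (l := F)
      (F := fun a ω => |g a (ctr (ν a) (Z (ν a) k ω)) - g₀ (X k ω)|) (f := fun _ => (0 : ℝ))
      (fun _ => c + c) (Eventually.of_forall fun a =>
        ((hfin _ k fun i => g a (ctr (ν a) i)).sub
          (hg₀.measurable.comp (hX k))).abs.aestronglyMeasurable) ?_ (integrable_const _) ?_
    · simpa using this
    · filter_upwards [hgb] with a ha
      refine ae_of_all _ fun ω => ?_
      rw [Real.norm_of_nonneg (abs_nonneg _)]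
      exact (abs_sub _ _).trans (add_le_add (ha _) (hg₀b _))
    · filter_upwards [hconv k] with ω hω
      have := (hg _ _ (hω.comp hν)).sub_const (g₀ (X k ω))
      simpa using this.abs
  induction m with
  | zero =>
    intro k₀ w w₀ c _ _ _ _
    exact ⟨fun ω => u₀ (X k₀ ω), hX𝒮 k₀ u₀ hu₀, ⟨cu, ae_of_all _ fun ω => hu₀b _⟩,
      hdom k₀ u u₀ cu hu₀ hu hub hu₀b, fun Φ _ _ => by simp⟩
  | succ m ih =>
    intro k₀ w w₀ c hw₀ hw hwb hw₀b
    obtain ⟨U', hU'm, ⟨cU, hcU⟩, hU'lim, hU'int⟩ := ih (k₀ + 1) (fun a k => w a (k + 1))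
      (fun k => w₀ (k + 1)) (fun k => c (k + 1)) (fun k => hw₀ _) (fun k => hw _)
      (fun k => hwb _) (fun k => hw₀b _)
    have hcU0 : 0 ≤ cU := by
      obtain ⟨ω, hω⟩ := hcU.exists
      exact (abs_nonneg _).trans hω
    have hc0 : 0 ≤ c 0 := by
      obtain ⟨ω, _⟩ := hcU.exists
      exact (abs_nonneg _).trans (hw₀b 0 (X 0 ω))
    let V : Ω → ℝ := fun ω => w₀ 0 (X (k₀ + 1) ω) * U' ω
    have hVm : AEStronglyMeasurable[𝒮 (k₀ + 1)] V μ := (hX𝒮 (k₀ + 1) _ (hw₀ 0)).mul hU'm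
    have hVb : ∀ᵐ ω ∂μ, |V ω| ≤ c 0 * cU := by
      filter_upwards [hcU] with ω hω
      rw [abs_mul]
      exact mul_le_mul (hw₀b _ _) hω (abs_nonneg _) hc0
    have hU'i : Integrable U' μ := Integrable.of_bound (hU'm.mono (h𝒮 _)) cU hcU
    have hVi : Integrable V μ := Integrable.of_bound (hVm.mono (h𝒮 _)) _ hVb
    obtain ⟨hUm, hUlim⟩ := hlim k₀ V hVm ⟨_, hVb⟩
    refine ⟨μ[V | 𝒢 k₀], hUm, ⟨c 0 * cU, ?_⟩, ?_, ?_⟩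
    · exact ae_bdd_abs_condExp_of_ae_bdd_abs hVb
    · let H : A → Ω → ℝ := fun a ω =>
        backward (P (ν a)) (ctr (ν a)) (u a) m (fun k => w a (k + 1)) (Z (ν a) (k₀ + 1) ω)
      have hHm : ∀ a, Measurable (H a) := fun a => hfin _ _ _
      let Y : A → Ω → ℝ := fun a ω => w a 0 (ctr (ν a) (Z (ν a) (k₀ + 1) ω)) * H a ω
      have hYi : ∀ a, Integrable (Y a) μ := by
        intro a
        let v : ι (ν a) → ℝ := fun i => w a 0 (ctr (ν a) i) *
          backward (P (ν a)) (ctr (ν a)) (u a) m (fun k => w a (k + 1)) i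
        obtain ⟨C, hC⟩ := (Set.finite_range fun i => |v i|).bddAbove
        exact Integrable.of_bound (hfin _ (k₀ + 1) v).aestronglyMeasurable C
          (ae_of_all _ fun ω => hC ⟨_, rfl⟩)
      have hHi : ∀ a, Integrable (H a) μ := by
        intro a
        let v : ι (ν a) → ℝ := backward (P (ν a)) (ctr (ν a)) (u a) m (fun k => w a (k + 1))
        obtain ⟨C, hC⟩ := (Set.finite_range fun i => |v i|).bddAbove
        exact Integrable.of_bound (hfin _ (k₀ + 1) v).aestronglyMeasurable C
          (ae_of_all _ fun ω => hC ⟨_, rfl⟩)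
      have hdw := hdom (k₀ + 1) (fun a => w a 0) (w₀ 0) (c 0) (hw₀ 0) (hw 0) (hwb 0) (hw₀b 0)
      have hbound : Tendsto (fun a => c 0 * ∫ ω, |H a ω - U' ω| ∂μ +
          cU * ∫ ω, |w a 0 (ctr (ν a) (Z (ν a) (k₀ + 1) ω)) - w₀ 0 (X (k₀ + 1) ω)| ∂μ +
          ∫ ω, |(μ[V | 𝒜 (ν a) k₀]) ω - (μ[V | 𝒢 k₀]) ω| ∂μ) F (𝓝 0) := by
        simpa using ((hU'lim.const_mul (c 0)).add (hdw.const_mul cU)).add (hUlim.comp hν)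
      refine tendsto_of_tendsto_of_tendsto_of_le_of_le' tendsto_const_nhds hbound
        (Eventually.of_forall fun a => integral_nonneg fun ω => abs_nonneg _) ?_
      filter_upwards [hwb 0] with a ha
      have hwi : Integrable (fun ω => |w a 0 (ctr (ν a) (Z (ν a) (k₀ + 1) ω)) -
          w₀ 0 (X (k₀ + 1) ω)|) μ := by
        refine Integrable.of_bound ((hfin _ (k₀ + 1) fun i => w a 0 (ctr (ν a) i)).sub
          ((hw₀ 0).measurable.comp (hX _))).abs.aestronglyMeasurable (c 0 + c 0)
          (ae_of_all _ fun ω => ?_)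
        rw [Real.norm_of_nonneg (abs_nonneg _)]
        exact (abs_sub _ _).trans (add_le_add (ha _) (hw₀b _ _))
      have hst := hstep (ν a) k₀ fun i => w a 0 (ctr (ν a) i) *
          backward (P (ν a)) (ctr (ν a)) (u a) m (fun k => w a (k + 1)) i
      have h1 : ∫ ω, |backward (P (ν a)) (ctr (ν a)) (u a) (m + 1) (w a) (Z (ν a) k₀ ω) -
          (μ[V | 𝒢 k₀]) ω| ∂μ ≤ ∫ ω, (|(μ[Y a - V | 𝒜 (ν a) k₀]) ω| +
            |(μ[V | 𝒜 (ν a) k₀]) ω - (μ[V | 𝒢 k₀]) ω|) ∂μ := by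
        refine integral_mono_ae ?_ (integrable_condExp.abs.add
          (integrable_condExp.sub integrable_condExp).abs) ?_
        · refine Integrable.abs (Integrable.sub ?_ integrable_condExp)
          exact integrable_condExp.congr hst
        · filter_upwards [hst, condExp_sub (hYi a) hVi (𝒜 (ν a) k₀)] with ω hω hsub
          have e : backward (P (ν a)) (ctr (ν a)) (u a) (m + 1) (w a) (Z (ν a) k₀ ω)
              = (μ[Y a | 𝒜 (ν a) k₀]) ω := hω.symm
          rw [e, hsub, Pi.sub_apply]
          exact abs_sub_le _ _ _
      have h2 : ∫ ω, |(μ[Y a - V | 𝒜 (ν a) k₀]) ω| ∂μ ≤ ∫ ω, |(Y a - V) ω| ∂μ :=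
        integral_abs_condExp_le _
      have h3 : ∫ ω, |(Y a - V) ω| ∂μ ≤ ∫ ω, (c 0 * |H a ω - U' ω| +
          cU * |w a 0 (ctr (ν a) (Z (ν a) (k₀ + 1) ω)) - w₀ 0 (X (k₀ + 1) ω)|) ∂μ := by
        refine integral_mono_ae ((hYi a).sub hVi).abs
          ((((hHi a).sub hU'i).abs.const_mul _).add (hwi.const_mul _)) ?_
        filter_upwards [hcU] with ω hω
        have e : (Y a - V) ω = w a 0 (ctr (ν a) (Z (ν a) (k₀ + 1) ω)) * (H a ω - U' ω) +
            (w a 0 (ctr (ν a) (Z (ν a) (k₀ + 1) ω)) - w₀ 0 (X (k₀ + 1) ω)) * U' ω := by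
          simp only [Pi.sub_apply, Y, V]; ring
        rw [e]
        refine (abs_add_le _ _).trans (add_le_add ?_ ?_)
        · rw [abs_mul]
          exact mul_le_mul_of_nonneg_right (ha _) (abs_nonneg _)
        · rw [abs_mul, mul_comm]
          exact mul_le_mul_of_nonneg_right hω (abs_nonneg _)
      have hi1 : Integrable (fun ω => |(μ[V | 𝒜 (ν a) k₀]) ω - (μ[V | 𝒢 k₀]) ω|) μ :=
        (integrable_condExp.sub integrable_condExp).abs
      have hi2 : Integrable (fun ω => |H a ω - U' ω|) μ := ((hHi a).sub hU'i).abs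
      rw [integral_add integrable_condExp.abs hi1] at h1
      rw [integral_add (hi2.const_mul _) (hwi.const_mul _),
        integral_const_mul, integral_const_mul] at h3
      exact h1.trans (add_le_add (h2.trans h3) le_rfl)
    · intro Φ hΦ ⟨cΦ, hcΦ⟩
      have hcΦ0 : 0 ≤ cΦ := by
        obtain ⟨ω, hω⟩ := hcΦ.exists
        exact (abs_nonneg _).trans hω
      have hΦV : Integrable (Φ * V) μ :=
        hVi.bdd_mul (hΦ.mono (h𝒢 _)) (c := cΦ) hcΦ
      have e1 : ∫ ω, Φ ω * (μ[V | 𝒢 k₀]) ω ∂μ = ∫ ω, Φ ω * V ω ∂μ := by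
        rw [← integral_condExp (h𝒢 k₀) (f := fun ω => Φ ω * V ω)]
        exact integral_congr_ae
          (condExp_mul_of_aestronglyMeasurable_left hΦ hΦV hVi).symm
      rw [e1]
      have e2 := hU'int (fun ω => Φ ω * w₀ 0 (X (k₀ + 1) ω))
        ((hΦ.mono (h𝒢mono (Nat.le_succ _))).mul (hX𝒢 (k₀ + 1) _ (hw₀ 0)))
        ⟨cΦ * c 0, by
          filter_upwards [hcΦ] with ω hω
          rw [abs_mul]
          exact mul_le_mul hω (hw₀b _ _) (abs_nonneg _) hcΦ0⟩
      simp only [V, ← mul_assoc] at e2 ⊢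
      rw [e2]
      refine integral_congr_ae (ae_of_all _ fun ω => ?_)
      simp only [Finset.prod_range_succ', add_zero]
      have e3 : k₀ + 1 + m = k₀ + (m + 1) := by ring
      have e4 : ∀ k, k₀ + 1 + k + 1 = k₀ + (k + 1) + 1 := fun k => by ring
      simp only [e3, e4]
      ring

/-! ### Consistency of the marginal quantization -/

/-- The transposed transition matrix acts as the conditional expectation given the current value. The
columns that `eq_cond` leaves open belong to values that are not attained. -/
theorem IsTransitionMatrix.condExp_comap {Ω ι : Type*} [MeasurableSpace Ω] [Fintype ι]
    [MeasurableSpace ι] [DiscreteMeasurableSpace ι] {μ : Measure Ω} [IsProbabilityMeasure μ]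
    {Z : ℕ → Ω → ι} {P : Matrix ι ι ℝ} (h : IsTransitionMatrix μ Z P) (hZ : ∀ k, Measurable (Z k))
    (k : ℕ) (v : ι → ℝ) :
    μ[fun ω => v (Z (k + 1) ω) | MeasurableSpace.comap (Z k) inferInstance]
      =ᵐ[μ] fun ω => ∑ i, P i (Z k ω) * v i := by
  classical
  have hfin : ∀ (k : ℕ) (v : ι → ℝ), Integrable (fun ω => v (Z k ω)) μ := fun k v => by
    obtain ⟨C, hC⟩ := (Set.finite_range fun i => |v i|).bddAbove
    exact Integrable.of_bound ((Measurable.of_discrete (f := v)).comp (hZ k)).aestronglyMeasurable C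
      (ae_of_all _ fun ω => hC ⟨_, rfl⟩)
  symm
  refine ae_eq_condExp_of_forall_setIntegral_eq (hZ k).comap_le (hfin _ v)
    (fun _ _ _ => (hfin k fun j => ∑ i, P i j * v i).integrableOn) ?_
    ((Measurable.of_discrete (f := fun j => ∑ i, P i j * v i)).comp
      (comap_measurable (Z k))).aestronglyMeasurable
  rintro _ ⟨B, -, rfl⟩ -
  have hB : Z k ⁻¹' B = ⋃ j ∈ (Finset.univ.filter (· ∈ B)), {ω | Z k ω = j} := by
    ext ω; simp
  have hmeas : ∀ k j, MeasurableSet {ω | Z k ω = j} := fun k j =>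
    hZ k (MeasurableSet.singleton j)
  have hdisj : ((Finset.univ.filter (· ∈ B) : Finset ι) : Set ι).Pairwise
      (Function.onFun Disjoint fun j => {ω | Z k ω = j}) := by
    intro i _ j _ hij
    refine Set.disjoint_left.2 fun ω h1 h2 => hij ?_
    exact (h1 : Z k ω = i).symm.trans h2
  rw [hB, integral_biUnion_finset _ (fun j _ => hmeas k j) hdisj
      fun j _ => (hfin k fun j => ∑ i, P i j * v i).integrableOn,
    integral_biUnion_finset _ (fun j _ => hmeas k j) hdisj fun j _ => (hfin _ v).integrableOn]
  refine Finset.sum_congr rfl fun j _ => ?_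
  rw [setIntegral_congr_fun (g := fun _ => ∑ i, P i j * v i) (hmeas k j)
    (fun ω (hω : Z k ω = j) => by simp [hω])]
  have hsum : (fun ω => v (Z (k + 1) ω))
      = fun ω => ∑ i, Set.indicator {ω | Z (k + 1) ω = i} (fun _ => v i) ω := by
    funext ω
    simp [Set.indicator_apply]
  rw [setIntegral_const, hsum, integral_finsetSum _ fun i _ =>
    ((integrable_const _).indicator (hmeas (k + 1) i)), smul_eq_mul,
    Finset.mul_sum]
  refine Finset.sum_congr rfl fun i _ => ?_
  rw [integral_indicator (hmeas _ _), Measure.restrict_restrict (hmeas _ _), setIntegral_const,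
    smul_eq_mul, ← mul_assoc]
  congr 1
  rcases eq_or_ne (μ {ω | Z k ω = j}) 0 with h0 | h0
  · rw [measureReal_def, h0, measureReal_def, measure_mono_null Set.inter_subset_right h0]
    simp
  · rw [h.eq_cond k i j h0, measureReal_def, measureReal_def, measureReal_def,
      cond_apply (hmeas k j), ENNReal.toReal_mul, ← mul_assoc, ← ENNReal.toReal_mul,
      ENNReal.mul_inv_cancel h0 (measure_ne_top _ _), ENNReal.toReal_one, one_mul,
      Set.inter_comm]

/-- The `σ`-algebras of increasingly accurate discretizations of `X` need not be nested, but
conditioning a function of `X` on them recovers it in mean all the same: this is clear for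
continuous functions, which are dense in `L¹`. -/
theorem tendsto_integral_abs_condExp_sub {Ω E : Type*} [m0 : MeasurableSpace Ω] {μ : Measure Ω}
    [IsProbabilityMeasure μ] [TopologicalSpace E] [TopologicalSpace.PseudoMetrizableSpace E]
    [MeasurableSpace E] [BorelSpace E] {ι : ℕ → Type*} [∀ n, MeasurableSpace (ι n)]
    [∀ n, DiscreteMeasurableSpace (ι n)] {X : Ω → E} (hX : Measurable X) {Z : ∀ n, Ω → ι n}
    (hZ : ∀ n, Measurable (Z n)) {ctr : ∀ n, ι n → E}
    (hconv : ∀ᵐ ω ∂μ, Tendsto (fun n => ctr n (Z n ω)) atTop (𝓝 (X ω))) {V : Ω → ℝ}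
    (hVi : Integrable V μ)
    (hV : AEStronglyMeasurable[MeasurableSpace.comap X inferInstance] V μ) :
    Tendsto (fun n => ∫ ω, |(μ[V | MeasurableSpace.comap (Z n) inferInstance]) ω - V ω| ∂μ)
      atTop (𝓝 0) := by
  let _ := TopologicalSpace.pseudoMetrizableSpacePseudoMetric E
  obtain ⟨v, hvm, hv⟩ := hV.stronglyMeasurable_mk.exists_eq_measurable_comp
  have hVv : V =ᵐ[μ] fun ω => v (X ω) := by
    filter_upwards [hV.ae_eq_mk] with ω hω
    rw [hω, hv]; rfl
  have : IsProbabilityMeasure (μ.map X) := Measure.isProbabilityMeasure_map hX.aemeasurable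
  have hvi : Integrable v (μ.map X) := by
    rw [integrable_map_measure hvm.aestronglyMeasurable hX.aemeasurable]
    exact hVi.congr hVv
  rw [Metric.tendsto_atTop]
  intro ε hε
  obtain ⟨g, hg, -⟩ := hvi.exists_boundedContinuous_integral_sub_le (ε := ε / 4) (by positivity)
  obtain ⟨C, hC⟩ : ∃ C, ∀ x, |g x| ≤ C := ⟨‖g‖, g.norm_coe_le_norm⟩
  have hgm : Measurable fun ω => g (X ω) := g.continuous.measurable.comp hX
  have hgi : Integrable (fun ω => g (X ω)) μ :=
    Integrable.of_bound hgm.aestronglyMeasurable C (ae_of_all _ fun ω => hC _)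
  have hgVi : Integrable (fun ω => |V ω - g (X ω)|) μ := (hVi.sub hgi).abs
  have hgV : ∫ ω, |V ω - g (X ω)| ∂μ ≤ ε / 4 := by
    have hm : Measurable fun x => ‖v x - g x‖ := (hvm.measurable.sub g.continuous.measurable).norm
    rw [integral_map hX.aemeasurable hm.aestronglyMeasurable] at hg
    refine le_of_eq_of_le (integral_congr_ae ?_) hg
    filter_upwards [hVv] with ω hω
    rw [hω, Real.norm_eq_abs]
  have hzm : ∀ n, Measurable[MeasurableSpace.comap (Z n) inferInstance]
      fun ω => g (ctr n (Z n ω)) := fun n =>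
    (Measurable.of_discrete (f := fun i => g (ctr n i))).comp (comap_measurable (Z n))
  have hzi : ∀ n, Integrable (fun ω => g (ctr n (Z n ω))) μ := fun n =>
    Integrable.of_bound ((hzm n).mono (hZ n).comap_le le_rfl).aestronglyMeasurable C
      (ae_of_all _ fun ω => hC _)
  have hlim : Tendsto (fun n => ∫ ω, |g (X ω) - g (ctr n (Z n ω))| ∂μ) atTop (𝓝 0) := by
    have := tendsto_integral_filter_of_dominated_convergence (μ := μ) (l := atTop)
      (F := fun n ω => |g (X ω) - g (ctr n (Z n ω))|) (f := fun _ => (0 : ℝ))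
      (fun _ => C + C) (Eventually.of_forall fun n =>
        (hgi.sub (hzi n)).abs.aestronglyMeasurable) (Eventually.of_forall fun n =>
        ae_of_all _ fun ω => ?_) (integrable_const _) ?_
    · simpa using this
    · rw [Real.norm_of_nonneg (abs_nonneg _)]
      exact (abs_sub _ _).trans (add_le_add (hC _) (hC _))
    · filter_upwards [hconv] with ω hω
      simpa using (((g.continuous.tendsto _).comp hω).const_sub (g (X ω))).abs
  obtain ⟨n₀, hn₀⟩ := Metric.tendsto_atTop.1 hlim (ε / 4) (by positivity)
  refine ⟨n₀, fun n hn => ?_⟩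
  have hδ := hn₀ n hn
  simp only [Real.dist_eq, sub_zero] at hδ ⊢
  rw [abs_of_nonneg (integral_nonneg fun ω => abs_nonneg _)] at hδ ⊢
  have hDi : Integrable (fun ω => |g (X ω) - g (ctr n (Z n ω))|) μ := (hgi.sub (hzi n)).abs
  have hci : Integrable (V - fun ω => g (ctr n (Z n ω))) μ := hVi.sub (hzi n)
  -- The error made by replacing `V` by the continuous function `g` of the discretization.
  have hW : ∫ ω, |(V - fun ω => g (ctr n (Z n ω))) ω| ∂μ < ε / 2 := by
    have : ∫ ω, |(V - fun ω => g (ctr n (Z n ω))) ω| ∂μ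
        ≤ ∫ ω, (|V ω - g (X ω)| + |g (X ω) - g (ctr n (Z n ω))|) ∂μ :=
      integral_mono hci.abs (hgVi.add hDi) fun ω => abs_sub_le _ _ _
    rw [integral_add hgVi hDi] at this
    linarith
  have hfinal : ∫ ω, |(μ[V | MeasurableSpace.comap (Z n) inferInstance]) ω - V ω| ∂μ
      ≤ ∫ ω, (|(μ[V - (fun ω => g (ctr n (Z n ω))) |
          MeasurableSpace.comap (Z n) inferInstance]) ω|
        + |(V - fun ω => g (ctr n (Z n ω))) ω|) ∂μ := by
    refine integral_mono_ae (integrable_condExp.sub hVi).abs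
      (integrable_condExp.abs.add hci.abs) ?_
    filter_upwards [condExp_sub hVi (hzi n) (MeasurableSpace.comap (Z n) inferInstance)]
      with ω hω
    rw [hω, condExp_of_stronglyMeasurable (hZ n).comap_le (hzm n).stronglyMeasurable (hzi n)]
    simp only [Pi.sub_apply]
    have := abs_sub ((μ[V | MeasurableSpace.comap (Z n) inferInstance]) ω - g (ctr n (Z n ω)))
      (V ω - g (ctr n (Z n ω)))
    rwa [sub_sub_sub_cancel_right] at this
  rw [integral_add integrable_condExp.abs hci.abs] at hfinal
  have hcontr : ∫ ω, |(μ[V - (fun ω => g (ctr n (Z n ω))) |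
      MeasurableSpace.comap (Z n) inferInstance]) ω| ∂μ
        ≤ ∫ ω, |(V - fun ω => g (ctr n (Z n ω))) ω| ∂μ := integral_abs_condExp_le _
  linarith

namespace Network

variable {N K : ℕ} {G : Network N K} {Ω : Type*} [m0 : MeasurableSpace Ω] {μ : Measure Ω}

/-- For a Markov chain, conditioning a function of the next state on the past gives a function of
the current state. -/
theorem IsMarkovChain.aestronglyMeasurable_condExp [IsProbabilityMeasure μ]
    {X : ℕ → Ω → State K} {κ : Kernel (State K) (State K)} [IsMarkovKernel κ]
    (h : IsMarkovChain μ X κ) (hX : ∀ k, Measurable (X k)) (k : ℕ) {U : Ω → ℝ}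
    (hU : AEStronglyMeasurable[MeasurableSpace.comap (X (k + 1)) inferInstance] U μ)
    (hUi : Integrable U μ) :
    AEStronglyMeasurable[MeasurableSpace.comap (X k) inferInstance]
      (μ[U | ⨆ i ≤ k, MeasurableSpace.comap (X i) inferInstance]) μ := by
  obtain ⟨v, hvm, hv⟩ := hU.stronglyMeasurable_mk.exists_eq_measurable_comp
  have hUv : U =ᵐ[μ] fun ω => v (X (k + 1) ω) := by
    filter_upwards [hU.ae_eq_mk] with ω hω
    rw [hω, hv]; rfl
  let past : Ω → Fin (k + 1) → State K := fun ω i => X i ω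
  let s : Ω → Unit → State K := fun ω _ => X (k + 1) ω
  have hpast : Measurable past := measurable_pi_lambda _ fun i => hX i
  have hs : Measurable s := measurable_pi_lambda _ fun _ => hX _
  have hle : ⨆ i ≤ k, MeasurableSpace.comap (X i) inferInstance
      = MeasurableSpace.comap past inferInstance := iSup_comap_eq_comap X k
  have hlaw := condDistrib_eq_pi_of_condExp (μ := μ) hpast hs
    (fun _ x => κ (x (Fin.last k))) (fun B hB => by
      have := h k (B ()) (hB ())
      rw [hle] at this
      have e : {ω | ∀ i, s ω i ∈ B i} = X (k + 1) ⁻¹' B () :=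
        Set.ext fun ω => ⟨fun hω => hω (), fun hω _ => hω⟩
      rw [e]
      simpa [past] using this)
  have hcond := condExp_ae_eq_integral_condDistrib (μ := μ) hpast hs.aemeasurable
    (f := fun x => v (x ())) (hvm.comp_measurable (measurable_pi_apply ())) (hUi.congr hUv)
  have hfinal : μ[U | ⨆ i ≤ k, MeasurableSpace.comap (X i) inferInstance]
      =ᵐ[μ] fun ω => ∫ x, v x ∂(κ (X k ω)) := by
    rw [hle]
    refine (condExp_congr_ae hUv).trans (hcond.trans ?_)
    filter_upwards [hlaw] with ω hω
    rw [hω]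
    have := (measurePreserving_eval (fun _ : Unit => κ (past ω (Fin.last k))) ()).map_eq
    simp only [past, Fin.val_last] at this ⊢
    conv_rhs => rw [← this]
    rw [integral_map (measurable_pi_apply ()).aemeasurable hvm.aestronglyMeasurable]
  refine AEStronglyMeasurable.congr ?_ hfinal.symm
  exact ((hvm.integral_kernel (κ := κ)).comp_measurable
    (comap_measurable (X k))).aestronglyMeasurable

theorem measurable_cellOf (n : ℕ) : Measurable (G.cellOf n) := by
  refine measurable_pi_lambda _ fun i => ?_
  have h1 : Measurable fun x : State K => ⌊(x i - G.a) / (G.b - G.a) * (n + 1)⌋₊ :=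
    Nat.measurable_floor.comp (by fun_prop)
  exact (Measurable.of_discrete (f := fun j : ℕ =>
    (⟨min j n, Nat.lt_succ_of_le (min_le_right _ _)⟩ : Fin (n + 1)))).comp h1

/-- The sup norm distance to the center of the cell is at most the mesh size; twice the optimal bound
is enough here. -/
theorem dist_quantizer_le (hG : G.Admissible) (n : ℕ) {x : State K} (hx : x ∈ G.box) :
    dist (G.quantizer n x) x ≤ (G.b - G.a) / (n + 1) := by
  have hd : 0 < G.b - G.a := sub_pos.2 hG.lt
  have hn : (0 : ℝ) < n + 1 := by positivity
  refine (dist_pi_le_iff (by positivity)).2 fun i => ?_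
  have h1 : 0 ≤ x i - G.a := sub_nonneg.2 (hx.1 i)
  have h2 : x i - G.a ≤ G.b - G.a := sub_le_sub_right (hx.2 i) _
  set r := (x i - G.a) / (G.b - G.a) * (n + 1) with hr
  have hr0 : 0 ≤ r := by positivity
  have hr1 : r ≤ n + 1 := by
    have : (x i - G.a) / (G.b - G.a) ≤ 1 := (div_le_one hd).2 h2
    nlinarith
  have hxr : x i = G.a + r * ((G.b - G.a) / (n + 1)) := by
    rw [hr]; field_simp; ring
  have hfl : |((min ⌊r⌋₊ n : ℕ) : ℝ) + 1 / 2 - r| ≤ 1 := by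
    have hf1 := Nat.floor_le hr0
    have hf2 := Nat.lt_floor_add_one r
    rcases le_total ⌊r⌋₊ n with h | h
    · rw [min_eq_left h, abs_le]
      constructor <;> linarith
    · rw [min_eq_right h, abs_le]
      have : (n : ℝ) ≤ ⌊r⌋₊ := by exact_mod_cast h
      constructor <;> linarith
  have he : G.quantizer n x i - x i
      = (((min ⌊r⌋₊ n : ℕ) : ℝ) + 1 / 2 - r) * ((G.b - G.a) / (n + 1)) := by
    have : G.quantizer n x i
        = G.a + (((min ⌊r⌋₊ n : ℕ) : ℝ) + 1 / 2) * ((G.b - G.a) / (n + 1)) := rfl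
    rw [this, hxr]; ring
  rw [Real.dist_eq, he, abs_mul, abs_of_pos (div_pos hd hn)]
  exact mul_le_of_le_one_left (by positivity) hfl

theorem tendsto_mesh (G : Network N K) :
    Tendsto (fun n : ℕ => (G.b - G.a) / ((n : ℝ) + 1)) atTop (𝓝 0) := by
  simpa [div_eq_mul_inv] using
    (tendsto_one_div_add_atTop_nhds_zero_nat (𝕜 := ℝ)).const_mul (G.b - G.a)

theorem center_mem (hG : G.Admissible) (n : ℕ) (l : Cells K n) : G.center n l ∈ G.box := by
  have hd : 0 < G.b - G.a := sub_pos.2 hG.lt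
  have hn : (0 : ℝ) < n + 1 := by positivity
  refine ⟨fun i => ?_, fun i => ?_⟩
  · simp only [center]
    have : 0 ≤ ((l i : ℝ) + 1 / 2) * ((G.b - G.a) / (n + 1)) := by positivity
    linarith
  · simp only [center]
    have hl : (l i : ℝ) + 1 / 2 ≤ n + 1 := by
      have : (l i : ℝ) ≤ n := by exact_mod_cast Nat.lt_succ_iff.1 (l i).2
      linarith
    have : ((l i : ℝ) + 1 / 2) * ((G.b - G.a) / (n + 1)) ≤ (n + 1) * ((G.b - G.a) / (n + 1)) :=
      mul_le_mul_of_nonneg_right hl (by positivity)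
    rw [mul_div_cancel₀ _ hn.ne'] at this
    linarith

theorem IsMarkovChain.isConsistentApproximation [IsProbabilityMeasure μ] (hG : G.Admissible)
    {X : ℕ → Ω → State K} (hX : ∀ k, Measurable (X k)) (hXbox : ∀ k, ∀ᵐ ω ∂μ, X k ω ∈ G.box)
    {κ : Kernel (State K) (State K)} [IsMarkovKernel κ] (h : IsMarkovChain μ X κ)
    {P : ∀ n, Matrix (Cells K n) (Cells K n) ℝ}
    (hP : ∀ n, IsTransitionMatrix μ (G.marginalQuantization n X) (P n)) :
    IsConsistentApproximation μ X (fun n => G.marginalQuantization n X) G.center P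
      (fun k => MeasurableSpace.comap (X k) inferInstance)
      (fun k => ⨆ i ≤ k, MeasurableSpace.comap (X i) inferInstance)
      (fun n k => MeasurableSpace.comap (G.marginalQuantization n X k) inferInstance) := by
  have hZ : ∀ n k, Measurable (G.marginalQuantization n X k) := fun n k =>
    (measurable_cellOf n).comp (hX k)
  have hpast : ∀ k, ⨆ i ≤ k, MeasurableSpace.comap (X i) inferInstance ≤ m0 := fun k =>
    iSup₂_le fun i _ => (hX i).comap_le
  have hprespast : ∀ k, MeasurableSpace.comap (X k) inferInstance
      ≤ ⨆ i ≤ k, MeasurableSpace.comap (X i) inferInstance := fun k =>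
    le_iSup₂_of_le k le_rfl le_rfl
  have hpres : ∀ (k : ℕ) (g : State K → ℝ), Continuous g →
      AEStronglyMeasurable[MeasurableSpace.comap (X k) inferInstance] (fun ω => g (X k ω)) μ :=
    fun k g hg => (hg.measurable.comp (comap_measurable (X k))).aestronglyMeasurable
  have hconv : ∀ k, ∀ᵐ ω ∂μ,
      Tendsto (fun n => G.center n (G.marginalQuantization n X k ω)) atTop (𝓝 (X k ω)) := by
    intro k
    filter_upwards [hXbox k] with ω hω
    rw [tendsto_iff_dist_tendsto_zero]
    exact squeeze_zero (fun _ => dist_nonneg) (fun n => dist_quantizer_le hG n hω) G.tendsto_mesh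
  refine ⟨hX, hZ, hconv, fun k => (hX k).comap_le, hpast, fun k l hkl => ?_, hpres,
    fun k g hg => (hpres k g hg).mono (hprespast k), fun n k v => (hP n).condExp_comap (hZ n) k v,
    fun k U hU ⟨c, hc⟩ => ?_⟩
  · exact biSup_mono fun i hi => hi.trans hkl
  · have hUi : Integrable U μ := Integrable.of_bound (hU.mono (hX _).comap_le) c hc
    have hm := h.aestronglyMeasurable_condExp hX k hU hUi
    refine ⟨hm, ?_⟩
    refine (tendsto_integral_abs_condExp_sub (hX k) (fun n => hZ n k) (hconv k)
      integrable_condExp hm).congr fun n => integral_congr_ae ?_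
    have hle : MeasurableSpace.comap (G.marginalQuantization n X k) inferInstance
        ≤ ⨆ i ≤ k, MeasurableSpace.comap (X i) inferInstance := by
      refine le_trans ?_ (hprespast k)
      exact ((measurable_cellOf n).comp (comap_measurable (X k))).comap_le
    filter_upwards [condExp_condExp_of_le (f := U) (μ := μ) hle (hpast k)] with ω hω
    rw [hω]

end Network

/-! ### Consistency of the Markovian quantization -/

/-- Conditioning a function of a `m`-measurable discrete variable and of an `m`-independent one
averages the latter out. -/
theorem condExp_comp_of_indep {Ω ι E : Type*} {m : MeasurableSpace Ω} [m0 : MeasurableSpace Ω]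
    {μ : Measure Ω} [IsProbabilityMeasure μ] [Fintype ι] [MeasurableSpace ι]
    [DiscreteMeasurableSpace ι] [mE : MeasurableSpace E] (hm : m ≤ m0) {Z : Ω → ι}
    (hZ : Measurable[m] Z) {W : Ω → E} (hW : Measurable W) (hind : Indep (mE.comap W) m μ)
    {g : ι → E → ℝ} (hg : ∀ i, Measurable (g i)) (hgi : ∀ i, Integrable (fun ω => g i (W ω)) μ) :
    μ[fun ω => g (Z ω) (W ω) | m] =ᵐ[μ] fun ω => ∫ ω', g (Z ω) (W ω') ∂μ := by
  classical
  have hsum : (fun ω => g (Z ω) (W ω))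
      = ∑ i, (Z ⁻¹' {i}).indicator (fun ω => g i (W ω)) := by
    funext ω
    simp [Finset.sum_apply, Set.indicator_apply]
  have hms : ∀ i, MeasurableSet[m] (Z ⁻¹' {i}) := fun i => hZ (MeasurableSet.singleton i)
  have h1 : ∀ i, μ[(Z ⁻¹' {i}).indicator (fun ω => g i (W ω)) | m]
      =ᵐ[μ] (Z ⁻¹' {i}).indicator fun _ => ∫ ω', g i (W ω') ∂μ := by
    intro i
    refine (condExp_indicator (hgi i) (hms i)).trans ?_
    have h2 := condExp_indep_eq (μ := μ) hW.comap_le hm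
      (((hg i).comp (comap_measurable W)).stronglyMeasurable) hind
    filter_upwards [h2] with ω hω
    simp only [Set.indicator_apply]
    split_ifs
    · exact hω
    · rfl
  rw [hsum]
  refine (condExp_finsetSum (fun i _ => (hgi i).indicator (hm _ (hms i))) m).trans ?_
  filter_upwards [ae_all_iff.2 h1] with ω hω
  rw [Finset.sum_apply, Finset.sum_congr rfl fun i _ => hω i]
  simp [Set.indicator_apply]

/-- The information carried by the initial state and the first `k` noise variables. -/
abbrev drivingSpace {Ω E F : Type*} [MeasurableSpace E] [MeasurableSpace F] (X₀ : Ω → E)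
    (W : ℕ → Ω → F) (k : ℕ) : MeasurableSpace Ω :=
  MeasurableSpace.comap (fun ω => (X₀ ω, fun i : Finset.range k => W i ω)) inferInstance

theorem measurable_drivingSpace_init {Ω E F : Type*} [MeasurableSpace E] [MeasurableSpace F]
    (X₀ : Ω → E) (W : ℕ → Ω → F) (k : ℕ) : Measurable[drivingSpace X₀ W k] X₀ :=
  measurable_fst.comp (comap_measurable fun ω => (X₀ ω, fun i : Finset.range k => W i ω))

theorem measurable_drivingSpace_noise {Ω E F : Type*} [MeasurableSpace E] [MeasurableSpace F]
    (X₀ : Ω → E) (W : ℕ → Ω → F) {k i : ℕ} (hi : i < k) :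
    Measurable[drivingSpace X₀ W k] (W i) :=
  ((measurable_pi_apply (⟨i, Finset.mem_range.2 hi⟩ : Finset.range k)).comp measurable_snd).comp
    (comap_measurable fun ω => (X₀ ω, fun i : Finset.range k => W i ω))

theorem drivingSpace_mono {Ω E F : Type*} [MeasurableSpace E] [MeasurableSpace F]
    (X₀ : Ω → E) (W : ℕ → Ω → F) : Monotone (drivingSpace X₀ W) := fun k l hkl => by
  have h : Measurable[drivingSpace X₀ W l] fun ω => (X₀ ω, fun i : Finset.range k => W i ω) := by
    let _ := drivingSpace X₀ W l
    refine (measurable_drivingSpace_init X₀ W l).prodMk (measurable_pi_lambda _ fun i => ?_)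
    exact measurable_drivingSpace_noise X₀ W ((Finset.mem_range.1 i.2).trans_le hkl)
  exact h.comap_le

theorem indep_drivingSpace {Ω E F : Type*} [MeasurableSpace Ω] {μ : Measure Ω}
    [IsProbabilityMeasure μ] [MeasurableSpace E] [mF : MeasurableSpace F] {X₀ : Ω → E}
    (hX₀ : Measurable X₀) {W : ℕ → Ω → F} (hW : ∀ k, Measurable (W k)) (hWi : iIndepFun W μ)
    (hind : IndepFun X₀ (fun ω k => W k ω) μ) (k : ℕ) :
    Indep (mF.comap (W k)) (drivingSpace X₀ W k) μ := by
  let B : Ω → Finset.range k → F := fun ω i => W i ω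
  have hB : Measurable B := measurable_pi_lambda _ fun i => hW i
  have hBW : IndepFun B (W k) μ := by
    have := hWi.indepFun_finset (Finset.range k) {k} (by simp) hW
    exact this.comp (φ := id) (ψ := fun x : ({k} : Finset ℕ) → F => x ⟨k, by simp⟩)
      measurable_id (measurable_pi_apply _)
  have h1 : IndepFun X₀ (fun ω => (B ω, W k ω)) μ :=
    hind.comp (φ := id) (ψ := fun x : ℕ → F => ((fun i : Finset.range k => x i), x k))
      measurable_id (by fun_prop)
  have h2 : IndepFun X₀ B μ := h1.comp (φ := id) (ψ := Prod.fst) measurable_id measurable_fst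
  have h3 : IndepFun (fun ω => (X₀ ω, B ω)) (W k) μ := by
    rw [indepFun_iff_map_prod_eq_prod_map_map (hX₀.prodMk hB).aemeasurable (hW k).aemeasurable]
    rw [indepFun_iff_map_prod_eq_prod_map_map hX₀.aemeasurable
      (hB.prodMk (hW k)).aemeasurable] at h1
    rw [indepFun_iff_map_prod_eq_prod_map_map hX₀.aemeasurable hB.aemeasurable] at h2
    rw [indepFun_iff_map_prod_eq_prod_map_map hB.aemeasurable (hW k).aemeasurable] at hBW
    have e : (fun ω => ((X₀ ω, B ω), W k ω))
        = MeasurableEquiv.prodAssoc.symm ∘ fun ω => (X₀ ω, (B ω, W k ω)) := rfl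
    have : IsProbabilityMeasure (μ.map X₀) := Measure.isProbabilityMeasure_map hX₀.aemeasurable
    have : IsProbabilityMeasure (μ.map B) := Measure.isProbabilityMeasure_map hB.aemeasurable
    have : IsProbabilityMeasure (μ.map (W k)) :=
      Measure.isProbabilityMeasure_map (hW k).aemeasurable
    rw [e, ← Measure.map_map (MeasurableEquiv.measurable _)
      (hX₀.prodMk (hB.prodMk (hW k))), h1, hBW, h2, ← Measure.prodAssoc_prod,
      Measure.map_map (MeasurableEquiv.measurable _) (MeasurableEquiv.measurable _),
      MeasurableEquiv.symm_comp_self, Measure.map_id]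
  exact ((IndepFun_iff_Indep _ _ _).1 h3).symm

namespace Network

variable {N K : ℕ} {G : Network N K} {Ω : Type*} [m0 : MeasurableSpace Ω] {μ : Measure Ω} {d : ℕ}
  {X : ℕ → Ω → State K} {Wset : Set (Fin d → ℝ)} {f : State K → (Fin d → ℝ) → State K}
  {W : ℕ → Ω → (Fin d → ℝ)}

theorem IsLipschitzDynamics.measurable_markovianQuantization
    (h : G.IsLipschitzDynamics μ X Wset f W) (n k : ℕ) :
    Measurable[drivingSpace (X 0) W k] (G.markovianQuantization n (X 0) f W k) := by
  induction k with
  | zero => exact (measurable_cellOf n).comp (measurable_drivingSpace_init (X 0) W 0)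
  | succ k ih =>
    refine (measurable_cellOf n).comp (h.measurable_f.comp (Measurable.prodMk ?_
      (measurable_drivingSpace_noise (X 0) W (Nat.lt_succ_self k))))
    exact (Measurable.of_discrete (f := G.center n)).comp
      (ih.mono (drivingSpace_mono (X 0) W (Nat.le_succ k)) le_rfl)

/-- The state is a function of the initial state and the noise up to a null set, since the dynamics
hold almost surely only. -/
theorem IsLipschitzDynamics.exists_measurable_ae_eq
    (h : G.IsLipschitzDynamics μ X Wset f W) (k : ℕ) :
    ∃ X' : Ω → State K, Measurable[drivingSpace (X 0) W k] X' ∧ X k =ᵐ[μ] X' := by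
  induction k with
  | zero => exact ⟨X 0, measurable_drivingSpace_init (X 0) W 0, ae_eq_rfl⟩
  | succ k ih =>
    obtain ⟨X', hX', he⟩ := ih
    refine ⟨fun ω => f (X' ω) (W k ω), h.measurable_f.comp
      ((hX'.mono (drivingSpace_mono (X 0) W (Nat.le_succ k)) le_rfl).prodMk
        (measurable_drivingSpace_noise (X 0) W (Nat.lt_succ_self k))), ?_⟩
    filter_upwards [h.step k, he] with ω h1 h2
    rw [h1, h2]

/-- For fixed noise, the quantized recursion inherits convergence from the Lipschitz continuity of
the dynamics; the Lipschitz constant may depend on the noise, as no rate is claimed. -/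
theorem IsLipschitzDynamics.tendsto_center (h : G.IsLipschitzDynamics μ X Wset f W)
    (hG : G.Admissible) (hXbox : ∀ k, ∀ᵐ ω ∂μ, X k ω ∈ G.box) :
    ∀ᵐ ω ∂μ, ∀ k, Tendsto (fun n => G.center n (G.markovianQuantization n (X 0) f W k ω)) atTop
      (𝓝 (X k ω)) := by
  have hf : ∀ᵐ ω ∂μ, ∀ k n (l : Cells K n), f (G.center n l) (W k ω) ∈ G.box :=
    ae_all_iff.2 fun k => ae_all_iff.2 fun n => ae_all_iff.2 fun l =>
      h.f_mem _ (center_mem hG n l) k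
  filter_upwards [hf, ae_all_iff.2 hXbox, ae_all_iff.2 h.W_mem, ae_all_iff.2 h.step]
    with ω hf hXb hW hst k
  induction k with
  | zero =>
    rw [tendsto_iff_dist_tendsto_zero]
    exact squeeze_zero (fun _ => dist_nonneg) (fun n => dist_quantizer_le hG n (hXb 0))
      G.tendsto_mesh
  | succ k ih =>
    obtain ⟨L, hL⟩ := h.lipschitz (W k ω) (hW k)
    rw [tendsto_iff_dist_tendsto_zero] at ih ⊢
    have hlim := G.tendsto_mesh.add (ih.const_mul (L : ℝ))
    rw [mul_zero, add_zero] at hlim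
    refine squeeze_zero (fun _ => dist_nonneg) (fun n => ?_) hlim
    refine (dist_triangle _ (f (G.center n (G.markovianQuantization n (X 0) f W k ω)) (W k ω))
      _).trans (add_le_add (dist_quantizer_le hG n (hf k n _)) ?_)
    rw [hst k]
    exact hL.dist_le_mul _ (center_mem hG n _) _ (hXb k)

theorem IsLipschitzDynamics.isConsistentApproximation [IsProbabilityMeasure μ]
    (h : G.IsLipschitzDynamics μ X Wset f W) (hG : G.Admissible) (hX : ∀ k, Measurable (X k))
    (hXbox : ∀ k, ∀ᵐ ω ∂μ, X k ω ∈ G.box) {P : ∀ n, Matrix (Cells K n) (Cells K n) ℝ}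
    (hP : ∀ n, IsTransitionMatrix μ (G.markovianQuantization n (X 0) f W) (P n)) :
    IsConsistentApproximation μ X (fun n => G.markovianQuantization n (X 0) f W) G.center P
      (fun _ => m0) (drivingSpace (X 0) W) (fun _ => drivingSpace (X 0) W) := by
  have hle : ∀ k, drivingSpace (X 0) W k ≤ m0 := fun k =>
    ((hX 0).prodMk (measurable_pi_lambda (fun ω (i : Finset.range k) => W i ω)
      fun i => h.measurable_W i)).comap_le
  have hZ : ∀ n k, Measurable (G.markovianQuantization n (X 0) f W k) := fun n k =>
    (h.measurable_markovianQuantization n k).mono (hle k) le_rfl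
  refine ⟨hX, hZ, fun k => (h.tendsto_center hG hXbox).mono fun ω hω => hω k, fun _ => le_rfl,
    hle, drivingSpace_mono _ _, fun k g hg => (hg.measurable.comp (hX k)).aestronglyMeasurable,
    fun k g hg => ?_, fun n k v => ?_, fun k U hU _ => ⟨?_, by simp⟩⟩
  · obtain ⟨X', hX', he⟩ := h.exists_measurable_ae_eq k
    exact ⟨fun ω => g (X' ω), (hg.measurable.comp hX').stronglyMeasurable,
      he.mono fun ω hω => by simp only [hω]⟩
  · obtain ⟨C, hC⟩ := (Set.finite_range fun i => |v i|).bddAbove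
    have hgm : ∀ j : Cells K n, Measurable fun w => v (G.cellOf n (f (G.center n j) w)) :=
      fun j => (Measurable.of_discrete (f := v)).comp ((measurable_cellOf n).comp
        (h.measurable_f.comp (measurable_const.prodMk measurable_id)))
    have h1 := condExp_comp_of_indep (μ := μ) (hle k) (h.measurable_markovianQuantization n k)
      (h.measurable_W k) (indep_drivingSpace (hX 0) h.measurable_W h.W_indep h.init_indep k)
      (g := fun j w => v (G.cellOf n (f (G.center n j) w))) hgm
      (fun j => Integrable.of_bound ((hgm j).comp (h.measurable_W k)).aestronglyMeasurable C
        (ae_of_all _ fun ω => hC ⟨_, rfl⟩))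
    let φ : Cells K n → ℝ := fun j => ∫ ω, v (G.cellOf n (f (G.center n j) (W k ω))) ∂μ
    have h1' : μ[fun ω => v (G.markovianQuantization n (X 0) f W (k + 1) ω) |
        drivingSpace (X 0) W k] =ᵐ[μ] fun ω => φ (G.markovianQuantization n (X 0) f W k ω) := h1
    -- Conditioning further on the quantized state identifies `φ` with the transition matrix.
    have hsub : MeasurableSpace.comap (G.markovianQuantization n (X 0) f W k) inferInstance
        ≤ drivingSpace (X 0) W k := (h.measurable_markovianQuantization n k).comap_le
    have hφm : Measurable[MeasurableSpace.comap (G.markovianQuantization n (X 0) f W k)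
        inferInstance] fun ω => φ (G.markovianQuantization n (X 0) f W k ω) :=
      (Measurable.of_discrete (f := φ)).comp (comap_measurable _)
    have h2 := ((condExp_congr_ae h1').symm.trans
      (condExp_condExp_of_le (μ := μ) hsub (hle k))).trans ((hP n).condExp_comap (hZ n) k v)
    rw [condExp_of_stronglyMeasurable (hZ n k).comap_le hφm.stronglyMeasurable
      (integrable_condExp.congr h1')] at h2
    exact h1'.trans h2
  · exact (stronglyMeasurable_condExp.mono (hle k)).aestronglyMeasurable

end Network

/-! ### The grid based predictor as a ratio of forward sums -/

theorem sum_meanBasisVector_mul {Ω ι : Type*} [MeasurableSpace Ω] {μ : Measure Ω}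
    [IsProbabilityMeasure μ] [Fintype ι] [DecidableEq ι] [MeasurableSpace ι]
    [DiscreteMeasurableSpace ι] {Z : Ω → ι} (hZ : Measurable Z) (v : ι → ℝ) :
    ∑ l, meanBasisVector μ Z l * v l = ∫ ω, v (Z ω) ∂μ := by
  have hi : ∀ l, Integrable (fun ω => (Pi.single (Z ω) (1 : ℝ) : ι → ℝ) l) μ := fun l =>
    Integrable.of_bound ((Measurable.of_discrete
      (f := fun i : ι => (Pi.single i (1 : ℝ) : ι → ℝ) l)).comp hZ).aestronglyMeasurable 1
      (ae_of_all _ fun ω => by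
        by_cases h : l = Z ω <;> simp [h])
  simp only [meanBasisVector, ← integral_mul_const]
  rw [← integral_finsetSum _ fun l _ => (hi l).mul_const _]
  refine integral_congr_ae (ae_of_all _ fun ω => ?_)
  simp [Pi.single_apply]

theorem sum_meanBasisVector_pos {Ω ι : Type*} [MeasurableSpace Ω] {μ : Measure Ω}
    [IsProbabilityMeasure μ] [Fintype ι] [DecidableEq ι] [MeasurableSpace ι]
    [DiscreteMeasurableSpace ι] {Z : Ω → ι} (hZ : Measurable Z) :
    0 < ∑ l, meanBasisVector μ Z l := by
  have := sum_meanBasisVector_mul (μ := μ) hZ fun _ => 1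
  simp only [mul_one, integral_const, probReal_univ, smul_eq_mul] at this
  rw [this]
  exact one_pos

theorem meanBasisVector_nonneg {Ω ι : Type*} [MeasurableSpace Ω] (μ : Measure Ω) [DecidableEq ι]
    (Z : Ω → ι) (l : ι) : 0 ≤ meanBasisVector μ Z l :=
  integral_nonneg fun ω => by
    by_cases h : l = Z ω <;> simp [h]

namespace Network

variable {N K : ℕ} {G : Network N K}

theorem unnormalized_nonneg_and_sum_pos (hG : G.Admissible) {n : ℕ}
    {P : Matrix (Cells K n) (Cells K n) ℝ} (hP : ∀ i j, 0 ≤ P i j) (hP1 : ∀ j, ∑ i, P i j = 1)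
    {E0 : Cells K n → ℝ} (hE : ∀ l, 0 ≤ E0 l) (hE1 : 0 < ∑ l, E0 l) (y : ℕ → Fin N → ℝ) (t : ℕ) :
    (∀ l, 0 ≤ G.unnormalized n P E0 y t l) ∧ 0 < ∑ l, G.unnormalized n P E0 y t l := by
  induction t with
  | zero => exact ⟨hE, hE1⟩
  | succ t ih =>
    have hpos : ∀ l, 0 < G.likelihood t (y t) (G.center n l) := fun l =>
      likelihood_pos hG t _ (center_mem hG n l)
    have hP0 : ∀ l, 0 ≤ (P *ᵥ G.unnormalized n P E0 y t) l := fun l =>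
      Finset.sum_nonneg fun j _ => mul_nonneg (hP l j) (ih.1 j)
    have hsum : ∑ l, (P *ᵥ G.unnormalized n P E0 y t) l = ∑ l, G.unnormalized n P E0 y t l := by
      simp only [Matrix.mulVec, dotProduct]
      rw [Finset.sum_comm]
      simp [← Finset.sum_mul, hP1]
    have hval : ∀ l, G.unnormalized n P E0 y (t + 1) l
        = G.likelihood t (y t) (G.center n l) * (P *ᵥ G.unnormalized n P E0 y t) l := fun l => by
      simp [unnormalized, likelihoodMatrix, Matrix.mulVec_diagonal]
    simp only [hval]
    refine ⟨fun l => mul_nonneg (hpos l).le (hP0 l), ?_⟩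
    have hlt : ∑ l : Cells K n, (0 : ℝ) < ∑ l, (P *ᵥ G.unnormalized n P E0 y t) l := by
      rw [hsum]; simpa using ih.2
    obtain ⟨l, hl, hl0⟩ := Finset.exists_lt_of_sum_lt hlt
    exact Finset.sum_pos' (fun l _ => mul_nonneg (hpos l).le (hP0 l))
      ⟨l, hl, mul_pos (hpos l) hl0⟩

variable (G) in
/-- The weight of the state at time `k` given the realization `y` of the observations up to time
`t`: the likelihood as long as there are observations, and `1` afterwards. -/
noncomputable def weight (t : ℕ) (y : ℕ → Fin N → ℝ) (k : ℕ) (x : State K) : ℝ :=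
  if k ≤ t then G.likelihood k (y k) x else 1

theorem unnormalized_eq_forward {n : ℕ} (P : Matrix (Cells K n) (Cells K n) ℝ)
    (E0 : Cells K n → ℝ) (y : ℕ → Fin N → ℝ) (t j : ℕ) (hj : j ≤ t + 1) :
    G.unnormalized n P E0 y j = forward P (G.center n) (G.weight t y) E0 j := by
  induction j with
  | zero => rfl
  | succ j ih =>
    funext l
    rw [unnormalized, forward, ih (by omega)]
    simp [likelihoodMatrix, Matrix.mulVec_diagonal, weight, Nat.lt_succ_iff.1 hj]

theorem pow_mulVec_unnormalized {n : ℕ} (P : Matrix (Cells K n) (Cells K n) ℝ)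
    (E0 : Cells K n → ℝ) (y : ℕ → Fin N → ℝ) (t ρ : ℕ) :
    P ^ ρ *ᵥ G.unnormalized n P E0 y (t + 1)
      = forward P (G.center n) (G.weight t y) E0 (t + ρ + 1) := by
  induction ρ with
  | zero => simpa using unnormalized_eq_forward P E0 y t (t + 1) le_rfl
  | succ ρ ih =>
    have : ¬ t + ρ + 1 ≤ t := by omega
    rw [pow_succ', ← Matrix.mulVec_mulVec, ih]
    funext l
    rw [show t + (ρ + 1) + 1 = t + ρ + 1 + 1 by ring]
    conv_rhs => rw [forward]
    simp only [weight, if_neg this, one_mul]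

theorem approxPredictor_eq_div {n : ℕ} (P : Matrix (Cells K n) (Cells K n) ℝ)
    (E0 : Cells K n → ℝ) (q : Plane) (ρ t : ℕ) (y : ℕ → Fin N → ℝ)
    (h0 : ∀ l, 0 ≤ G.unnormalized n P E0 y (t + 1) l) :
    G.approxPredictor q n P E0 ρ t y =
      (∑ l, forward P (G.center n) (G.weight t y) E0 (t + ρ + 1) l
        * G.target q ρ t y (G.center n l)) /
      ∑ l, forward P (G.center n) (G.weight t y) E0 (t + 1) l * 1 := by
  have hn : l1norm (G.unnormalized n P E0 y (t + 1))
      = ∑ l, forward P (G.center n) (G.weight t y) E0 (t + 1) l * 1 := by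
    simp only [l1norm, mul_one, ← unnormalized_eq_forward P E0 y t (t + 1) le_rfl]
    exact Finset.sum_congr rfl fun l _ => abs_of_nonneg (h0 l)
  rw [← hn, ← pow_mulVec_unnormalized, div_eq_inv_mul]
  by_cases hρ : ρ = 0
  · subst hρ
    simp only [approxPredictor, target, if_true, dotProduct_smul, smul_eq_mul, pow_zero,
      Matrix.one_mulVec]
    rw [dotProduct_comm]
    rfl
  · simp only [approxPredictor, target, if_neg hρ, ← Matrix.mulVec_mulVec, Matrix.mulVec_smul,
      dotProduct_smul, smul_eq_mul]
    congr 1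
    rw [Matrix.dotProduct_mulVec, dotProduct_comm]
    rfl

/-! ### Locally uniform convergence -/

/-- By compactness of the hypercube, a jointly continuous function is bounded uniformly in the state,
locally in the parameter. -/
theorem exists_eventually_bound_clamp (hG : G.Admissible) {Y : Type*} [TopologicalSpace Y]
    {g : Y → State K → ℝ} (hg : Continuous fun p : Y × State K => g p.1 (G.clamp p.2)) (y₀ : Y) :
    ∃ c, ∀ᶠ y in 𝓝 y₀, ∀ x, |g y (G.clamp x)| ≤ c := by
  obtain ⟨c, hc⟩ := exists_bound_comp_clamp hG (f := g y₀)
    (hg.comp (Continuous.prodMk continuous_const continuous_id))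
  have hbox : IsCompact G.box := isCompact_Icc
  have := hbox.eventually_forall_of_forall_eventually (x₀ := y₀)
    (P := fun y x => |g y (G.clamp x)| < c + 1) fun x _ =>
      (hg.abs.tendsto (y₀, x)).eventually_lt_const (lt_of_le_of_lt (hc x) (lt_add_one c))
  refine ⟨c + 1, this.mono fun y hy x => ?_⟩
  have := hy _ (clamp_mem hG x)
  rw [clamp_of_mem (clamp_mem hG x)] at this
  exact this.le

theorem continuous_weight_clamp (hG : G.Admissible) (t k : ℕ) :
    Continuous fun p : (ℕ → Fin N → ℝ) × State K => G.weight t p.1 k (G.clamp p.2) := by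
  unfold weight
  split_ifs
  · exact (continuous_likelihood_clamp hG k).comp
      (f := fun p : (ℕ → Fin N → ℝ) × State K => (p.1 k, p.2)) (by fun_prop)
  · exact continuous_const

variable {Ω : Type*} [m0 : MeasurableSpace Ω] {μ : Measure Ω} [IsProbabilityMeasure μ]
  {X : ℕ → Ω → State K}

theorem continuous_integral_prod_weight (hG : G.Admissible) (hX : ∀ k, Measurable (X k))
    (t m : ℕ) {u : (ℕ → Fin N → ℝ) → State K → ℝ}
    (hu : Continuous fun p : (ℕ → Fin N → ℝ) × State K => u p.1 (G.clamp p.2)) :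
    Continuous fun y => ∫ ω, (∏ k ∈ Finset.range m, G.weight t y k (G.clamp (X (k + 1) ω)))
      * u y (G.clamp (X m ω)) ∂μ := by
  have hcont : ∀ {g : (ℕ → Fin N → ℝ) → State K → ℝ},
      (Continuous fun p : (ℕ → Fin N → ℝ) × State K => g p.1 (G.clamp p.2)) →
      (∀ y k, Measurable fun ω => g y (G.clamp (X k ω))) ∧
        ∀ x, Continuous fun y => g y (G.clamp x) := fun {g} hg =>
    ⟨fun y k =>
      (hg.comp (Continuous.prodMk (continuous_const (y := y)) continuous_id)).measurable.comp (hX k),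
      fun x => hg.comp (Continuous.prodMk continuous_id continuous_const)⟩
  refine continuous_iff_continuousAt.2 fun y₀ => ?_
  choose c hc using fun k => exists_eventually_bound_clamp hG (g := fun y => G.weight t y k)
    (continuous_weight_clamp hG t k) y₀
  obtain ⟨cu, hcu⟩ := exists_eventually_bound_clamp hG hu y₀
  refine tendsto_integral_filter_of_dominated_convergence
    (fun _ => (∏ k ∈ Finset.range m, c k) * cu) (Eventually.of_forall fun y => ?_) ?_
    (integrable_const _) (ae_of_all _ fun ω => ?_)
  · exact ((Finset.measurable_prod _ fun k _ =>
      (hcont (g := fun y => G.weight t y k) (continuous_weight_clamp hG t k)).1 y (k + 1)).mul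
        ((hcont hu).1 y m)).aestronglyMeasurable
  · filter_upwards [(Finset.range m).eventually_all.2 fun k _ => hc k, hcu] with y hy hyu
    refine ae_of_all _ fun ω => ?_
    rw [Real.norm_eq_abs, abs_mul, Finset.abs_prod]
    exact mul_le_mul (Finset.prod_le_prod (fun _ _ => abs_nonneg _) fun k hk => hy k hk _) (hyu _)
      (abs_nonneg _) (Finset.prod_nonneg fun k hk => (abs_nonneg _).trans (hy k hk (X 0 ω)))
  · exact ((continuous_finsetProd _ fun k _ =>
      (hcont (g := fun y => G.weight t y k) (continuous_weight_clamp hG t k)).2 _).mul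
      ((hcont hu).2 _)).tendsto y₀

/-- The sums over the grid converge to the expectations that they approximate, along refinements of
the grid and jointly with the realization of the observations. -/
theorem tendsto_sum_forward (hG : G.Admissible) {Z : ∀ n, ℕ → Ω → Cells K n}
    {P : ∀ n, Matrix (Cells K n) (Cells K n) ℝ} {𝒮 𝒢 : ℕ → MeasurableSpace Ω}
    {𝒜 : ℕ → ℕ → MeasurableSpace Ω}
    (h : IsConsistentApproximation μ X Z G.center P 𝒮 𝒢 𝒜) (t m : ℕ)
    {u : (ℕ → Fin N → ℝ) → State K → ℝ}
    (hu : Continuous fun p : (ℕ → Fin N → ℝ) × State K => u p.1 (G.clamp p.2))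
    (y₀ : ℕ → Fin N → ℝ) :
    Tendsto (fun a : ℕ × (ℕ → Fin N → ℝ) => ∑ l, forward (P a.1) (G.center a.1) (G.weight t a.2)
        (meanBasisVector μ (Z a.1 0)) m l * u a.2 (G.center a.1 l))
      (atTop ×ˢ 𝓝 y₀)
      (𝓝 (∫ ω, (∏ k ∈ Finset.range m, G.weight t y₀ k (G.clamp (X (k + 1) ω)))
        * u y₀ (G.clamp (X m ω)) ∂μ)) := by
  have hseq : ∀ {g : (ℕ → Fin N → ℝ) → State K → ℝ},
      (Continuous fun p : (ℕ → Fin N → ℝ) × State K => g p.1 (G.clamp p.2)) →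
      ∀ (x : State K) (xa : ℕ × (ℕ → Fin N → ℝ) → State K), Tendsto xa (atTop ×ˢ 𝓝 y₀) (𝓝 x) →
        Tendsto (fun a => g a.2 (G.clamp (xa a))) (atTop ×ˢ 𝓝 y₀) (𝓝 (g y₀ (G.clamp x))) := by
    intro g hg x xa hxa
    exact (hg.tendsto (y₀, x)).comp (tendsto_snd.prodMk_nhds hxa)
  have hcont : ∀ {g : (ℕ → Fin N → ℝ) → State K → ℝ},
      (Continuous fun p : (ℕ → Fin N → ℝ) × State K => g p.1 (G.clamp p.2)) →
      Continuous fun x => g y₀ (G.clamp x) := fun {g} hg =>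
    hg.comp (Continuous.prodMk continuous_const continuous_id)
  choose c hc using fun k => exists_eventually_bound_clamp hG (g := fun y => G.weight t y k)
    (continuous_weight_clamp hG t k) y₀
  obtain ⟨cu, hcu⟩ := exists_eventually_bound_clamp hG hu y₀
  obtain ⟨U, hUm, ⟨cU, hcU⟩, hlim, hint⟩ := tendsto_backward h (F := atTop ×ˢ 𝓝 y₀) (ν := Prod.fst)
    tendsto_fst (u := fun a x => u a.2 (G.clamp x)) (u₀ := fun x => u y₀ (G.clamp x)) (hcont hu)
    (hseq hu) (tendsto_snd.eventually hcu) hcu.self_of_nhds m 0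
    (fun a k x => G.weight t a.2 k (G.clamp x)) (fun k x => G.weight t y₀ k (G.clamp x)) c
    (fun k => hcont (g := fun y => G.weight t y k) (continuous_weight_clamp hG t k))
    (fun k => hseq (g := fun y => G.weight t y k) (continuous_weight_clamp hG t k))
    (fun k => tendsto_snd.eventually (hc k))
    fun k => (hc k).self_of_nhds
  have hUi : Integrable U μ := Integrable.of_bound (hUm.mono (h.present_le 0)) cU hcU
  have hone := hint (fun _ => 1) aestronglyMeasurable_const ⟨1, by simp⟩
  simp only [one_mul, zero_add] at hone
  rw [← hone, tendsto_iff_norm_sub_tendsto_zero]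
  refine squeeze_zero (fun _ => norm_nonneg _) (fun a => ?_) hlim
  have hcl : ∀ l, G.clamp (G.center a.1 l) = G.center a.1 l := fun l =>
    clamp_of_mem (center_mem hG a.1 l)
  have hforw : ∑ l, forward (P a.1) (G.center a.1) (G.weight t a.2)
        (meanBasisVector μ (Z a.1 0)) m l * u a.2 (G.center a.1 l)
      = ∫ ω, backward (P a.1) (G.center a.1) (fun x => u a.2 (G.clamp x)) m
          (fun k x => G.weight t a.2 k (G.clamp x)) (Z a.1 0 ω) ∂μ := by
    rw [← sum_meanBasisVector_mul (h.measurable_Z a.1 0), ← sum_forward_mul,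
      forward_congr _ _ (w := fun k x => G.weight t a.2 k (G.clamp x)) (w' := G.weight t a.2)
        fun k l => by simp only [hcl]]
    simp only [hcl]
  rw [hforw, ← integral_sub ?_ hUi]
  · exact norm_integral_le_integral_norm _
  · let v : Cells K a.1 → ℝ := backward (P a.1) (G.center a.1) (fun x => u a.2 (G.clamp x)) m
      (fun k x => G.weight t a.2 k (G.clamp x))
    obtain ⟨C, hC⟩ := (Set.finite_range fun i => |v i|).bddAbove
    exact Integrable.of_bound ((Measurable.of_discrete (f := v)).comp
      (h.measurable_Z a.1 0)).aestronglyMeasurable C (ae_of_all _ fun ω => hC ⟨_, rfl⟩)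

/-- Convergence along `atTop ×ˢ 𝓝 y₀` for every `y₀`, together with the continuity of the limit, is
locally uniform convergence. -/
theorem tendstoLocallyUniformly_approxPredictor (hG : G.Admissible)
    {Z : ∀ n, ℕ → Ω → Cells K n}
    {P : ∀ n, Matrix (Cells K n) (Cells K n) ℝ} {𝒮 𝒢 : ℕ → MeasurableSpace Ω}
    {𝒜 : ℕ → ℕ → MeasurableSpace Ω}
    (h : IsConsistentApproximation μ X Z G.center P 𝒮 𝒢 𝒜)
    (hP : ∀ n, IsTransitionMatrix μ (Z n) (P n)) {q : Plane}
    (hcross : ∀ t i, ContinuousOn (fun θ => G.R q (G.p t i) θ) G.paramBox) (ρ t : ℕ) :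
    TendstoLocallyUniformly
      (fun n y => G.approxPredictor q n (P n) (meanBasisVector μ (Z n 0)) ρ t y)
      (G.bayesPredictor μ X q ρ t) atTop := by
  have hpos : ∀ (y : ℕ → Fin N → ℝ) k ω, 0 < G.likelihood k (y k) (G.clamp (X (k + 1) ω)) :=
    fun y k ω => likelihood_pos hG k _ (clamp_mem hG _)
  have hnum : ∀ (y : ℕ → Fin N → ℝ) ω,
      ∏ k ∈ Finset.range (t + ρ + 1), G.weight t y k (G.clamp (X (k + 1) ω))
      = ∏ k ∈ Finset.range (t + 1), G.likelihood k (y k) (G.clamp (X (k + 1) ω)) := by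
    intro y ω
    symm
    refine Finset.prod_subset_one_on_sdiff (fun k hk => ?_) (fun k hk => ?_) fun k hk => ?_
    · simp only [Finset.mem_range] at hk ⊢; omega
    · simp only [Finset.mem_sdiff, Finset.mem_range, not_lt] at hk
      rw [weight, if_neg (by omega)]
    · rw [weight, if_pos (Nat.lt_succ_iff.1 (Finset.mem_range.1 hk))]
  have hden : ∀ (y : ℕ → Fin N → ℝ) ω,
      ∏ k ∈ Finset.range (t + 1), G.weight t y k (G.clamp (X (k + 1) ω))
      = ∏ k ∈ Finset.range (t + 1), G.likelihood k (y k) (G.clamp (X (k + 1) ω)) := fun y ω =>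
    Finset.prod_congr rfl fun k hk => by
      rw [weight, if_pos (Nat.lt_succ_iff.1 (Finset.mem_range.1 hk))]
  have hbayes : G.bayesPredictor μ X q ρ t = fun y =>
      (∫ ω, (∏ k ∈ Finset.range (t + ρ + 1), G.weight t y k (G.clamp (X (k + 1) ω)))
        * G.target q ρ t y (G.clamp (X (t + ρ + 1) ω)) ∂μ) /
      ∫ ω, (∏ k ∈ Finset.range (t + 1), G.weight t y k (G.clamp (X (k + 1) ω))) * 1 ∂μ := by
    funext y
    simp only [bayesPredictor, hnum, hden, mul_one]
  have hone : Continuous fun p : (ℕ → Fin N → ℝ) × State K =>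
      (fun _ _ => (1 : ℝ) : (ℕ → Fin N → ℝ) → State K → ℝ) p.1 (G.clamp p.2) := continuous_const
  have htar := continuous_target_clamp hG hcross ρ t
  have hZpos : ∀ y, 0 < ∫ ω, (∏ k ∈ Finset.range (t + 1),
      G.weight t y k (G.clamp (X (k + 1) ω))) * 1 ∂μ := by
    intro y
    simp only [mul_one, hden]
    have hlik : ∀ k, Continuous fun x => G.likelihood k (y k) (G.clamp x) := fun k =>
      (continuous_likelihood_clamp hG k).comp (Continuous.prodMk continuous_const continuous_id)
    choose c hc using fun k => exists_bound_comp_clamp hG (hlik k)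
    have hint : Integrable (fun ω => ∏ k ∈ Finset.range (t + 1),
        G.likelihood k (y k) (G.clamp (X (k + 1) ω))) μ := by
      refine Integrable.of_bound (Finset.measurable_prod _ fun k _ =>
        (hlik k).measurable.comp (h.measurable_X (k + 1))).aestronglyMeasurable
        (∏ k ∈ Finset.range (t + 1), c k) (ae_of_all _ fun ω => ?_)
      rw [Real.norm_eq_abs, Finset.abs_prod]
      exact Finset.prod_le_prod (fun _ _ => abs_nonneg _) fun k _ => hc k _
    have hprod : ∀ ω, 0 < ∏ k ∈ Finset.range (t + 1),
        G.likelihood k (y k) (G.clamp (X (k + 1) ω)) := fun ω =>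
      Finset.prod_pos fun k _ => hpos y k ω
    rw [integral_pos_iff_support_of_nonneg (fun ω => (hprod ω).le) hint,
      Function.support_eq_univ fun ω => (hprod ω).ne', measure_univ]
    exact one_pos
  have hcont : Continuous (G.bayesPredictor μ X q ρ t) := by
    rw [hbayes]
    exact (continuous_integral_prod_weight hG h.measurable_X t _ htar).div
      (continuous_integral_prod_weight hG h.measurable_X t (t + 1) (u := fun _ _ => 1) hone)
      fun y => (hZpos y).ne'
  rw [tendstoLocallyUniformly_iff_forall_tendsto]
  intro y₀
  have hlim : Tendsto (fun a : ℕ × (ℕ → Fin N → ℝ) =>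
      G.approxPredictor q a.1 (P a.1) (meanBasisVector μ (Z a.1 0)) ρ t a.2)
      (atTop ×ˢ 𝓝 y₀) (𝓝 (G.bayesPredictor μ X q ρ t y₀)) := by
    simp only [hbayes]
    refine ((tendsto_sum_forward hG h t (t + ρ + 1) htar y₀).div
      (tendsto_sum_forward hG h t (t + 1) (u := fun _ _ => 1) hone y₀) (hZpos y₀).ne').congr
      fun a => ?_
    refine (approxPredictor_eq_div _ _ q ρ t a.2 ?_).symm
    refine (unnormalized_nonneg_and_sum_pos hG (hP a.1).nonneg (hP a.1).colSum
      (meanBasisVector_nonneg μ _) ?_ a.2 (t + 1)).1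
    exact sum_meanBasisVector_pos (h.measurable_Z a.1 0)
  have := ((hcont.tendsto y₀).comp tendsto_snd).prodMk_nhds hlim
  exact this.mono_right (nhds_le_uniformity _)

theorem IsObservationModel.exists_isConsistentApproximation (hG : G.Admissible) {q : Plane}
    {sh : ℕ → Ω → EuclideanSpace ℝ (Option (Fin N))} {ξ : ℕ → Option (Fin N) → Ω → ℝ}
    (hobs : G.IsObservationModel μ q X sh ξ) {Z : ∀ n, ℕ → Ω → Cells K n}
    (hZ : (∃ (d : ℕ) (Wset : Set (Fin d → ℝ)) (f : State K → (Fin d → ℝ) → State K)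
            (W : ℕ → Ω → (Fin d → ℝ)), G.IsLipschitzDynamics μ X Wset f W ∧
            ∀ n, Z n = G.markovianQuantization n (X 0) f W) ∨
          (∃ κ : Kernel (State K) (State K), IsMarkovKernel κ ∧ IsMarkovChain μ X κ ∧
            G.ConditionallyRegular κ ∧ ∀ n, Z n = G.marginalQuantization n X))
    {P : ∀ n, Matrix (Cells K n) (Cells K n) ℝ} (hP : ∀ n, IsTransitionMatrix μ (Z n) (P n)) :
    ∃ (𝒮 𝒢 : ℕ → MeasurableSpace Ω) (𝒜 : ℕ → ℕ → MeasurableSpace Ω),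
      IsConsistentApproximation μ X Z G.center P 𝒮 𝒢 𝒜 := by
  rcases hZ with ⟨d, Wset, f, W, hdyn, hZ⟩ | ⟨κ, hκ, hchain, -, hZ⟩
  · obtain rfl : Z = fun n => G.markovianQuantization n (X 0) f W := funext hZ
    exact ⟨_, _, _, hdyn.isConsistentApproximation hG hobs.measurable_X hobs.X_mem hP⟩
  · obtain rfl : Z = fun n => G.marginalQuantization n X := funext hZ
    exact ⟨_, _, _, hchain.isConsistentApproximation hG hobs.measurable_X hobs.X_mem hP⟩

end Network

end ChannelPrediction

/-! ### Uniform convergence on a set of large probability -/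

theorem theorem4 {Ω : Type*} [MeasurableSpace Ω] (μ : Measure Ω) [IsProbabilityMeasure μ]
    {N K : ℕ} (hN : 0 < N) (G : ChannelPrediction.Network N K) (hG : G.Admissible)
    (q : ChannelPrediction.Plane) (hqS : q ∈ G.S) (hq : q ≠ G.pref)
    (hcross : ∀ t i, ContinuousOn (fun θ => G.R q (G.p t i) θ) G.paramBox)
    (X : ℕ → Ω → ChannelPrediction.State K)
    (sh : ℕ → Ω → EuclideanSpace ℝ (Option (Fin N))) (ξ : ℕ → Option (Fin N) → Ω → ℝ)
    (hobs : G.IsObservationModel μ q X sh ξ)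
    -- the observations at the sensors, the log-magnitude at `q`, and the observation filtration
    (y : ℕ → Ω → Fin N → ℝ) (hy : y = fun t ω i => G.augObs q X sh ξ t (some i) ω)
    (yq : ℕ → Ω → ℝ) (hyq : yq = fun t ω => G.augObs q X sh ξ t none ω)
    (Y : ℕ → MeasurableSpace Ω)
    (hY : Y = fun t => ⨆ i ≤ t, MeasurableSpace.comap (y i) inferInstance)
    -- the quantized state at resolution `n + 1`, and its transition matrix
    (Z : ∀ n, ℕ → Ω → ChannelPrediction.Cells K n)
    (hZ : (∃ (d : ℕ) (Wset : Set (Fin d → ℝ))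
            (f : ChannelPrediction.State K → (Fin d → ℝ) → ChannelPrediction.State K)
            (W : ℕ → Ω → (Fin d → ℝ)), G.IsLipschitzDynamics μ X Wset f W ∧
            ∀ n, Z n = G.markovianQuantization n (X 0) f W) ∨
          (∃ κ : Kernel (ChannelPrediction.State K) (ChannelPrediction.State K),
            IsMarkovKernel κ ∧ ChannelPrediction.Network.IsMarkovChain μ X κ ∧
            G.ConditionallyRegular κ ∧ ∀ n, Z n = G.marginalQuantization n X))
    (P : ∀ n, Matrix (ChannelPrediction.Cells K n) (ChannelPrediction.Cells K n) ℝ)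
    (hP : ∀ n, ChannelPrediction.IsTransitionMatrix μ (Z n) (P n)) :
    (∀ t, MemLp (yq t) 2 μ) ∧
    (∀ n t ω, 0 < ChannelPrediction.l1norm
      (G.unnormalized n (P n) (ChannelPrediction.meanBasisVector μ (Z n 0))
        (fun s => y s ω) (t + 1))) ∧
    ∀ (T : ℕ) (C : ℝ), 1 ≤ C → ∃ Ωhat : Set Ω, MeasurableSet Ωhat ∧
      ENNReal.ofReal (1 - ((T : ℝ) + 1) ^ (1 - C * N) * Real.exp (-(C * N))) ≤ μ Ωhat ∧
      ∀ ρ : ℕ, Tendsto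
        (fun n : ℕ => ⨆ t ∈ Set.Iic T, ⨆ ω ∈ Ωhat,
          ‖G.approxPredictor q n (P n) (ChannelPrediction.meanBasisVector μ (Z n 0)) ρ t
              (fun s => y s ω)
            - (μ[yq (t + ρ) | Y t]) ω‖ₑ)
        atTop (𝓝 0) := by
  obtain ⟨𝒮, 𝒢, 𝒜, hcons⟩ := hobs.exists_isConsistentApproximation hG hZ hP
  have hym : Measurable fun ω s => y s ω :=
    measurable_pi_lambda _ fun s => hobs.measurable_sensor y hy s
  refine ⟨fun t => by rw [hyq]; exact hobs.memLp_augObs hG hN hqS t, fun n t ω => ?_,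
    fun T C hC => ?_⟩
  · obtain ⟨h0, hpos⟩ := ChannelPrediction.Network.unnormalized_nonneg_and_sum_pos hG
      (hP n).nonneg (hP n).colSum (ChannelPrediction.meanBasisVector_nonneg μ (Z n 0))
      (ChannelPrediction.sum_meanBasisVector_pos (hcons.measurable_Z n 0)) (fun s => y s ω) (t + 1)
    rwa [ChannelPrediction.l1norm, Finset.sum_congr rfl fun l _ => abs_of_nonneg (h0 l)]
  · set ε : ℝ := ((T : ℝ) + 1) ^ (1 - C * N) * Real.exp (-(C * N)) with hε
    have hε0 : 0 < ε := by positivity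
    -- The law of the observations is tight: a compact set of realizations carries most of it.
    have hlaw : IsProbabilityMeasure (μ.map fun ω s => y s ω) :=
      Measure.isProbabilityMeasure_map hym.aemeasurable
    obtain ⟨A, -, hA, hAε⟩ := MeasurableSet.univ.exists_isCompact_lt_add
      (measure_ne_top (μ.map fun ω s => y s ω) _) (ε := ENNReal.ofReal ε) (by simpa using hε0)
    rw [measure_univ, Measure.map_apply hym hA.measurableSet] at hAε
    have hae : ∀ᵐ ω ∂μ, ∀ t ρ, (μ[yq (t + ρ) | Y t]) ω
        = G.bayesPredictor μ X q ρ t (fun s => y s ω) := by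
      refine ae_all_iff.2 fun t => ae_all_iff.2 fun ρ => ?_
      rw [hyq, hY]
      exact hobs.condExp_eq_bayesPredictor hG hN hqS hcross ρ t y hy
    set D := toMeasurable μ {ω | ∀ t ρ, (μ[yq (t + ρ) | Y t]) ω
        = G.bayesPredictor μ X q ρ t (fun s => y s ω)}ᶜ with hD
    have hD0 : μ D = 0 := by rw [hD, measure_toMeasurable]; exact hae
    refine ⟨((fun ω s => y s ω) ⁻¹' A) \ D, (hym hA.measurableSet).diff
      (measurableSet_toMeasurable _ _), ?_, fun ρ => ?_⟩
    · rw [measure_sdiff_null hD0, ENNReal.ofReal_sub _ hε0.le, ENNReal.ofReal_one]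
      exact tsub_le_iff_right.2 hAε.le
    · rw [ENNReal.tendsto_nhds_zero]
      intro δ hδ
      have hunif : ∀ t ∈ Set.Iic T, ∀ᶠ n in atTop, ∀ v ∈ A,
          edist (G.bayesPredictor μ X q ρ t v) (G.approxPredictor q n (P n)
            (ChannelPrediction.meanBasisVector μ (Z n 0)) ρ t v) < δ := fun t _ =>
        EMetric.tendstoUniformlyOn_iff.1
          ((tendstoLocallyUniformlyOn_iff_tendstoUniformlyOn_of_compact hA).1
            (ChannelPrediction.Network.tendstoLocallyUniformly_approxPredictor hG hcons hP hcross
              ρ t).tendstoLocallyUniformlyOn) δ hδ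
      filter_upwards [(eventually_all_finite (Set.finite_Iic T)).2 hunif] with n hn
      refine iSup₂_le fun t ht => iSup₂_le fun ω hω => ?_
      have hgood : (μ[yq (t + ρ) | Y t]) ω = G.bayesPredictor μ X q ρ t (fun s => y s ω) := by
        by_contra hne
        exact hω.2 (subset_toMeasurable _ _ fun hall => hne (hall t ρ))
      rw [hgood, ← edist_eq_enorm_sub, edist_comm]
      exact (hn t ht _ hω.1).le
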